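/- Let $n\ge 3$, $I=(-1,1)$, and write $\mathbb{R}^n=\mathbb{R}^{n-1}\times\mathbb{R}$. An \emph{ovaloid} is a closed (compact, connected) embedded smooth hypersurface of a Euclidean space all of whose principal curvatures with respect to the outer unit normal are positive; it is \emph{central} if it is invariant under the reflection through some point. By Hadamard's theorem the Gauss map of an ovaloid $\mathcal{O}\subset\mathbb{R}^{n-1}$ is a diffeomorphism $\mathcal{O}\to\mathbb{S}^{n-2}$; its inverse is called the support parameterization of $\mathcal{O}$. Let $c\colon I\to\mathbb{R}^{n-1}$ and $\alpha\colon\mathbb{S}^{n-2}\times I\to\mathbb{R}^{n-1}$ be smooth maps such that $X(u,z)=(c(z)+\alpha(u,z),z)$ is a smooth embedding of $\mathbb{S}^{n-2}\times I$ into $\mathbb{R}^n$ and such that, for each $z\in I$, $\alpha(\cdot,z)$ parameterizes an ovaloid with center of mass at the origin. The image $\mathcal{T}$ of $X$ is a \emph{transversely convex tube in standard position}. Suppose that $\mathcal{T}$ has the \emph{central ovaloid property}: calling \emph{cross-cut} any compact connected component of $X^{-1}(H)$, where $H\subset\mathbb{R}^n$ is a hyperplane transversal to $X$, there is at least one cross-cut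 whose image under $X$ is an ovaloid in $H$, and every such ovaloid is central. For $z\in I$ let $\Gamma(\cdot,z)\colon\mathbb{S}^{n-2}\to\mathbb{R}^{n-1}$ be the support parameterization of the ovaloid $\{y\in\mathbb{R}^{n-1}:(y,z)\in\mathcal{T}\}$, let $\Gamma^-(u,z)=\tfrac12\bigl(\Gamma(u,z)-\Gamma(-u,z)\bigr)$, and let $h(u,z)=u\cdot\Gamma^-(u,z)$ be the transverse support function (of the rectified tube $\mathcal{T}^-$, the image of $(u,z)\mapsto(\alpha(u,z),z)$). Let $\nabla$ and $\Delta$ denote the gradient and the Laplace--Beltrami operator of the unit sphere $\mathbb{S}^{n-2}$, acting in the variable $u$, and let $\nabla_v$ be its Levi-Civita connection. Then $h$ is smooth on $\mathbb{S}^{n-2}\times I$, and at every $(u,z)\in\mathbb{S}^{n-2}\times I$ $$\frac{\partial h}{\partial z}\,\nabla\bigl[\Delta h+(n-2)h\bigr]+\frac{\partial}{\partial z}\bigl[\Delta h+(n-2)h\bigr]\,\nabla h+2\Bigl\{h\,\nabla\frac{\partial h}{\partial z}+\nabla_{\nabla\frac{\partial h}{\partial z}}\nabla h\Bigr\}=0,$$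 $$h\,\frac{\partial}{\partial z}\bigl[\Delta h+(n-2)h\bigr]-\bigl[\Delta h+(n-2)h\bigr]\frac{\partial h}{\partial z}=0.$$ -/

import Mathlib

open Set MeasureTheory
open scoped Manifold ContDiff Topology InnerProductSpace

noncomputable section

/-! ### Ovaloids, outer unit normals, support parameterizations -/

section Ovaloid

variable {E : Type*} [NormedAddCommGroup E] [InnerProductSpace ℝ E] [CompleteSpace E]

/-- The union of the unbounded connected components of the complement of `O`
(a single component when `O` is compact and `dim E ≥ 2`). -/
def outside (O : Set E) : Set E :=
  {x | x ∈ Oᶜ ∧ ¬ Bornology.IsBounded (connectedComponentIn Oᶜ x)}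

/-- The unit normal field `∇f / |∇f|` of the level sets of `f`. -/
def unitNormal (f : E → ℝ) (x : E) : E :=
  ‖gradient f x‖⁻¹ • gradient f x

/-- On the open set `U`, the set `O` is the regular zero set of the smooth function `f`, and `f` is
positive precisely on the outside of `O`; thus `unitNormal f` is the outer unit normal on `O ∩ U`. -/
structure IsOuterDefiningFunction (O U : Set E) (f : E → ℝ) : Prop where
  isOpen : IsOpen U
  smooth : ContDiffOn ℝ ∞ f U
  regular : ∀ x ∈ U, gradient f x ≠ 0
  zero_iff : ∀ x ∈ U, f x = 0 ↔ x ∈ O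
  pos_iff : ∀ x ∈ U, 0 < f x ↔ x ∈ outside O

/-- `κ` is a principal curvature at `p` of the level set of `f` through `p`, with respect to the
unit normal `∇f / |∇f|`: an eigenvalue of the differential of the unit normal field on the
tangent space `(∇f(p))^⊥`. -/
def IsPrincipalCurvature (f : E → ℝ) (p : E) (κ : ℝ) : Prop :=
  ∃ v : E, v ≠ 0 ∧ ⟪gradient f p, v⟫_ℝ = 0 ∧ fderiv ℝ (unitNormal f) p v = κ • v

/-- An ovaloid: a closed (compact, connected) embedded smooth hypersurface all of whose principal
curvatures with respect to the outer unit normal are positive everywhere. -/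
structure IsOvaloid (O : Set E) : Prop where
  isCompact : IsCompact O
  isConnected : IsConnected O
  curvature_pos : ∀ p ∈ O, ∃ (U : Set E) (f : E → ℝ), p ∈ U ∧ IsOuterDefiningFunction O U f ∧
    ∀ κ : ℝ, IsPrincipalCurvature f p κ → 0 < κ

/-- `ν` is the outer unit normal of the hypersurface `O` at the point `p`. -/
def IsOuterUnitNormal (O : Set E) (p ν : E) : Prop :=
  ∃ (U : Set E) (f : E → ℝ), p ∈ U ∧ p ∈ O ∧ IsOuterDefiningFunction O U f ∧ ν = unitNormal f p

/-- The Gauss map of `O`: the outer unit normal at `p ∈ O`. -/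
def gaussMap (O : Set E) (p : E) : E :=
  Classical.epsilon (IsOuterUnitNormal O p)

/-- The support parameterization of an ovaloid: the inverse of its Gauss map. -/
def supportParam (O : Set E) : E → E :=
  Function.invFunOn (gaussMap O) O

/-- A set is central if it is invariant under the reflection through some point. -/
def IsCentral (S : Set E) : Prop :=
  ∃ c : E, ∀ x ∈ S, Equiv.pointReflection c x ∈ S

/-- The hyperplane `{x : w · x = a}` (for `w ≠ 0`). -/
def hyperplane (w : E) (a : ℝ) : Set E :=
  {x | ⟪w, x⟫_ℝ = a}

/-- `O` is an ovaloid in the hyperplane `{x : w · x = a}`, which is identified with the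
Euclidean space `w^⊥` by the choice of an origin `q`. -/
def IsOvaloidInHyperplane (w : E) (a : ℝ) (O : Set E) : Prop :=
  O ⊆ hyperplane w a ∧
    ∃ q ∈ hyperplane w a, IsOvaloid {y : ((ℝ ∙ w)ᗮ : Submodule ℝ E) | q + (y : E) ∈ O}

end Ovaloid

/-! ### Cross-cuts and the central ovaloid property -/

section Cop

variable {V : Type*} [NormedAddCommGroup V] [InnerProductSpace ℝ V] [CompleteSpace V]
  {B : Type*} [NormedAddCommGroup B] [NormedSpace ℝ B] {H : Type*} [TopologicalSpace H]
  (J : ModelWithCorners ℝ B H) {M : Type*} [TopologicalSpace M] [ChartedSpace H M]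

/-- The hyperplane `{x : w · x = a}` is transversal to the restriction of `F` to the open
submanifold `D` of `M`. -/
def IsTransversal (F : M → V) (D : Set M) (w : V) (a : ℝ) : Prop :=
  ∀ p ∈ D, F p ∈ hyperplane w a →
    LinearMap.range (mvfderiv J F p).toLinearMap ⊔ (ℝ ∙ w)ᗮ = ⊤

/-- `C` is a cross-cut of `F : D → V` relative to the hyperplane `{x : w · x = a}`: the hyperplane is
transversal to `F`, and `C` is a compact connected component of the preimage of the hyperplane. -/
structure IsCrossCut (F : M → V) (D : Set M) (w : V) (a : ℝ) (C : Set M) : Prop where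
  ne_zero : w ≠ 0
  transversal : IsTransversal J F D w a
  isComponent : ∃ p ∈ D ∩ F ⁻¹' hyperplane w a,
    C = connectedComponentIn (D ∩ F ⁻¹' hyperplane w a) p
  isCompact : IsCompact C

/-- The central ovaloid property of the immersion `F : D → V`, where `D` is an open submanifold
of `M`: some cross-cut has an ovaloid as its image, and every such ovaloid is central. -/
def HasCop (F : M → V) (D : Set M) : Prop :=
  (∃ (w : V) (a : ℝ) (C : Set M),
    IsCrossCut J F D w a C ∧ IsOvaloidInHyperplane w a (F '' C)) ∧
  ∀ (w : V) (a : ℝ) (C : Set M),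
    IsCrossCut J F D w a C → IsOvaloidInHyperplane w a (F '' C) → IsCentral (F '' C)

end Cop

/-! ### Transversely convex tubes in standard position (`d = n - 2`) -/

/-- `ℝ^{n-1}`, with `d = n - 2`. -/
abbrev Horiz (d : ℕ) : Type := EuclideanSpace ℝ (Fin (d + 1))

/-- The unit sphere `S^{n-2}` of `ℝ^{n-1}`, with `d = n - 2`. -/
abbrev USphere (d : ℕ) : Type := Metric.sphere (0 : Horiz d) 1

/-- `ℝ^n = ℝ^{n-1} × ℝ` with its Euclidean structure, `d = n - 2`. -/
abbrev Ambient (d : ℕ) : Type := WithLp 2 (Horiz d × ℝ)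

/-- The model with corners of the manifold `S^{n-2} × ℝ`. -/
abbrev tubeModel (d : ℕ) := (𝓡 d).prod 𝓘(ℝ, ℝ)

/-- The open submanifold `S^{n-2} × I` of `S^{n-2} × ℝ`, with `I = (-1, 1)`. -/
def tubeDomain (d : ℕ) : Set (USphere d × ℝ) := univ ×ˢ Ioo (-1) 1

/-- `X(u, z) = (c(z) + α(u, z), z)`. -/
def tubeMap {d : ℕ} (c : ℝ → Horiz d) (α : USphere d → ℝ → Horiz d) :
    USphere d × ℝ → Ambient d :=
  fun p => WithLp.toLp 2 (c p.2 + α p.1 p.2, p.2)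

/-- The map `X(u, z) = (c(z) + α(u, z), z)` on `S^{n-2} × I` is a transversely convex tube in standard
position: `c` and `α` are smooth, `X` is a smooth embedding (a topological embedding and an
immersion), and each `α(·, z)` parameterizes an ovaloid with center of mass at the origin. -/
structure IsTransverselyConvexTube {d : ℕ} (c : ℝ → Horiz d) (α : USphere d → ℝ → Horiz d) :
    Prop where
  smooth_center : ContDiffOn ℝ ∞ c (Ioo (-1) 1)
  smooth_shape : ContMDiffOn (tubeModel d) 𝓘(ℝ, Horiz d) ∞
    (fun p : USphere d × ℝ => α p.1 p.2) (tubeDomain d)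
  isEmbedding : Topology.IsEmbedding ((tubeDomain d).domRestrict (tubeMap c α))
  immersion : ∀ p ∈ tubeDomain d,
    Function.Injective (mvfderiv (tubeModel d) (tubeMap c α) p)
  ovaloid : ∀ z ∈ Ioo (-1 : ℝ) 1, IsOvaloid (range fun u => α u z)
  centered : ∀ z ∈ Ioo (-1 : ℝ) 1, ∫ x in range (fun u => α u z), x ∂(μH[(d : ℝ)]) = 0

/-- The tube `𝒯`, the image of `X`. -/
def tube {d : ℕ} (c : ℝ → Horiz d) (α : USphere d → ℝ → Horiz d) : Set (Ambient d) :=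
  tubeMap c α '' tubeDomain d

/-- The horizontal cross-section of `T` at height `z`, as a subset of `ℝ^{n-1}`. -/
def crossSection {d : ℕ} (T : Set (Ambient d)) (z : ℝ) : Set (Horiz d) :=
  {y | WithLp.toLp 2 (y, z) ∈ T}

/-- The support map `Γ(u, z)` of the tube `T`: for each height `z`, the support parameterization of
the horizontal cross-section. -/
def supportMap {d : ℕ} (T : Set (Ambient d)) (u : Horiz d) (z : ℝ) : Horiz d :=
  supportParam (crossSection T z) u

/-- The odd part `Γ⁻(u, z)` in `u` of the support map. -/
def oddSupportMap {d : ℕ} (T : Set (Ambient d)) (u : Horiz d) (z : ℝ) : Horiz d :=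
  (1 / 2 : ℝ) • (supportMap T u z - supportMap T (-u) z)

/-- The transverse support function `h(u, z) = u · Γ⁻(u, z)`; only its values at unit vectors `u` and
`z ∈ (-1, 1)` are meaningful. -/
def transverseSupport {d : ℕ} (T : Set (Ambient d)) (u : Horiz d) (z : ℝ) : ℝ :=
  ⟪u, oddSupportMap T u z⟫_ℝ

/-! ### Calculus on the unit sphere

Functions and tangent vector fields on the sphere are represented by functions on the ambient
Euclidean space of which only the values on the unit sphere are used. -/

section Sphere

variable {E : Type*} [NormedAddCommGroup E] [InnerProductSpace ℝ E] [CompleteSpace E]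

/-- The radially constant extension of the restriction of `g` to the unit sphere. -/
def radialExt {A : Type*} (g : E → A) : E → A :=
  fun x => g (‖x‖⁻¹ • x)

/-- The spherical gradient of `g` at the unit vector `u` (a vector tangent to the sphere). -/
def sphGrad (g : E → ℝ) (u : E) : E :=
  gradient (radialExt g) u

/-- The Levi-Civita connection of the unit sphere, `v ↦ ∇_v Y` at `u`: the tangential part of the
Euclidean derivative of `Y` in the tangent direction `v`. It vanishes on the normal vector `u`. -/
def sphCov (Y : E → E) (u : E) : E →L[ℝ] E :=
  ((ℝ ∙ u)ᗮ : Submodule ℝ E).starProjection ∘L fderiv ℝ (radialExt Y) u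

/-- The spherical divergence: the trace of `v ↦ ∇_v Y`. -/
def sphDiv (Y : E → E) (u : E) : ℝ :=
  LinearMap.trace ℝ E (sphCov Y u : E →ₗ[ℝ] E)

/-- The Laplace-Beltrami operator of the unit sphere. -/
def sphLaplacian (g : E → ℝ) (u : E) : ℝ :=
  sphDiv (sphGrad g) u

end Sphere

/-- `Δh(u, z) + (n - 2) h(u, z)`, with `d = n - 2`. -/
def radiiSum {d : ℕ} (h : Horiz d → ℝ → ℝ) (u : Horiz d) (z : ℝ) : ℝ :=
  sphLaplacian (fun v => h v z) u + (d : ℝ) * h u z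

/-- The partial derivative `∂h/∂z (u, z)`. -/
def dz {d : ℕ} (h : Horiz d → ℝ → ℝ) (u : Horiz d) (z : ℝ) : ℝ :=
  deriv (h u) z

end

set_option linter.unusedSectionVars false

open Filter

/-! Let H(v, z) be the support function of the slice at height z, extended to all v ≠ 0 with degree
one, and write H = g + o for its even and odd parts in v. Pairing the odd part of Γ with u gives the
even part of H, so h is the restriction of g to unit vectors
(`IsTransverselyConvexTube.transverseSupport_eq`), and h is smooth because H is
(`OvaloidFamily.contDiffAt_suppPt`).

The information on g comes from tilting. A section of the tube by a plane z = a + ⟨w, y⟩ with w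
small and a near z₀, projected to the y-space, is again an ovaloid (`TiltBox.isOvaloid_tiltSet`). By
a Sard argument a dense set of these planes is transversal to the tube
(`OvaloidFamily.dense_transversal`), and for them the section is central. If φ is the support
function of a central section, φ(v) - φ(-v) = 2⟨v, b⟩ is additive in v. As φ depends continuously on
the plane, this additivity holds for all small tilts (`TiltBox.tiltSupp_additive`).

At the horizontal plane it says that o is additive. Differentiate next at the horizontal plane in
the direction w: by an envelope argument (`TiltBox.hasDerivAt_tiltSupp`) the derivative of φ(v) is
F(v) = H_z ∂_w H, so F(v) - F(-v) is additive. This difference equals 2(g_z ∂_w g + o_z ∂_w o). Here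
o_z is additive and ∂_w o does not depend on v, so g_z ∂_w g is itself additive, for every w
(`OvaloidFamily.evenSupp_product_add`). An additive smooth function has zero Laplacian; with L the
Euclidean Laplacian in v, (Lg)_z ∂_w g + 2⟨D g_z, D ∂_w g⟩ + g_z ∂_w (Lg) = 0.

It remains to read this on the sphere (`sphere_equations`). Since g has degree one, Lg = Δh + (n-2)h
there, D²g annihilates the radial direction u, and on tangent vectors D²g is the spherical Hessian
of h plus h times the metric. Tangential w give the vector equation. For w = u, Euler's relations
∂_u g = g and ∂_u (Lg) = -Lg give the scalar one.

Much of the work lies in reaching support functions from a definition of ovaloid by curvature and by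
components of the complement: positive curvature gives local convexity of the enclosed region,
Tietze–Nakajima makes it convex, the implicit function theorem makes the support parameterization
smooth, and compactness keeps curvature positive under small tilts. -/

/-! ### Local convexity implies convexity -/

section LocallyConvex

/-- In a preconnected set any two points are joined by a chain with small steps. -/
theorem IsPreconnected.exists_chain {E : Type*} [PseudoMetricSpace E] {K : Set E}
    (hK : IsPreconnected K) {δ : ℝ} (hδ : 0 < δ) {x y : E} (hx : x ∈ K) (hy : y ∈ K) :
    ∃ (N : ℕ) (γ : ℕ → E), γ 0 = x ∧ γ N = y ∧ (∀ k, γ k ∈ K) ∧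
      ∀ k < N, dist (γ k) (γ (k + 1)) ≤ δ := by
  set R : Set E := {y | ∃ (N : ℕ) (γ : ℕ → E), γ 0 = x ∧ γ N = y ∧ (∀ k, γ k ∈ K) ∧
      ∀ k < N, dist (γ k) (γ (k + 1)) ≤ δ} with hR
  have hstep : ∀ a ∈ R, ∀ b ∈ K, dist a b ≤ δ → b ∈ R := by
    rintro a ⟨N, γ, h0, hN, hK', hd⟩ b hb hab
    refine ⟨N + 1, fun k => if k ≤ N then γ k else b, by simp [h0], by simp, ?_, ?_⟩
    · intro k
      dsimp only
      split_ifs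
      exacts [hK' k, hb]
    · intro k hk
      rcases Nat.lt_or_ge k N with h | h
      · have h1 : k + 1 ≤ N := h
        simp only [h.le, h1, if_true]
        exact hd k h
      · have : k = N := by omega
        subst this
        simpa [hN] using hab
  by_contra hcon
  have hyR : y ∉ R := hcon
  -- The δ/2-neighbourhoods of the reachable points and of the unreachable points of K cannot share
  -- a point of K: that would bring an unreachable point within δ of a reachable one.
  obtain ⟨b, hbK, hb1, hb2⟩ := hK (⋃ a ∈ R, Metric.ball a (δ / 2)) (⋃ a ∈ K \ R, Metric.ball a (δ / 2))
    (isOpen_biUnion fun _ _ => Metric.isOpen_ball) (isOpen_biUnion fun _ _ => Metric.isOpen_ball)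
    (fun a ha => by
      by_cases h : a ∈ R
      · exact Or.inl (mem_biUnion h (Metric.mem_ball_self (by positivity)))
      · exact Or.inr (mem_biUnion (⟨ha, h⟩ : a ∈ K \ R) (Metric.mem_ball_self (by positivity))))
    ⟨x, hx, mem_biUnion (⟨0, fun _ => x, rfl, rfl, fun _ => hx, by simp⟩ : x ∈ R)
      (Metric.mem_ball_self (by positivity))⟩
    ⟨y, hy, mem_biUnion (⟨hy, hyR⟩ : y ∈ K \ R) (Metric.mem_ball_self (by positivity))⟩
  simp only [mem_iUnion, Metric.mem_ball] at hb1 hb2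
  obtain ⟨a, haR, ha⟩ := hb1
  obtain ⟨a', haR', ha'⟩ := hb2
  refine haR'.2 (hstep a haR a' haR'.1 ?_)
  have := dist_triangle_left a a' b
  linarith

variable {E : Type*} [NormedAddCommGroup E] [InnerProductSpace ℝ E]

/-- Apollonius' identity. Moving p to the midpoint of its neighbours a and b lowers the sum of
squared steps by exactly 2 dist(p, midpoint)², which forces energy-minimizing chains to be straight.
-/
theorem dist_sq_add_dist_sq_eq (a b p : E) :
    dist a p ^ 2 + dist p b ^ 2
      = dist a (midpoint ℝ a b) ^ 2 + dist (midpoint ℝ a b) b ^ 2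
        + 2 * dist p (midpoint ℝ a b) ^ 2 := by
  have h1 := parallelogram_law_with_norm ℝ (a - p) (b - p)
  have h2 : a - p + (b - p) = (-2 : ℝ) • (p - midpoint ℝ a b) := by
    rw [midpoint_eq_smul_add, invOf_eq_inv]; module
  rw [h2, norm_smul, sub_sub_sub_cancel_right] at h1
  rw [dist_left_midpoint, dist_midpoint_right]
  simp only [dist_eq_norm]
  rw [← norm_neg (p - b), neg_sub]
  norm_num at h1 ⊢
  nlinarith [h1]

/-- **Tietze–Nakajima**: a compact connected locally convex set is convex. -/
theorem IsCompact.convex_of_locally_convex {K : Set E} (hc : IsCompact K) (hK : IsPreconnected K)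
    (hloc : ∀ p ∈ K, ∃ r > 0, ∀ a ∈ K ∩ Metric.ball p r, ∀ b ∈ K ∩ Metric.ball p r,
      segment ℝ a b ⊆ K) : Convex ℝ K := by
  choose! r hr hseg using hloc
  -- A Lebesgue number turns local convexity into convexity at the uniform scale δ.
  obtain ⟨δ, hδ, hleb⟩ := lebesgue_number_lemma_of_metric (c := fun p : K => Metric.ball (p : E) (r p))
    hc (fun _ => Metric.isOpen_ball)
    (fun p hp => mem_iUnion.2 ⟨⟨p, hp⟩, Metric.mem_ball_self (hr p hp)⟩)
  have hunif : ∀ p ∈ K, ∀ a ∈ K, ∀ b ∈ K, dist a p < δ → dist b p < δ → segment ℝ a b ⊆ K := by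
    intro p hp a ha b hb hap hbp
    obtain ⟨q, hq⟩ := hleb p hp
    exact hseg q q.2 a ⟨ha, hq hap⟩ b ⟨hb, hq hbp⟩
  rw [convex_iff_segment_subset]
  intro x hx y hy
  obtain ⟨N, γ₀, hγ₀⟩ := hK.exists_chain (half_pos hδ) hx hy
  -- Chains are whole sequences in K, including the irrelevant entries after N, so that `Ch` is
  -- closed in a product of compact sets. A chain of least energy then exists.
  set Ch : Set (ℕ → E) := {γ | γ 0 = x ∧ γ N = y ∧ (∀ k, γ k ∈ K) ∧
      ∀ k < N, dist (γ k) (γ (k + 1)) ≤ δ / 2} with hCh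
  have hCompact : IsCompact Ch := by
    refine (isCompact_univ_pi (fun _ : ℕ => hc)).of_isClosed_subset ?_ (fun γ hγ k _ => hγ.2.2.1 k)
    simp only [hCh, ofPred_and, ofPred_forall]
    refine (isClosed_eq (by fun_prop) (by fun_prop)).inter
      ((isClosed_eq (by fun_prop) (by fun_prop)).inter (IsClosed.inter ?_ ?_))
    · exact isClosed_iInter fun k => hc.isClosed.preimage (continuous_apply k)
    · exact isClosed_iInter fun k => isClosed_iInter fun _ =>
        isClosed_le (by fun_prop) continuous_const
  obtain ⟨γ, ⟨h0, hN, hγK, hγd⟩, hmin⟩ := hCompact.exists_isMinOn ⟨γ₀, hγ₀⟩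
    (f := fun γ : ℕ → E => ∑ k ∈ Finset.range N, dist (γ k) (γ (k + 1)) ^ 2) (by fun_prop)
  -- Replacing an inner vertex by the midpoint of its neighbours gives an admissible chain: both
  -- neighbours lie within δ/2 of the old vertex, so the midpoint is in K, and the new steps have
  -- length at most δ/2. Minimality then forces the vertex to be the midpoint already.
  have hmid : ∀ i, i + 1 < N → γ (i + 1) = midpoint ℝ (γ i) (γ (i + 2)) := by
    intro i hi
    set q := midpoint ℝ (γ i) (γ (i + 2)) with hq
    have hd1 := hγd i (by omega)
    have hd2 := hγd (i + 1) hi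
    have hqK : q ∈ K := by
      refine hunif (γ (i + 1)) (hγK _) (γ i) (hγK _) (γ (i + 2)) (hγK _) (by linarith) ?_
        (midpoint_mem_segment _ _)
      rw [dist_comm]
      linarith
    have hdd : dist (γ i) (γ (i + 2)) ≤ δ := by
      have := dist_triangle (γ i) (γ (i + 1)) (γ (i + 2))
      linarith
    have hq1 : dist (γ i) q ≤ δ / 2 := by
      rw [hq, dist_left_midpoint]; norm_num; linarith
    have hq2 : dist q (γ (i + 2)) ≤ δ / 2 := by
      rw [hq, dist_midpoint_right]; norm_num; linarith
    set γ' : ℕ → E := Function.update γ (i + 1) q with hγ'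
    have hne : ∀ k, k ≠ i + 1 → γ' k = γ k := fun k hk => Function.update_of_ne hk _ _
    have heq : γ' (i + 1) = q := Function.update_self _ _ _
    have hmem : γ' ∈ Ch := by
      refine ⟨by rw [hne 0 (by omega), h0], by rw [hne N (by omega), hN], fun k => ?_,
        fun k hk => ?_⟩
      · by_cases hk : k = i + 1
        · rw [hk, heq]; exact hqK
        · rw [hne k hk]; exact hγK k
      · by_cases hk1 : k = i
        · subst hk1
          rw [heq, hne k (by omega)]; exact hq1
        · by_cases hk2 : k = i + 1
          · subst hk2
            rw [heq, hne _ (by omega)]; exact hq2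
          · rw [hne k hk2, hne (k + 1) (by omega)]; exact hγd k hk
    have hle : ∑ k ∈ Finset.range N, dist (γ k) (γ (k + 1)) ^ 2
        ≤ ∑ k ∈ Finset.range N, dist (γ' k) (γ' (k + 1)) ^ 2 := hmin hmem
    have hsum : ∑ k ∈ Finset.range N,
        (dist (γ' k) (γ' (k + 1)) ^ 2 - dist (γ k) (γ (k + 1)) ^ 2)
        = (dist (γ' i) (γ' (i + 1)) ^ 2 - dist (γ i) (γ (i + 1)) ^ 2)
          + (dist (γ' (i + 1)) (γ' (i + 1 + 1)) ^ 2 - dist (γ (i + 1)) (γ (i + 1 + 1)) ^ 2) := by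
      refine Finset.sum_eq_add i (i + 1) (by omega) ?_ ?_ ?_
      · intro k _ hk
        rw [hne k hk.2, hne (k + 1) (by omega), sub_self]
      · intro h; exact absurd (Finset.mem_range.2 (by omega)) h
      · intro h; exact absurd (Finset.mem_range.2 (by omega)) h
    rw [Finset.sum_sub_distrib, heq, hne i (by omega), hne (i + 1 + 1) (by omega)] at hsum
    have key := dist_sq_add_dist_sq_eq (γ i) (γ (i + 2)) (γ (i + 1))
    rw [← hq] at key
    have h3 : dist (γ (i + 1)) q ^ 2 ≤ 0 := by
      have : i + 1 + 1 = i + 2 := rfl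
      rw [this] at hsum
      linarith
    exact dist_eq_zero.1 (pow_eq_zero_iff two_ne_zero |>.1 (le_antisymm h3 (sq_nonneg _)))
  set e : E := γ 1 - γ 0 with he
  have hstep : ∀ k, k + 1 ≤ N → γ (k + 1) - γ k = e := by
    intro k
    induction k with
    | zero => intro _; rfl
    | succ k ih =>
      intro hk
      have h1 := ih (by omega)
      have h2 := hmid k (by omega)
      rw [midpoint_eq_smul_add] at h2
      have h3 : γ (k + 2) = (2 : ℝ) • γ (k + 1) - γ k := by
        rw [h2]; simp
      rw [show k + 1 + 1 = k + 2 from rfl, h3, ← h1]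
      module
  have hform : ∀ k, k ≤ N → γ k = x + (k : ℝ) • e := by
    intro k
    induction k with
    | zero => intro _; simp [h0]
    | succ k ih =>
      intro hk
      have := hstep k hk
      rw [sub_eq_iff_eq_add.1 this, ih (by omega)]
      push_cast
      module
  -- The minimal chain is equally spaced on a line, and each of its steps is short enough to be a
  -- segment in K.
  have hline : ∀ k, k ≤ N → ∀ s : ℝ, 0 ≤ s → s ≤ k → x + s • e ∈ K := by
    intro k
    induction k with
    | zero =>
      intro _ s h1 h2
      have : s = 0 := le_antisymm (by simpa using h2) h1
      simpa [this] using hx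
    | succ k ih =>
      intro hk s h1 h2
      rcases le_total s k with h | h
      · exact ih (by omega) s h1 h
      · refine hunif (γ k) (hγK k) (γ k) (hγK k) (γ (k + 1)) (hγK _) (by simpa using hδ) ?_ ?_
        · rw [dist_comm]
          have := hγd k hk
          linarith
        · rw [hform k (by omega), hform (k + 1) hk, segment_eq_image']
          push_cast at h2
          refine ⟨s - k, ⟨by linarith, by linarith⟩, ?_⟩
          push_cast
          module
  have hy' : y = x + (N : ℝ) • e := by rw [← hform N le_rfl, hN]
  rw [segment_eq_image']
  rintro _ ⟨t, ⟨ht0, ht1⟩, rfl⟩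
  have := hline N le_rfl (t * N) (by positivity)
    (mul_le_of_le_one_left (Nat.cast_nonneg _) ht1)
  convert this using 1
  rw [hy']
  module

end LocallyConvex

/-! ### Principal curvatures and the Hessian of a defining function -/

section Curvature

variable {E : Type*} [NormedAddCommGroup E] [InnerProductSpace ℝ E]

/-- Positivity of a quadratic form on the kernel of a linear form is an open condition. -/
theorem eventually_pos_on_ker {T : Type*} [TopologicalSpace T] {F : Type*} [NormedAddCommGroup F]
    [NormedSpace ℝ F] [FiniteDimensional ℝ F] {ℓ : T → F →L[ℝ] ℝ} {Q : T → F →L[ℝ] F →L[ℝ] ℝ}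
    {t₀ : T} (hℓ : ContinuousAt ℓ t₀) (hQ : ContinuousAt Q t₀)
    (h : ∀ v, v ≠ 0 → ℓ t₀ v = 0 → 0 < Q t₀ v v) :
    ∀ᶠ t in 𝓝 t₀, ∀ v, v ≠ 0 → ℓ t v = 0 → 0 < Q t v v := by
  -- By homogeneity unit vectors suffice. At each of them either ℓ is nonzero or Q is positive; both
  -- conditions are open, and the sphere is compact.
  have hev : ∀ᶠ t in 𝓝 t₀, ∀ v ∈ Metric.sphere (0 : F) 1, ℓ t v ≠ 0 ∨ 0 < Q t v v := by
    refine (isCompact_sphere (0 : F) 1).eventually_forall_of_forall_eventually fun v hv => ?_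
    have hv0 : v ≠ 0 := by rintro rfl; simp at hv
    have c1 : ContinuousAt (fun z : T × F => ℓ z.1) (t₀, v) :=
      ContinuousAt.comp (f := Prod.fst) (x := (t₀, v)) hℓ continuousAt_fst
    have c2 : ContinuousAt (fun z : T × F => Q z.1) (t₀, v) :=
      ContinuousAt.comp (f := Prod.fst) (x := (t₀, v)) hQ continuousAt_fst
    by_cases h0 : ℓ t₀ v = 0
    · have : ContinuousAt (fun z : T × F => Q z.1 z.2 z.2) (t₀, v) :=
        (c2.clm_apply continuousAt_snd).clm_apply continuousAt_snd
      exact (this.eventually (lt_mem_nhds (h v hv0 h0))).mono fun _ hz => Or.inr hz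
    · have : ContinuousAt (fun z : T × F => ℓ z.1 z.2) (t₀, v) := c1.clm_apply continuousAt_snd
      exact (this.eventually_ne h0).mono fun _ hz => Or.inl hz
  filter_upwards [hev] with t ht v hv h0
  have hn : 0 < ‖v‖ := norm_pos_iff.2 hv
  have := ht (‖v‖⁻¹ • v) (by simp [norm_smul, hn.ne'])
  simp only [map_smul, h0, mul_zero, ne_eq, not_true_eq_false, false_or, smul_apply,
    smul_eq_mul] at this
  have hinv : 0 < ‖v‖⁻¹ := inv_pos.2 hn
  exact pos_of_mul_pos_right (pos_of_mul_pos_right this hinv.le) hinv.le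

/-- A function with a critical point of positive second derivative has no local maximum there. -/
theorem not_isLocalMax_of_deriv_deriv_pos {f : ℝ → ℝ} {x : ℝ} (hf : 0 < deriv (deriv f) x)
    (hc : ContinuousAt f x) : ¬ IsLocalMax f x := by
  intro hmax
  have hd : deriv f x = 0 := hmax.deriv_eq_zero
  have hmin := isLocalMin_of_deriv_deriv_pos hf hd hc
  have hconst : f =ᶠ[𝓝 x] fun _ => f x := by
    filter_upwards [hmax, hmin] with y h1 h2 using le_antisymm h1 h2
  have h1 : deriv f =ᶠ[𝓝 x] fun _ => 0 := by
    filter_upwards [hconst.eventuallyEq_nhds] with y hy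
    rw [hy.deriv_eq, deriv_const]
  rw [h1.deriv_eq, deriv_const] at hf
  exact lt_irrefl _ hf

theorem hasDerivAt_comp_line {F G : Type*} [NormedAddCommGroup F] [NormedSpace ℝ F]
    [NormedAddCommGroup G] [NormedSpace ℝ G] {f : F → G} {a v : F} {t : ℝ} (hf : DifferentiableAt ℝ f (a + t • v)) :
    HasDerivAt (fun s : ℝ => f (a + s • v)) (fderiv ℝ f (a + t • v) v) t := by
  have hl : HasDerivAt (fun s : ℝ => a + s • v) v t := by
    simpa using ((hasDerivAt_id t).smul_const v).const_add a
  exact hf.hasFDerivAt.comp_hasDerivAt t hl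

theorem hasDerivAt_fderiv_comp_line {F G : Type*} [NormedAddCommGroup F] [NormedSpace ℝ F]
    [NormedAddCommGroup G] [NormedSpace ℝ G] {f : F → G} {a v : F} {t : ℝ}
    (hf : ContDiffAt ℝ 2 f (a + t • v)) (w : F) :
    HasDerivAt (fun s : ℝ => fderiv ℝ f (a + s • v) w)
      (fderiv ℝ (fderiv ℝ f) (a + t • v) v w) t := by
  have hd : DifferentiableAt ℝ (fderiv ℝ f) (a + t • v) :=
    (hf.fderiv_right (m := 1) (by norm_num)).differentiableAt (by norm_num)
  exact (ContinuousLinearMap.apply ℝ G w).hasFDerivAt.comp_hasDerivAt t (hasDerivAt_comp_line hd)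

theorem deriv_deriv_comp_line {F : Type*} [NormedAddCommGroup F] [NormedSpace ℝ F]
    {f : F → ℝ} {a v : F} {t : ℝ} (hf : ContDiffAt ℝ 2 f (a + t • v)) :
    deriv (deriv fun s : ℝ => f (a + s • v)) t = fderiv ℝ (fderiv ℝ f) (a + t • v) v v := by
  have hcont : ContinuousAt (fun s : ℝ => a + s • v) t := by fun_prop
  have h1 : ∀ᶠ y in 𝓝 (a + t • v), ContDiffAt ℝ 2 f y := hf.eventually (by simp)
  have h2 : (deriv fun s : ℝ => f (a + s • v)) =ᶠ[𝓝 t] fun s => fderiv ℝ f (a + s • v) v := by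
    filter_upwards [hcont.eventually h1] with s hs
    exact (hasDerivAt_comp_line (hs.differentiableAt (by norm_num))).deriv
  rw [h2.deriv_eq]
  exact (hasDerivAt_fderiv_comp_line hf v).deriv

variable [CompleteSpace E]

theorem inner_gradient (f : E → ℝ) (p v : E) : ⟪gradient f p, v⟫_ℝ = fderiv ℝ f p v := by
  rw [gradient, InnerProductSpace.toDual_symm_apply]

theorem gradient_ne_zero_iff {f : E → ℝ} {p : E} : gradient f p ≠ 0 ↔ fderiv ℝ f p ≠ 0 := by
  rw [gradient, ne_eq, ne_eq, LinearIsometryEquiv.map_eq_zero_iff]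

theorem differentiableAt_gradient {f : E → ℝ} {p : E} (hf : ContDiffAt ℝ 2 f p) :
    DifferentiableAt ℝ (gradient f) p := by
  have hd : DifferentiableAt ℝ (fderiv ℝ f) p :=
    (hf.fderiv_right (m := 1) (by norm_num)).differentiableAt (by norm_num)
  exact ((InnerProductSpace.toDual ℝ E).symm.toContinuousLinearEquiv.differentiableAt).comp p hd

theorem inner_fderiv_gradient {f : E → ℝ} {p : E} (hf : ContDiffAt ℝ 2 f p) (v v' : E) :
    ⟪fderiv ℝ (gradient f) p v, v'⟫_ℝ = fderiv ℝ (fderiv ℝ f) p v v' := by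
  have hd : DifferentiableAt ℝ (fderiv ℝ f) p :=
    (hf.fderiv_right (m := 1) (by norm_num)).differentiableAt (by norm_num)
  have h1 : fderiv ℝ (fun x => ⟪gradient f x, v'⟫_ℝ) p v = ⟪fderiv ℝ (gradient f) p v, v'⟫_ℝ := by
    rw [fderiv_inner_apply ℝ (differentiableAt_gradient hf) (differentiableAt_const _)]
    simp
  have h2 : (fun x => ⟪gradient f x, v'⟫_ℝ) = fun x => fderiv ℝ f x v' :=
    funext fun x => inner_gradient f x v'
  rw [← h1, h2, fderiv_clm_apply hd (differentiableAt_const _)]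
  simp

theorem differentiableAt_unitNormal {f : E → ℝ} {p : E} (hf : ContDiffAt ℝ 2 f p)
    (hg : gradient f p ≠ 0) : DifferentiableAt ℝ (unitNormal f) p :=
  (((differentiableAt_gradient hf).norm ℝ hg).inv (norm_ne_zero_iff.2 hg)).smul
    (differentiableAt_gradient hf)

/-- Differentiating the factor ‖∇f‖⁻¹ only produces a multiple of ∇f, invisible to tangent vectors.
The second fundamental form is thus the Hessian divided by ‖∇f‖. -/
theorem inner_fderiv_unitNormal {f : E → ℝ} {p : E} (hf : ContDiffAt ℝ 2 f p)
    (hg : gradient f p ≠ 0) (v : E) {v' : E} (hv' : ⟪gradient f p, v'⟫_ℝ = 0) :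
    ⟪fderiv ℝ (unitNormal f) p v, v'⟫_ℝ = ‖gradient f p‖⁻¹ * fderiv ℝ (fderiv ℝ f) p v v' := by
  have hG := differentiableAt_gradient hf
  have hN := (hG.norm ℝ hg).inv (norm_ne_zero_iff.2 hg)
  have h : fderiv ℝ (unitNormal f) p = _ := fderiv_smul hN hG
  rw [h]
  simp only [add_apply, smul_apply,
    ContinuousLinearMap.smulRight_apply, inner_add_left, inner_smul_left, hv', mul_zero, add_zero]
  rw [inner_fderiv_gradient hf]
  simp

/-- A field of unit vectors varies orthogonally to itself; hence the shape operator maps the tangent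
space to itself. -/
theorem inner_fderiv_unitNormal_gradient {f : E → ℝ} {p : E} (hf : ContDiffAt ℝ 2 f p)
    (hg : gradient f p ≠ 0) (v : E) : ⟪fderiv ℝ (unitNormal f) p v, gradient f p⟫_ℝ = 0 := by
  have hd := differentiableAt_unitNormal hf hg
  have h1 : (fun x => ⟪unitNormal f x, unitNormal f x⟫_ℝ) =ᶠ[𝓝 p] fun _ => 1 := by
    filter_upwards [(differentiableAt_gradient hf).continuousAt.eventually_ne hg] with x hx
    rw [unitNormal, real_inner_self_eq_norm_sq, norm_smul]
    simp [hx]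
  have h2 := fderiv_inner_apply ℝ hd hd v
  rw [h1.fderiv_eq] at h2
  simp only [fderiv_fun_const, Pi.zero_apply, zero_apply] at h2
  rw [real_inner_comm, ← two_mul] at h2
  have h3 : ⟪fderiv ℝ (unitNormal f) p v, unitNormal f p⟫_ℝ = 0 := by linarith
  rw [unitNormal, inner_smul_right] at h3
  exact (mul_eq_zero.1 h3).resolve_left (inv_ne_zero (norm_ne_zero_iff.2 hg))

/-- Positivity of the principal curvatures means that the Hessian of the defining function is
positive definite on the tangent space. -/
theorem forall_isPrincipalCurvature_pos_iff [FiniteDimensional ℝ E] {f : E → ℝ} {p : E}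
    (hf : ContDiffAt ℝ 2 f p) (hg : gradient f p ≠ 0) :
    (∀ κ, IsPrincipalCurvature f p κ → 0 < κ) ↔
      ∀ v, v ≠ 0 → fderiv ℝ f p v = 0 → 0 < fderiv ℝ (fderiv ℝ f) p v v := by
  have hgn : 0 < ‖gradient f p‖⁻¹ := inv_pos.2 (norm_pos_iff.2 hg)
  constructor
  · intro h v hv hv0
    set W : Submodule ℝ E := (ℝ ∙ gradient f p)ᗮ with hW
    have memW : ∀ x, x ∈ W ↔ ⟪gradient f p, x⟫_ℝ = 0 := fun x =>
      Submodule.mem_orthogonal_singleton_iff_inner_right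
    have hinv : ∀ x ∈ W, (fderiv ℝ (unitNormal f) p : E →ₗ[ℝ] E) x ∈ W := fun x _ => by
      rw [memW, real_inner_comm]
      exact inner_fderiv_unitNormal_gradient hf hg x
    -- The shape operator, symmetric because the Hessian is. Expanding its quadratic form in an
    -- eigenbasis reduces positivity to that of the eigenvalues.
    set T : W →ₗ[ℝ] W := (fderiv ℝ (unitNormal f) p : E →ₗ[ℝ] E).restrict hinv with hT
    have hTi : ∀ x y : W, ⟪T x, y⟫_ℝ
        = ‖gradient f p‖⁻¹ * fderiv ℝ (fderiv ℝ f) p (x : E) (y : E) := fun x y => by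
      rw [Submodule.coe_inner]
      exact inner_fderiv_unitNormal hf hg x ((memW y).1 y.2)
    have hsym : T.IsSymmetric := fun x y => by
      rw [hTi, real_inner_comm, hTi, hf.isSymmSndFDerivAt (by simp)]
    set b := hsym.eigenvectorBasis rfl with hb
    have hpos : ∀ i, 0 < hsym.eigenvalues rfl i := fun i => by
      refine h _ ⟨(b i : E), ?_, (memW _).1 (b i).2, ?_⟩
      · have := b.orthonormal.ne_zero i
        simpa using this
      · have := congrArg (Subtype.val) (hsym.apply_eigenvectorBasis rfl i)
        exact this
    set w : W := ⟨v, (memW v).2 (by rw [inner_gradient]; exact hv0)⟩ with hw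
    have hexp : ⟪T w, w⟫_ℝ = ∑ i, hsym.eigenvalues rfl i * ⟪b i, w⟫_ℝ ^ 2 := by
      rw [← b.sum_inner_mul_inner]
      refine Finset.sum_congr rfl fun i _ => ?_
      rw [hsym w (b i), hb, hsym.apply_eigenvectorBasis rfl i, ← hb, inner_smul_right,
        real_inner_comm w (b i)]
      simp
      ring
    have hne : ∃ i, ⟪b i, w⟫_ℝ ≠ 0 := by
      by_contra hcon
      push Not at hcon
      have : w = 0 := by
        rw [← b.sum_repr' w]
        simp [hcon]
      exact hv (congrArg Subtype.val this)
    obtain ⟨i, hi⟩ := hne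
    have : 0 < ⟪T w, w⟫_ℝ := by
      rw [hexp]
      exact Finset.sum_pos' (fun j _ => mul_nonneg (hpos j).le (sq_nonneg _))
        ⟨i, Finset.mem_univ _, mul_pos (hpos i) (by positivity)⟩
    rw [hTi] at this
    exact pos_of_mul_pos_right this hgn.le
  · rintro h κ ⟨v, hv, hv0, hκ⟩
    have h1 := inner_fderiv_unitNormal hf hg v hv0
    rw [hκ, inner_smul_left, real_inner_self_eq_norm_sq] at h1
    have h2 : 0 < κ * ‖v‖ ^ 2 := by
      have := mul_pos hgn (h v hv (by rw [← inner_gradient]; exact hv0))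
      rw [← h1] at this
      simpa using this
    exact pos_of_mul_pos_left h2 (by positivity)

theorem IsOuterDefiningFunction.contDiffAt {O U : Set E} {f : E → ℝ}
    (hf : IsOuterDefiningFunction O U f) {p : E} (hp : p ∈ U) : ContDiffAt ℝ ∞ f p :=
  hf.smooth.contDiffAt (hf.isOpen.mem_nhds hp)

theorem IsOuterDefiningFunction.contDiffAt_two {O U : Set E} {f : E → ℝ}
    (hf : IsOuterDefiningFunction O U f) {p : E} (hp : p ∈ U) : ContDiffAt ℝ 2 f p :=
  (hf.contDiffAt hp).of_le ENat.LEInfty.out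

/-- Hessian characterization of ovaloids. -/
theorem isOvaloid_iff [FiniteDimensional ℝ E] {O : Set E} :
    IsOvaloid O ↔ IsCompact O ∧ IsConnected O ∧ ∀ p ∈ O, ∃ (U : Set E) (f : E → ℝ), p ∈ U ∧
      IsOuterDefiningFunction O U f ∧
      ∀ v, v ≠ 0 → fderiv ℝ f p v = 0 → 0 < fderiv ℝ (fderiv ℝ f) p v v := by
  constructor
  · intro h
    refine ⟨h.isCompact, h.isConnected, fun p hp => ?_⟩
    obtain ⟨U, f, hpU, hf, hk⟩ := h.curvature_pos p hp
    exact ⟨U, f, hpU, hf, (forall_isPrincipalCurvature_pos_iff (hf.contDiffAt_two hpU)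
      (hf.regular p hpU)).1 hk⟩
  · rintro ⟨h1, h2, h3⟩
    refine ⟨h1, h2, fun p hp => ?_⟩
    obtain ⟨U, f, hpU, hf, hk⟩ := h3 p hp
    exact ⟨U, f, hpU, hf, (forall_isPrincipalCurvature_pos_iff (hf.contDiffAt_two hpU)
      (hf.regular p hpU)).2 hk⟩

end Curvature

/-! ### Ovaloids bound convex bodies -/

section OneVariable

theorem HasDerivAt.eventually_lt_right {φ : ℝ → ℝ} {φ' x : ℝ} (h : HasDerivAt φ φ' x)
    (h0 : 0 < φ') : ∀ᶠ t in 𝓝[>] x, φ x < φ t := by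
  have h1 := (hasDerivAt_iff_tendsto_slope.1 h).eventually (lt_mem_nhds h0)
  have h2 : ∀ᶠ t in 𝓝[>] x, 0 < slope φ x t :=
    h1.filter_mono (nhdsWithin_mono _ fun t (ht : x < t) => ht.ne')
  filter_upwards [h2, self_mem_nhdsWithin] with t ht (hxt : x < t)
  rw [slope_def_field] at ht
  have := (div_pos_iff_of_pos_right (sub_pos.2 hxt)).1 ht
  linarith

theorem HasDerivAt.eventually_gt_right {φ : ℝ → ℝ} {φ' x : ℝ} (h : HasDerivAt φ φ' x)
    (h0 : φ' < 0) : ∀ᶠ t in 𝓝[>] x, φ t < φ x :=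
  (h.neg.eventually_lt_right (neg_pos.2 h0)).mono fun _ ht => neg_lt_neg_iff.1 ht

theorem eventually_lt_right_of_deriv_deriv_pos {φ : ℝ → ℝ} {x : ℝ} (h2 : 0 < deriv (deriv φ) x)
    (h1 : deriv φ x = 0) (hc : ∀ᶠ t in 𝓝 x, ContinuousAt φ t) : ∀ᶠ t in 𝓝[>] x, φ x < φ t := by
  have hd : HasDerivAt (deriv φ) (deriv (deriv φ) x) x :=
    (differentiableAt_of_deriv_ne_zero h2.ne').hasDerivAt
  have hpos := hd.eventually_lt_right h2
  rw [h1, eventually_nhdsWithin_iff] at hpos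
  obtain ⟨ε, hε, hball⟩ := Metric.eventually_nhds_iff.1 (hpos.and hc)
  filter_upwards [Ioo_mem_nhdsGT (show x < x + ε by linarith)] with t ht
  have hin : ∀ s ∈ Icc x t, dist s x < ε := fun s hs => by
    rw [Real.dist_eq, abs_lt]
    constructor <;> linarith [hs.1, hs.2, ht.2]
  refine strictMonoOn_of_deriv_pos (convex_Icc x t)
    (fun s hs => (hball (hin s hs)).2.continuousWithinAt) (fun s hs => ?_)
    (left_mem_Icc.2 ht.1.le) (right_mem_Icc.2 ht.1.le) ht.1
  rw [interior_Icc] at hs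
  exact (hball (hin s (Ioo_subset_Icc_self hs))).1 hs.1

end OneVariable

/-! ### The convex body bounded by an ovaloid and its support parameterization -/

section Ovaloid

variable {E : Type*} [NormedAddCommGroup E] [InnerProductSpace ℝ E]

/-- The ray is connected and unbounded and avoids O, so it makes the component of its origin
unbounded. Membership in the exterior is certified in this way throughout. -/
theorem mem_outside_of_ray {O : Set E} {x v : E} (hv : v ≠ 0) (h : ∀ t : ℝ, 0 ≤ t → x + t • v ∉ O) :
    x ∈ outside O := by
  have hx : x ∈ Oᶜ := by simpa using h 0 le_rfl
  refine ⟨hx, fun hb => ?_⟩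
  have hsub : (fun t : ℝ => x + t • v) '' Ici 0 ⊆ connectedComponentIn Oᶜ x := by
    refine IsPreconnected.subset_connectedComponentIn
      (isPreconnected_Ici.image _ (by fun_prop)) ⟨0, self_mem_Ici, by simp⟩ ?_
    rintro _ ⟨t, ht, rfl⟩
    exact h t ht
  obtain ⟨R, hR⟩ := (hb.subset hsub).exists_norm_le
  have hvn : 0 < ‖v‖ := norm_pos_iff.2 hv
  have hR0 : 0 ≤ R := le_trans (norm_nonneg _) (hR x ⟨0, self_mem_Ici, by simp⟩)
  set t : ℝ := (R + ‖x‖ + 1) / ‖v‖ with ht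
  have ht0 : 0 ≤ t := by positivity
  have h1 := hR (x + t • v) ⟨t, ht0, rfl⟩
  have h2 : ‖t • v‖ = R + ‖x‖ + 1 := by
    rw [norm_smul, Real.norm_of_nonneg ht0, ht, div_mul_cancel₀ _ hvn.ne']
  have h3 : ‖t • v‖ ≤ ‖x + t • v‖ + ‖x‖ := by
    have := norm_sub_le (x + t • v) x
    simpa using this
  linarith

theorem isOpen_outside {O : Set E} (hO : IsClosed O) : IsOpen (outside O) := by
  rw [isOpen_iff_mem_nhds]
  rintro x ⟨hx, hb⟩
  filter_upwards [(hO.isOpen_compl.connectedComponentIn (x := x)).mem_nhds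
    (mem_connectedComponentIn hx)] with y hy
  exact ⟨connectedComponentIn_subset _ _ hy, by rwa [← connectedComponentIn_eq hy]⟩

theorem isOpen_compl_outside_diff {O : Set E} (hO : IsClosed O) : IsOpen ((outside O)ᶜ \ O) := by
  rw [isOpen_iff_mem_nhds]
  rintro x ⟨hx, hxO⟩
  filter_upwards [(hO.isOpen_compl.connectedComponentIn (x := x)).mem_nhds
    (mem_connectedComponentIn hxO)] with y hy
  refine ⟨fun hy' => hx ⟨hxO, ?_⟩, connectedComponentIn_subset _ _ hy⟩
  rw [connectedComponentIn_eq hy]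
  exact hy'.2

theorem subset_compl_outside (O : Set E) : O ⊆ (outside O)ᶜ := fun _ hx hx' => hx'.1 hx

theorem IsCompact.compl_outside [FiniteDimensional ℝ E] {O : Set E} (hO : IsCompact O) :
    IsCompact (outside O)ᶜ := by
  obtain ⟨R, hR⟩ := hO.isBounded.exists_norm_le
  refine (isCompact_closedBall (0 : E) (max R 0)).of_isClosed_subset
    (isOpen_outside hO.isClosed).isClosed_compl fun x hx => ?_
  by_contra hcon
  rw [mem_closedBall_zero_iff, not_le] at hcon
  have hx0 : x ≠ 0 := norm_pos_iff.1 (lt_of_le_of_lt (le_max_right _ _) hcon)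
  refine hx (mem_outside_of_ray hx0 fun t ht hmem => ?_)
  have h1 := hR _ hmem
  have h2 : x + t • x = (1 + t) • x := by module
  rw [h2, norm_smul, Real.norm_of_nonneg (by linarith)] at h1
  have h3 := le_max_left R 0
  nlinarith [norm_nonneg x]

/-- A ray issued from a point of the body must meet O. Up to its first hit it stays in one component
of the complement, so in the body. Every point is thus joined to the connected set O. -/
theorem IsConnected.isPreconnected_compl_outside [Nontrivial E] {O : Set E} (hO : IsConnected O)
    (hcl : IsClosed O) : IsPreconnected (outside O)ᶜ := by
  obtain ⟨x₀, hx₀⟩ := hO.nonempty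
  refine isPreconnected_of_forall x₀ fun x hx => ?_
  obtain ⟨e, he⟩ := exists_ne (0 : E)
  have hex : ∃ t : ℝ, 0 ≤ t ∧ x + t • e ∈ O := by
    by_contra hcon
    push Not at hcon
    exact hx (mem_outside_of_ray he hcon)
  set A : Set ℝ := Ici 0 ∩ (fun t : ℝ => x + t • e) ⁻¹' O with hA
  have hAcl : IsClosed A := isClosed_Ici.inter (hcl.preimage (by fun_prop))
  have hAbdd : BddBelow A := ⟨0, fun t ht => ht.1⟩
  have hAne : A.Nonempty := by
    obtain ⟨t, h1, h2⟩ := hex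
    exact ⟨t, h1, h2⟩
  have hmem := hAcl.csInf_mem hAne hAbdd
  set t₀ := sInf A with ht₀
  have hlt : ∀ s ∈ Ico 0 t₀, x + s • e ∉ O := fun s hs hsO =>
    absurd (csInf_le hAbdd (show s ∈ A from ⟨hs.1, hsO⟩)) (not_le.2 hs.2)
  have hK : ∀ s ∈ Icc 0 t₀, x + s • e ∈ (outside O)ᶜ := by
    intro s hs hout
    rcases hs.2.lt_or_eq with h | h
    · have hsub : (fun t : ℝ => x + t • e) '' Icc 0 s ⊆ connectedComponentIn Oᶜ (x + s • e) := by
        refine IsPreconnected.subset_connectedComponentIn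
          (isPreconnected_Icc.image _ (by fun_prop)) ⟨s, right_mem_Icc.2 hs.1, rfl⟩ ?_
        rintro _ ⟨t, ht, rfl⟩
        exact hlt t ⟨ht.1, lt_of_le_of_lt ht.2 h⟩
      have hxc : x ∈ connectedComponentIn Oᶜ (x + s • e) :=
        hsub ⟨0, left_mem_Icc.2 hs.1, by simp⟩
      refine hx ⟨connectedComponentIn_subset _ _ hxc, ?_⟩
      rw [← connectedComponentIn_eq hxc]
      exact hout.2
    · subst h
      exact hout.1 hmem.2
  refine ⟨O ∪ (fun t : ℝ => x + t • e) '' Icc 0 t₀, ?_, Or.inl hx₀,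
    Or.inr ⟨0, left_mem_Icc.2 hmem.1, by simp⟩, ?_⟩
  · rintro y (hy | ⟨t, ht, rfl⟩)
    · exact subset_compl_outside O hy
    · exact hK t ht
  · exact IsPreconnected.union (x + t₀ • e) hmem.2 ⟨t₀, right_mem_Icc.2 hmem.1, rfl⟩
      hO.isPreconnected (isPreconnected_Icc.image _ (by fun_prop))

variable [CompleteSpace E]

theorem IsOuterDefiningFunction.nonpos {O U : Set E} {f : E → ℝ}
    (hf : IsOuterDefiningFunction O U f) {x : E} (hxU : x ∈ U) (hx : x ∉ outside O) : f x ≤ 0 :=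
  not_lt.1 fun h => hx ((hf.pos_iff x hxU).1 h)

theorem IsOuterDefiningFunction.notMem_outside {O U : Set E} {f : E → ℝ}
    (hf : IsOuterDefiningFunction O U f) {x : E} (hxU : x ∈ U) (hx : f x ≤ 0) : x ∉ outside O :=
  fun h => absurd ((hf.pos_iff x hxU).2 h) (not_lt.2 hx)

theorem IsOuterDefiningFunction.hasDerivAt_line {O U : Set E} {f : E → ℝ}
    (hf : IsOuterDefiningFunction O U f) {p : E} (hpU : p ∈ U) (v : E) :
    HasDerivAt (fun t : ℝ => f (p + t • v)) (fderiv ℝ f p v) 0 := by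
  have h := hasDerivAt_comp_line (f := f) (a := p) (v := v) (t := 0)
    (by simpa using (hf.contDiffAt hpU).differentiableAt (by simp))
  simpa using h

theorem eventually_line_mem {U : Set E} (hU : IsOpen U) {p : E} (hpU : p ∈ U) (v : E) :
    ∀ᶠ t : ℝ in 𝓝 0, p + t • v ∈ U := by
  have : ContinuousAt (fun t : ℝ => p + t • v) 0 := by fun_prop
  exact this.eventually (by simpa using hU.mem_nhds hpU)

/-- Two outer defining functions have the same normal direction. -/
theorem IsOuterUnitNormal.unique {O : Set E} {p ν₁ ν₂ : E} (h₁ : IsOuterUnitNormal O p ν₁)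
    (h₂ : IsOuterUnitNormal O p ν₂) : ν₁ = ν₂ := by
  obtain ⟨U₁, f₁, hp₁, hpO, hf₁, rfl⟩ := h₁
  obtain ⟨U₂, f₂, hp₂, -, hf₂, rfl⟩ := h₂
  have norm_one : ∀ f : E → ℝ, gradient f p ≠ 0 → ‖unitNormal f p‖ = 1 := fun f hf => by
    rw [unitNormal, norm_smul, norm_inv, norm_norm, inv_mul_cancel₀ (norm_ne_zero_iff.2 hf)]
  have n₁ := norm_one f₁ (hf₁.regular p hp₁)
  have n₂ := norm_one f₂ (hf₂.regular p hp₂)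
  have der : ∀ (f : E → ℝ) (v : E), gradient f p ≠ 0 →
      fderiv ℝ f p v = ‖gradient f p‖ * ⟪unitNormal f p, v⟫_ℝ := fun f v hf => by
    rw [unitNormal, inner_smul_left, inner_gradient]
    simp [hf]
  by_contra hne
  have hlt : ⟪unitNormal f₁ p, unitNormal f₂ p⟫_ℝ < 1 :=
    lt_of_le_of_ne (by simpa [n₁, n₂] using real_inner_le_norm (unitNormal f₁ p) (unitNormal f₂ p))
      (fun h => hne ((inner_eq_one_iff_of_norm_eq_one n₁ n₂).1 h))
  -- Along the difference of two distinct unit normals f₁ decreases and f₂ increases, so a point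
  -- just beyond p would be both in the body and outside.
  set v := unitNormal f₂ p - unitNormal f₁ p with hv
  have d₁ : fderiv ℝ f₁ p v < 0 := by
    rw [der f₁ v (hf₁.regular p hp₁), hv, inner_sub_right, real_inner_self_eq_norm_sq, n₁]
    exact mul_neg_of_pos_of_neg (norm_pos_iff.2 (hf₁.regular p hp₁)) (by linarith)
  have d₂ : 0 < fderiv ℝ f₂ p v := by
    rw [der f₂ v (hf₂.regular p hp₂), hv, inner_sub_right, real_inner_self_eq_norm_sq, n₂,
      real_inner_comm]
    exact mul_pos (norm_pos_iff.2 (hf₂.regular p hp₂)) (by linarith)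
  have e₁ := (hf₁.hasDerivAt_line hp₁ v).eventually_gt_right d₁
  have e₂ := (hf₂.hasDerivAt_line hp₂ v).eventually_lt_right d₂
  simp only [zero_smul, add_zero, (hf₁.zero_iff p hp₁).2 hpO, (hf₂.zero_iff p hp₂).2 hpO] at e₁ e₂
  obtain ⟨t, h1, h2, h3, h4⟩ := (e₁.and (e₂.and
    (((eventually_line_mem hf₁.isOpen hp₁ v).filter_mono nhdsWithin_le_nhds).and
    ((eventually_line_mem hf₂.isOpen hp₂ v).filter_mono nhdsWithin_le_nhds)))).exists
  exact hf₁.notMem_outside h3 h1.le ((hf₂.pos_iff _ h4).1 h2)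

theorem IsOuterUnitNormal.gaussMap_eq {O : Set E} {p ν : E} (h : IsOuterUnitNormal O p ν) :
    gaussMap O p = ν :=
  (Classical.epsilon_spec (p := IsOuterUnitNormal O p) ⟨ν, h⟩).unique h

/-- Away from O the body is open. Near a point of O the Hessian of the defining function stays
positive on the kernel of its differential, so along a short segment f has no interior local
maximum. Its maximum is attained at an endpoint, where f ≤ 0. -/
theorem IsOvaloid.exists_segment_subset [FiniteDimensional ℝ E] {O : Set E} (hO : IsOvaloid O)
    {p : E} (hp : p ∈ (outside O)ᶜ) : ∃ r > 0, ∀ a ∈ (outside O)ᶜ ∩ Metric.ball p r,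
      ∀ b ∈ (outside O)ᶜ ∩ Metric.ball p r, segment ℝ a b ⊆ (outside O)ᶜ := by
  by_cases hpO : p ∈ O
  · obtain ⟨U, f, hpU, hf, hpos⟩ := (isOvaloid_iff.1 hO).2.2 p hpO
    have c1 : ContDiffAt ℝ 1 (fderiv ℝ f) p := (hf.contDiffAt_two hpU).fderiv_right (by norm_num)
    have hev := eventually_pos_on_ker (ℓ := fderiv ℝ f) (Q := fderiv ℝ (fderiv ℝ f))
      c1.continuousAt (c1.fderiv_right (m := 0) (by norm_num)).continuousAt hpos
    obtain ⟨r, hr, hball⟩ := Metric.eventually_nhds_iff_ball.1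
      (hev.and (hf.isOpen.mem_nhds hpU))
    refine ⟨r, hr, fun a ha b hb => ?_⟩
    have hseg : ∀ t ∈ Icc (0 : ℝ) 1, a + t • (b - a) ∈ Metric.ball p r := fun t ht =>
      (convex_ball p r).segment_subset ha.2 hb.2 (by rw [segment_eq_image']; exact ⟨t, ht, rfl⟩)
    rcases eq_or_ne b a with rfl | hne
    · simpa using ha.1
    have hcd : ∀ t ∈ Icc (0 : ℝ) 1, ContDiffAt ℝ 2 f (a + t • (b - a)) := fun t ht =>
      hf.contDiffAt_two (hball _ (hseg t ht)).2
    have hcont : ∀ t ∈ Icc (0 : ℝ) 1, ContinuousAt (fun s : ℝ => f (a + s • (b - a))) t :=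
      fun t ht => ContinuousAt.comp (g := f) (hcd t ht).continuousAt (by fun_prop)
    obtain ⟨t₀, ht₀, hmax⟩ := isCompact_Icc.exists_isMaxOn (nonempty_Icc.2 zero_le_one)
      (f := fun s : ℝ => f (a + s • (b - a))) fun t ht => (hcont t ht).continuousWithinAt
    have hle : f (a + t₀ • (b - a)) ≤ 0 := by
      by_cases h0 : t₀ = 0
      · simpa [h0] using hf.nonpos (hball a ha.2).2 ha.1
      by_cases h1 : t₀ = 1
      · simpa [h1] using hf.nonpos (hball b hb.2).2 hb.1
      exfalso
      have hIoo : t₀ ∈ Ioo (0 : ℝ) 1 :=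
        ⟨lt_of_le_of_ne ht₀.1 (Ne.symm h0), lt_of_le_of_ne ht₀.2 h1⟩
      have hloc : IsLocalMax (fun s : ℝ => f (a + s • (b - a))) t₀ :=
        hmax.isLocalMax (Icc_mem_nhds hIoo.1 hIoo.2)
      have hd0 := hloc.hasDerivAt_eq_zero
        (hasDerivAt_comp_line ((hcd t₀ ht₀).differentiableAt (by norm_num)))
      refine not_isLocalMax_of_deriv_deriv_pos ?_ (hcont t₀ ht₀) hloc
      rw [deriv_deriv_comp_line (hcd t₀ ht₀)]
      exact (hball _ (hseg t₀ ht₀)).1 _ (sub_ne_zero.2 hne) hd0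
    rw [segment_eq_image']
    rintro _ ⟨t, ht, rfl⟩
    exact hf.notMem_outside (hball _ (hseg t ht)).2 (le_trans (hmax ht) hle)
  · obtain ⟨r, hr, hball⟩ := Metric.isOpen_iff.1 (isOpen_compl_outside_diff hO.isCompact.isClosed) p
      ⟨hp, hpO⟩
    refine ⟨r, hr, fun a ha b hb => ?_⟩
    exact ((convex_ball p r).segment_subset ha.2 hb.2).trans fun x hx => (hball hx).1

/-- The region bounded by an ovaloid is convex. -/
theorem IsOvaloid.convex [FiniteDimensional ℝ E] [Nontrivial E] {O : Set E} (hO : IsOvaloid O) :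
    Convex ℝ (outside O)ᶜ :=
  hO.isCompact.compl_outside.convex_of_locally_convex
    (hO.isConnected.isPreconnected_compl_outside hO.isCompact.isClosed)
    fun _ hp => hO.exists_segment_subset hp

variable [FiniteDimensional ℝ E] [Nontrivial E]

/-- A strict supporting hyperplane. By convexity f ≤ 0 on the segment from p to x; a positive
derivative, or a zero derivative with positive second derivative, would make f positive just after
p. -/
theorem IsOvaloid.fderiv_neg {O U : Set E} {f : E → ℝ} (hO : IsOvaloid O)
    (hf : IsOuterDefiningFunction O U f) {p : E} (hpU : p ∈ U) (hpO : p ∈ O)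
    (hpos : ∀ v, v ≠ 0 → fderiv ℝ f p v = 0 → 0 < fderiv ℝ (fderiv ℝ f) p v v)
    {x : E} (hx : x ∈ (outside O)ᶜ) (hxp : x ≠ p) : fderiv ℝ f p (x - p) < 0 := by
  have h0 : f p = 0 := (hf.zero_iff p hpU).2 hpO
  have hmem : ∀ᶠ t : ℝ in 𝓝[>] 0, f (p + t • (x - p)) ≤ 0 := by
    filter_upwards [(eventually_line_mem hf.isOpen hpU (x - p)).filter_mono nhdsWithin_le_nhds,
      Ioo_mem_nhdsGT (show (0 : ℝ) < 1 by norm_num)] with t ht ht'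
    refine hf.nonpos ht (hO.convex.segment_subset (subset_compl_outside O hpO) hx ?_)
    rw [segment_eq_image']
    exact ⟨t, Ioo_subset_Icc_self ht', rfl⟩
  by_contra hcon
  have hev : ∀ᶠ t : ℝ in 𝓝[>] 0, f p < f (p + t • (x - p)) := by
    have hd := hf.hasDerivAt_line hpU (x - p)
    rcases (not_lt.1 hcon).lt_or_eq with h | h
    · simpa using hd.eventually_lt_right h
    · have h2 : 0 < deriv (deriv fun t : ℝ => f (p + t • (x - p))) 0 := by
        rw [deriv_deriv_comp_line (by simpa using hf.contDiffAt_two hpU)]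
        simpa using hpos (x - p) (sub_ne_zero.2 hxp) h.symm
      have := eventually_lt_right_of_deriv_deriv_pos h2 (hd.deriv.trans h.symm) (by
        filter_upwards [eventually_line_mem hf.isOpen hpU (x - p)] with t ht
        exact ContinuousAt.comp (g := f) (hf.contDiffAt ht).continuousAt (by fun_prop))
      simpa using this
  obtain ⟨t, h1, h2⟩ := (hev.and hmem).exists
  linarith

/-- The outer unit normal, with a defining function certifying it. -/
theorem IsOvaloid.exists_definingFunction {O : Set E} (hO : IsOvaloid O) {p : E} (hp : p ∈ O) :
    ‖gaussMap O p‖ = 1 ∧ ∃ (U : Set E) (f : E → ℝ), p ∈ U ∧ IsOuterDefiningFunction O U f ∧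
      gradient f p = ‖gradient f p‖ • gaussMap O p ∧
      ∀ v, v ≠ 0 → fderiv ℝ f p v = 0 → 0 < fderiv ℝ (fderiv ℝ f) p v v := by
  obtain ⟨U, f, hpU, hf, hpos⟩ := (isOvaloid_iff.1 hO).2.2 p hp
  have hg := norm_ne_zero_iff.2 (hf.regular p hpU)
  have heq : gaussMap O p = unitNormal f p :=
    IsOuterUnitNormal.gaussMap_eq ⟨U, f, hpU, hp, hf, rfl⟩
  refine ⟨?_, U, f, hpU, hf, ?_, hpos⟩
  · rw [heq, unitNormal, norm_smul, norm_inv, norm_norm, inv_mul_cancel₀ hg]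
  · rw [heq, unitNormal, smul_inv_smul₀ hg]

theorem IsOvaloid.inner_gaussMap_lt {O : Set E} (hO : IsOvaloid O) {p : E} (hp : p ∈ O) {x : E}
    (hx : x ∈ (outside O)ᶜ) (hxp : x ≠ p) : ⟪gaussMap O p, x⟫_ℝ < ⟪gaussMap O p, p⟫_ℝ := by
  obtain ⟨-, U, f, hpU, hf, hgr, hpos⟩ := hO.exists_definingFunction hp
  have h := hO.fderiv_neg hf hpU hp hpos hx hxp
  rw [← inner_gradient, hgr, inner_smul_left, inner_sub_right] at h
  have := norm_nonneg (gradient f p)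
  simp only [conj_trivial] at h
  by_contra hcon
  nlinarith [mul_nonneg this (sub_nonneg.2 (not_lt.1 hcon))]

/-- Take a point q of the body maximizing ⟨u, ·⟩. It lies on O, since elsewhere it could be pushed
along u. If its normal ν were not u, the direction u - ν would enter the body and increase ⟨u, ·⟩.
-/
theorem IsOvaloid.exists_gaussMap_eq {O : Set E} (hO : IsOvaloid O) {u : E} (hu : ‖u‖ = 1) :
    ∃ p ∈ O, gaussMap O p = u := by
  obtain ⟨q, hq, hmax⟩ := hO.isCompact.compl_outside.exists_isMaxOn
    (hO.isConnected.nonempty.mono (subset_compl_outside O)) (f := fun x => ⟪u, x⟫_ℝ) (by fun_prop)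
  have hqO : q ∈ O := by
    by_contra hqO
    obtain ⟨t, ht, ht0⟩ := (((eventually_line_mem (isOpen_compl_outside_diff hO.isCompact.isClosed)
      ⟨hq, hqO⟩ u).filter_mono nhdsWithin_le_nhds).and
      (self_mem_nhdsWithin (s := Ioi (0 : ℝ)))).exists
    have h1 : ⟪u, q + t • u⟫_ℝ ≤ ⟪u, q⟫_ℝ := hmax ht.1
    rw [inner_add_right, inner_smul_right, real_inner_self_eq_norm_sq, hu] at h1
    have : 0 < t := ht0
    linarith
  refine ⟨q, hqO, ?_⟩
  obtain ⟨hn, U, f, hqU, hf, hgr, -⟩ := hO.exists_definingFunction hqO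
  by_contra hne
  have hlt : ⟪gaussMap O q, u⟫_ℝ < 1 :=
    lt_of_le_of_ne (by simpa [hn, hu] using real_inner_le_norm (gaussMap O q) u)
      (fun h => hne ((inner_eq_one_iff_of_norm_eq_one hn hu).1 h))
  set v := u - gaussMap O q with hv
  have hd : fderiv ℝ f q v < 0 := by
    rw [← inner_gradient, hgr, inner_smul_left, hv, inner_sub_right, real_inner_self_eq_norm_sq, hn]
    exact mul_neg_of_pos_of_neg (norm_pos_iff.2 (hf.regular q hqU)) (by linarith)
  have e₁ := (hf.hasDerivAt_line hqU v).eventually_gt_right hd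
  simp only [zero_smul, add_zero, (hf.zero_iff q hqU).2 hqO] at e₁
  obtain ⟨t, h1, h2, h3⟩ := (e₁.and (((eventually_line_mem hf.isOpen hqU v).filter_mono
    nhdsWithin_le_nhds).and (self_mem_nhdsWithin (s := Ioi (0 : ℝ))))).exists
  have h4 : ⟪u, q + t • v⟫_ℝ ≤ ⟪u, q⟫_ℝ := hmax (hf.notMem_outside h2 h1.le)
  rw [inner_add_right, inner_smul_right, hv, inner_sub_right, real_inner_self_eq_norm_sq, hu,
    real_inner_comm (gaussMap O q) u] at h4
  have h5 : 0 < t := h3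
  nlinarith

theorem IsOvaloid.supportParam_mem {O : Set E} (hO : IsOvaloid O) {u : E} (hu : ‖u‖ = 1) :
    supportParam O u ∈ O :=
  Function.invFunOn_mem (hO.exists_gaussMap_eq hu)

theorem IsOvaloid.gaussMap_supportParam {O : Set E} (hO : IsOvaloid O) {u : E} (hu : ‖u‖ = 1) :
    gaussMap O (supportParam O u) = u :=
  Function.invFunOn_eq (hO.exists_gaussMap_eq hu)

/-- The support parameterization picks the strict maximizer of a linear form. -/
theorem IsOvaloid.inner_lt_inner_supportParam {O : Set E} (hO : IsOvaloid O) {u : E} (hu : ‖u‖ = 1)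
    {x : E} (hx : x ∈ (outside O)ᶜ) (hxp : x ≠ supportParam O u) :
    ⟪u, x⟫_ℝ < ⟪u, supportParam O u⟫_ℝ := by
  have h := hO.inner_gaussMap_lt (hO.supportParam_mem hu) hx hxp
  rwa [hO.gaussMap_supportParam hu] at h

theorem IsOvaloid.inner_le_inner_supportParam {O : Set E} (hO : IsOvaloid O) {u : E} (hu : ‖u‖ = 1)
    {x : E} (hx : x ∈ (outside O)ᶜ) : ⟪u, x⟫_ℝ ≤ ⟪u, supportParam O u⟫_ℝ := by
  rcases eq_or_ne x (supportParam O u) with rfl | h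
  · exact le_rfl
  · exact (hO.inner_lt_inner_supportParam hu hx h).le

/-- Injectivity of the Gauss map: of two distinct points with the same normal, each would be the
strict maximizer of the same linear form. -/
theorem IsOvaloid.supportParam_gaussMap {O : Set E} (hO : IsOvaloid O) {p : E} (hp : p ∈ O) :
    supportParam O (gaussMap O p) = p := by
  have hn := (hO.exists_definingFunction hp).1
  by_contra hne
  have h1 := hO.inner_lt_inner_supportParam hn (subset_compl_outside O hp) (Ne.symm hne)
  have h2 := hO.inner_gaussMap_lt hp (subset_compl_outside O (hO.supportParam_mem hn)) hne
  exact lt_asymm h1 h2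

/-- The exterior of an ovaloid in terms of its supporting half-spaces. -/
theorem IsOvaloid.mem_outside_iff {O : Set E} (hO : IsOvaloid O) {y : E} :
    y ∈ outside O ↔ ∃ v : E, ‖v‖ = 1 ∧ ⟪v, supportParam O v⟫_ℝ < ⟪v, y⟫_ℝ := by
  constructor
  · intro hy
    obtain ⟨g, s, hg, hgs⟩ := geometric_hahn_banach_point_closed hO.convex
      hO.isCompact.compl_outside.isClosed (notMem_compl_iff.2 hy)
    set a := (InnerProductSpace.toDual ℝ E).symm g with ha
    have hga : ∀ x, g x = ⟪a, x⟫_ℝ := fun x => by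
      rw [ha, InnerProductSpace.toDual_symm_apply]
    have ha0 : a ≠ 0 := by
      intro h0
      obtain ⟨x, hx⟩ := hO.isConnected.nonempty
      have := hgs x (subset_compl_outside O hx)
      rw [hga, h0, inner_zero_left] at this hg
      linarith
    have han : 0 < ‖a‖ := norm_pos_iff.2 ha0
    have hu : ‖-(‖a‖⁻¹ • a)‖ = 1 := by
      rw [norm_neg, norm_smul, norm_inv, norm_norm, inv_mul_cancel₀ han.ne']
    refine ⟨_, hu, ?_⟩
    have h4 := hgs _ (subset_compl_outside O (hO.supportParam_mem hu))
    rw [inner_neg_left, inner_neg_left, inner_smul_left, inner_smul_left, ← hga, ← hga]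
    simp only [conj_trivial]
    exact neg_lt_neg (mul_lt_mul_of_pos_left (hg.trans h4) (inv_pos.2 han))
  · rintro ⟨v, hv, h⟩
    by_contra hy
    exact absurd (hO.inner_le_inner_supportParam hv hy) (not_le.2 h)

/-- An ovaloid is the set of boundary points of the intersection of its supporting half-spaces. -/
theorem IsOvaloid.mem_iff {O : Set E} (hO : IsOvaloid O) {y : E} :
    y ∈ O ↔ (∀ v : E, ‖v‖ = 1 → ⟪v, y⟫_ℝ ≤ ⟪v, supportParam O v⟫_ℝ) ∧
      ∃ v : E, ‖v‖ = 1 ∧ ⟪v, y⟫_ℝ = ⟪v, supportParam O v⟫_ℝ := by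
  constructor
  · intro hy
    exact ⟨fun v hv => hO.inner_le_inner_supportParam hv (subset_compl_outside O hy),
      gaussMap O y, (hO.exists_definingFunction hy).1, by rw [hO.supportParam_gaussMap hy]⟩
  · rintro ⟨h1, v, hv, h2⟩
    have hyK : y ∈ (outside O)ᶜ := fun hy => by
      obtain ⟨w, hw, hlt⟩ := hO.mem_outside_iff.1 hy
      exact absurd (h1 w hw) (not_le.2 hlt)
    by_contra hyO
    refine absurd h2 (hO.inner_lt_inner_supportParam hv hyK ?_).ne
    rintro rfl
    exact hyO (hO.supportParam_mem hv)

/-- Start on O and move slightly against the normal. The point reached is in the body with f < 0, so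
it is not on O and cannot be the maximizer of any linear form. -/
theorem IsOvaloid.exists_interior_point {O : Set E} (hO : IsOvaloid O) :
    ∃ m : E, ∀ v : E, ‖v‖ = 1 → ⟪v, m⟫_ℝ < ⟪v, supportParam O v⟫_ℝ := by
  obtain ⟨p, hp⟩ := hO.isConnected.nonempty
  obtain ⟨hn, U, f, hpU, hf, hgr, -⟩ := hO.exists_definingFunction hp
  have hd : fderiv ℝ f p (-gaussMap O p) < 0 := by
    rw [← inner_gradient, hgr, inner_smul_left, inner_neg_right, real_inner_self_eq_norm_sq, hn]
    exact mul_neg_of_pos_of_neg (norm_pos_iff.2 (hf.regular p hpU)) (by norm_num)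
  have e₁ := (hf.hasDerivAt_line hpU _).eventually_gt_right hd
  simp only [zero_smul, add_zero, (hf.zero_iff p hpU).2 hp] at e₁
  obtain ⟨t, h1, h2⟩ := (e₁.and
    ((eventually_line_mem hf.isOpen hpU _).filter_mono nhdsWithin_le_nhds)).exists
  refine ⟨_, fun v hv => hO.inner_lt_inner_supportParam hv (hf.notMem_outside h2 h1.le) ?_⟩
  intro heq
  have := (hf.zero_iff _ h2).2 (heq ▸ hO.supportParam_mem hv)
  linarith

end Ovaloid

/-! ### Affine images of ovaloids -/

section Affine

variable {E : Type*} [NormedAddCommGroup E] [InnerProductSpace ℝ E]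
  {F : Type*} [NormedAddCommGroup F] [InnerProductSpace ℝ F]

/-- The affine homeomorphism `y ↦ q + L y`. -/
def affineHomeo (L : E ≃L[ℝ] F) (q : F) : E ≃ₜ F :=
  L.toHomeomorph.trans (Homeomorph.addLeft q)

theorem affineHomeo_apply (L : E ≃L[ℝ] F) (q : F) (y : E) : affineHomeo L q y = q + L y := rfl

theorem affineHomeo_symm_apply (L : E ≃L[ℝ] F) (q y : F) :
    (affineHomeo L q).symm y = L.symm (y - q) := by
  rw [Homeomorph.symm_apply_eq, affineHomeo_apply]
  simp

theorem isBounded_affineHomeo_image (L : E ≃L[ℝ] F) (q : F) {B : Set E} :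
    Bornology.IsBounded (affineHomeo L q '' B) ↔ Bornology.IsBounded B := by
  constructor
  · intro h
    have h1 : LipschitzWith (‖(L.symm : F →L[ℝ] E)‖₊ * 1) fun y : F => L.symm (y + -q) :=
      L.symm.lipschitz.comp (Isometry.lipschitz (isometry_add_right (-q)))
    have h2 := h1.isBounded_image h
    rw [image_image] at h2
    simpa [affineHomeo_apply] using h2
  · intro h
    have h1 : LipschitzWith (1 * ‖(L : E →L[ℝ] F)‖₊) fun y : E => q + L y :=
      (Isometry.lipschitz (isometry_add_left q)).comp L.lipschitz
    exact h1.isBounded_image h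

theorem mem_outside_affineHomeo_image (L : E ≃L[ℝ] F) (q : F) (O : Set E) (x : E) :
    affineHomeo L q x ∈ outside (affineHomeo L q '' O) ↔ x ∈ outside O := by
  have hcompl : (affineHomeo L q '' O)ᶜ = affineHomeo L q '' Oᶜ :=
    (image_compl_eq (affineHomeo L q).bijective).symm
  simp only [outside, mem_ofPred_eq]
  rw [hcompl, (affineHomeo L q).injective.mem_set_image]
  refine and_congr_right fun hx => not_congr ?_
  rw [← (affineHomeo L q).image_connectedComponentIn hx, isBounded_affineHomeo_image]

variable [FiniteDimensional ℝ E] [CompleteSpace E] [FiniteDimensional ℝ F] [CompleteSpace F]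

/-- Positivity of the Hessian on the kernel of the differential is an affine notion, although
principal curvatures are not. General linear L are needed because a tilted plane will be identified
with E by a graph map, which is not an isometry. -/
theorem IsOvaloid.affine_image {O : Set E} (hO : IsOvaloid O) (L : E ≃L[ℝ] F) (q : F) :
    IsOvaloid ((fun y => q + L y) '' O) := by
  have he : (fun y => q + L y) = affineHomeo L q := rfl
  rw [he]
  set e := affineHomeo L q with hedef
  rw [isOvaloid_iff] at hO ⊢
  refine ⟨hO.1.image e.continuous, hO.2.1.image _ e.continuous.continuousOn, ?_⟩
  rintro _ ⟨p, hp, rfl⟩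
  obtain ⟨U, f, hpU, hf, hpos⟩ := hO.2.2 p hp
  set f' : F → ℝ := fun y => f (L.symm (y - q)) with hf'
  have hes : ∀ y : F, L.symm (y - q) = e.symm y := fun y => (affineHomeo_symm_apply L q y).symm
  have hsub : ∀ y ∈ e '' U, e.symm y ∈ U := by
    rintro _ ⟨x, hx, rfl⟩
    simpa using hx
  have hfd : ∀ y ∈ e '' U, fderiv ℝ f' y = fderiv ℝ f (e.symm y) ∘L (L.symm : F →L[ℝ] E) := by
    intro y hy
    have h1 : HasFDerivAt (fun y : F => L.symm (y - q)) (L.symm : F →L[ℝ] E) y := by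
      simp only [map_sub]
      exact L.symm.hasFDerivAt.sub_const _
    have h2 := ((hf.contDiffAt (hsub y hy)).differentiableAt (by simp)).hasFDerivAt
    rw [← hes] at h2 ⊢
    exact (h2.comp y h1).fderiv
  have hsm : ContDiffOn ℝ ∞ f' (e '' U) := by
    refine hf.smooth.comp (t := U) (f := fun y : F => L.symm (y - q)) (ContDiff.contDiffOn ?_)
      fun y hy => ?_
    · exact L.symm.contDiff.comp (contDiff_id.sub contDiff_const)
    · dsimp only
      rw [hes]; exact hsub y hy
  have hopen : IsOpen (e '' U) := e.isOpenMap U hf.isOpen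
  have hpU' : e p ∈ e '' U := mem_image_of_mem _ hpU
  refine ⟨e '' U, f', hpU', ⟨hopen, hsm, ?_, ?_, ?_⟩, ?_⟩
  · intro y hy
    have hr := hf.regular _ (hsub y hy)
    rw [gradient_ne_zero_iff] at hr ⊢
    intro h0
    rw [hfd y hy] at h0
    apply hr
    ext v
    simpa using congrArg (fun g : F →L[ℝ] ℝ => g (L v)) h0
  · rintro _ ⟨x, hx, rfl⟩
    rw [e.injective.mem_set_image, ← hf.zero_iff x hx]
    simp [hf', hes]
  · rintro _ ⟨x, hx, rfl⟩
    rw [hedef, mem_outside_affineHomeo_image, ← hf.pos_iff x hx]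
    simp [hf', hes, ← hedef]
  · intro v hv h0
    have h1 : fderiv ℝ f p (L.symm v) = 0 := by
      rw [hfd _ hpU'] at h0
      simpa using h0
    have h2 := hpos (L.symm v) (by simpa using hv) h1
    have h3 : ContDiffAt ℝ 2 f' (e p + (0 : ℝ) • v) := by
      rw [zero_smul, add_zero]
      exact (hsm.contDiffAt (hopen.mem_nhds hpU')).of_le ENat.LEInfty.out
    have h4 := deriv_deriv_comp_line h3
    have h5 := deriv_deriv_comp_line (f := f) (a := p) (v := L.symm v) (t := 0)
      (by simpa using hf.contDiffAt_two hpU)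
    have h6 : (fun s : ℝ => f' (e p + s • v)) = fun s : ℝ => f (p + s • L.symm v) := by
      funext s
      simp only [hf', hedef, affineHomeo_apply]
      congr 1
      rw [show q + L p + s • v - q = L p + s • v by abel, map_add, map_smul,
        ContinuousLinearEquiv.symm_apply_apply]
    rw [h6, h5] at h4
    simp only [zero_smul, add_zero] at h4
    rw [← h4]
    exact h2

end Affine

/-! ### Smooth families of ovaloids -/

section Family

variable {E : Type*} [NormedAddCommGroup E] [InnerProductSpace ℝ E] [CompleteSpace E]

/-- The hypersurface parameterized by `S(·, z)` on the unit sphere. -/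
def slice (S : E × ℝ → E) (z : ℝ) : Set E := (fun x => S (x, z)) '' Metric.sphere 0 1

/-- The boundary point of `slice S z` with outer normal direction `v`, at `p = (v, z)`. -/
noncomputable def suppPt (S : E × ℝ → E) (p : E × ℝ) : E := supportParam (slice S p.2) (‖p.1‖⁻¹ • p.1)

/-- The support function of `slice S z` at `v`, at `p = (v, z)`. -/
noncomputable def suppFn (S : E × ℝ → E) (p : E × ℝ) : ℝ := ⟪p.1, suppPt S p⟫_ℝ

/-- A smooth family of ovaloids indexed by an open set `I` of heights, parameterized by the unit
sphere through maps extended to nonzero vectors by homogeneity of degree `0`. -/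
structure OvaloidFamily (S : E × ℝ → E) (I : Set ℝ) : Prop where
  isOpen : IsOpen I
  smooth : ContDiffOn ℝ ∞ S ({0}ᶜ ×ˢ I)
  homog : ∀ t : ℝ, 0 < t → ∀ x z, S (t • x, z) = S (x, z)
  immersion : ∀ x, x ≠ 0 → ∀ z ∈ I, ∀ ξ, fderiv ℝ S (x, z) (ξ, 0) = 0 → ∃ r : ℝ, ξ = r • x
  injOn : ∀ z ∈ I, InjOn (fun x => S (x, z)) (Metric.sphere 0 1)
  ovaloid : ∀ z ∈ I, IsOvaloid (slice S z)

theorem norm_inv_norm_smul {v : E} (hv : v ≠ 0) : ‖‖v‖⁻¹ • v‖ = 1 := by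
  rw [norm_smul, norm_inv, norm_norm, inv_mul_cancel₀ (norm_ne_zero_iff.2 hv)]

variable {S : E × ℝ → E} {I : Set ℝ}

namespace OvaloidFamily

theorem isOpen_domain (hS : OvaloidFamily S I) : IsOpen (({0}ᶜ : Set E) ×ˢ I) :=
  isOpen_compl_singleton.prod hS.isOpen

theorem domain_mem_nhds (hS : OvaloidFamily S I) {x : E} (hx : x ≠ 0) {z : ℝ} (hz : z ∈ I) :
    ({0}ᶜ : Set E) ×ˢ I ∈ 𝓝 (x, z) :=
  hS.isOpen_domain.mem_nhds ⟨hx, hz⟩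

theorem contDiffAt (hS : OvaloidFamily S I) {x : E} (hx : x ≠ 0) {z : ℝ} (hz : z ∈ I) :
    ContDiffAt ℝ ∞ S (x, z) :=
  hS.smooth.contDiffAt (hS.domain_mem_nhds hx hz)

theorem mem_slice (hS : OvaloidFamily S I) {x : E} (hx : x ≠ 0) (z : ℝ) : S (x, z) ∈ slice S z := by
  refine ⟨‖x‖⁻¹ • x, by simpa using norm_inv_norm_smul hx, ?_⟩
  exact hS.homog _ (inv_pos.2 (norm_pos_iff.2 hx)) x z

theorem suppPt_smul {t : ℝ} (ht : 0 < t) (v : E) (z : ℝ) :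
    suppPt S (t • v, z) = suppPt S (v, z) := by
  simp only [suppPt]
  congr 1
  rcases eq_or_ne v 0 with rfl | hv
  · simp
  rw [norm_smul, Real.norm_of_nonneg ht.le, smul_smul]
  congr 1
  field_simp

theorem suppFn_smul {t : ℝ} (ht : 0 < t) (v : E) (z : ℝ) :
    suppFn S (t • v, z) = t * suppFn S (v, z) := by
  simp only [suppFn]
  rw [suppPt_smul ht, inner_smul_left]
  simp

theorem suppPt_of_norm_one {v : E} (hv : ‖v‖ = 1) (z : ℝ) :
    suppPt S (v, z) = supportParam (slice S z) v := by
  simp [suppPt, hv]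

theorem hasDerivAt_line (hS : OvaloidFamily S I) {x : E} (hx : x ≠ 0) {z : ℝ} (hz : z ∈ I) (ξ : E) :
    HasDerivAt (fun t : ℝ => S (x + t • ξ, z)) (fderiv ℝ S (x, z) (ξ, 0)) 0 := by
  have := hasDerivAt_comp_line (f := S) (a := (x, z)) (v := (ξ, 0)) (t := 0)
    (by simpa using (hS.contDiffAt hx hz).differentiableAt (by simp))
  simpa using this

theorem hasDerivAt_fderiv_line (hS : OvaloidFamily S I) {x : E} (hx : x ≠ 0) {z : ℝ} (hz : z ∈ I)
    (ξ η : E) : HasDerivAt (fun t : ℝ => fderiv ℝ S (x + t • ξ, z) (η, 0))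
      (fderiv ℝ (fderiv ℝ S) (x, z) (ξ, 0) (η, 0)) 0 := by
  have := hasDerivAt_fderiv_comp_line (f := S) (a := (x, z)) (v := (ξ, 0)) (t := 0)
    (by simpa using (hS.contDiffAt hx hz).of_le ENat.LEInfty.out) (η, 0)
  simpa using this

theorem eventually_ne_zero {x : E} (hx : x ≠ 0) (ξ : E) : ∀ᶠ t : ℝ in 𝓝 0, x + t • ξ ≠ 0 :=
  eventually_line_mem (isOpen_compl_singleton (x := (0 : E))) hx ξ

theorem fderiv_self (hS : OvaloidFamily S I) {x : E} (hx : x ≠ 0) {z : ℝ} (hz : z ∈ I) :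
    fderiv ℝ S (x, z) (x, 0) = 0 := by
  have h1 : (fun t : ℝ => S (x + t • x, z)) =ᶠ[𝓝 0] fun _ => S (x, z) := by
    filter_upwards [lt_mem_nhds (show (-1 : ℝ) < 0 by norm_num)] with t ht
    rw [show x + t • x = (1 + t) • x by module]
    exact hS.homog _ (by linarith) x z
  exact (hS.hasDerivAt_line hx hz x).unique ((hasDerivAt_const _ _).congr_of_eventuallyEq h1)

/-- Differentiate the Euler relation dS(x) x = 0 in the direction η. -/
theorem fderiv_fderiv_self (hS : OvaloidFamily S I) {x : E} (hx : x ≠ 0) {z : ℝ} (hz : z ∈ I)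
    (η : E) : fderiv ℝ (fderiv ℝ S) (x, z) (η, 0) (x, 0) = -fderiv ℝ S (x, z) (η, 0) := by
  have h1 : (fun t : ℝ => fderiv ℝ S (x + t • η, z) (x, 0)
      + t • fderiv ℝ S (x + t • η, z) (η, 0)) =ᶠ[𝓝 0] fun _ => 0 := by
    filter_upwards [eventually_ne_zero hx η] with t ht
    have := hS.fderiv_self ht hz
    rwa [show ((x + t • η, 0) : E × ℝ) = (x, 0) + t • (η, 0) by simp, map_add, map_smul] at this
  have h2 := (hS.hasDerivAt_fderiv_line hx hz η x).add
    ((hasDerivAt_id (0 : ℝ)).smul (hS.hasDerivAt_fderiv_line hx hz η η))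
  have h3 := h2.unique ((hasDerivAt_const _ _).congr_of_eventuallyEq h1)
  simp only [id, zero_smul, add_zero, one_smul, zero_add] at h3
  exact eq_neg_of_add_eq_zero_left h3

variable [FiniteDimensional ℝ E] [Nontrivial E]

theorem suppPt_mem (hS : OvaloidFamily S I) {v : E} (hv : v ≠ 0) {z : ℝ} (hz : z ∈ I) :
    suppPt S (v, z) ∈ slice S z :=
  (hS.ovaloid z hz).supportParam_mem (norm_inv_norm_smul hv)

theorem inner_lt_suppFn (hS : OvaloidFamily S I) {v : E} (hv : v ≠ 0) {z : ℝ} (hz : z ∈ I) {y : E}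
    (hy : y ∈ slice S z) (hne : y ≠ suppPt S (v, z)) : ⟪v, y⟫_ℝ < suppFn S (v, z) := by
  have h := (hS.ovaloid z hz).inner_lt_inner_supportParam (norm_inv_norm_smul hv)
    (subset_compl_outside _ hy) hne
  rw [inner_smul_left, inner_smul_left] at h
  simp only [conj_trivial] at h
  exact lt_of_mul_lt_mul_left h (by positivity)

theorem inner_le_suppFn (hS : OvaloidFamily S I) (v : E) {z : ℝ} (hz : z ∈ I) {y : E}
    (hy : y ∈ slice S z) : ⟪v, y⟫_ℝ ≤ suppFn S (v, z) := by
  rcases eq_or_ne v 0 with rfl | hv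
  · simp [suppFn]
  rcases eq_or_ne y (suppPt S (v, z)) with rfl | h
  · exact le_rfl
  · exact (hS.inner_lt_suppFn hv hz hy h).le

theorem mem_slice_iff (hS : OvaloidFamily S I) {z : ℝ} (hz : z ∈ I) {y : E} :
    y ∈ slice S z ↔ (∀ v : E, ‖v‖ = 1 → ⟪v, y⟫_ℝ ≤ suppFn S (v, z)) ∧
      ∃ v : E, ‖v‖ = 1 ∧ ⟪v, y⟫_ℝ = suppFn S (v, z) := by
  rw [(hS.ovaloid z hz).mem_iff]
  have h : ∀ v : E, ‖v‖ = 1 → suppFn S (v, z) = ⟪v, supportParam (slice S z) v⟫_ℝ := fun v hv => by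
    rw [suppFn, suppPt_of_norm_one hv]
  constructor
  · rintro ⟨h1, v, hv, h2⟩
    exact ⟨fun v hv => by rw [h v hv]; exact h1 v hv, v, hv, by rw [h v hv]; exact h2⟩
  · rintro ⟨h1, v, hv, h2⟩
    exact ⟨fun v hv => by rw [← h v hv]; exact h1 v hv, v, hv, by rw [← h v hv]; exact h2⟩

/-- A defining function of a slice at `suppPt S (v, z)`. -/
theorem exists_definingFunction (hS : OvaloidFamily S I) {v : E} (hv : v ≠ 0) {z : ℝ} (hz : z ∈ I) :
    ∃ (U : Set E) (f : E → ℝ), suppPt S (v, z) ∈ U ∧ IsOuterDefiningFunction (slice S z) U f ∧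
      (∃ r > 0, ∀ w, fderiv ℝ f (suppPt S (v, z)) w = r * ⟪v, w⟫_ℝ) ∧
      ∀ w, w ≠ 0 → ⟪v, w⟫_ℝ = 0 → 0 < fderiv ℝ (fderiv ℝ f) (suppPt S (v, z)) w w := by
  have hO := hS.ovaloid z hz
  have hn := norm_inv_norm_smul hv
  obtain ⟨-, U, f, hpU, hf, hgr, hpos⟩ := hO.exists_definingFunction (hS.suppPt_mem hv hz)
  have hgm : gaussMap (slice S z) (suppPt S (v, z)) = ‖v‖⁻¹ • v := hO.gaussMap_supportParam hn
  have hfd : ∀ w, fderiv ℝ f (suppPt S (v, z)) w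
      = ‖gradient f (suppPt S (v, z))‖ * ‖v‖⁻¹ * ⟪v, w⟫_ℝ := fun w => by
    rw [← inner_gradient, hgr, hgm, inner_smul_left, inner_smul_left, norm_smul, norm_smul]
    simp [hv, mul_assoc]
  have hr : 0 < ‖gradient f (suppPt S (v, z))‖ * ‖v‖⁻¹ :=
    mul_pos (norm_pos_iff.2 (hf.regular _ hpU)) (inv_pos.2 (norm_pos_iff.2 hv))
  exact ⟨U, f, hpU, hf, ⟨_, hr, hfd⟩, fun w hw h0 => hpos w hw (by rw [hfd, h0, mul_zero])⟩

/-- The linear form ⟨v, ·⟩ restricted to the slice is maximal, hence critical, at the parameter x.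
-/
theorem inner_fderiv_eq_zero (hS : OvaloidFamily S I) {v x : E} {z : ℝ} (hx : x ≠ 0) (hz : z ∈ I)
    (hxv : S (x, z) = suppPt S (v, z)) (ξ : E) : ⟪v, fderiv ℝ S (x, z) (ξ, 0)⟫_ℝ = 0 := by
  have hd : HasDerivAt (fun t : ℝ => ⟪v, S (x + t • ξ, z)⟫_ℝ) ⟪v, fderiv ℝ S (x, z) (ξ, 0)⟫_ℝ 0 := by
    simpa using (hasDerivAt_const (0 : ℝ) v).inner ℝ (hS.hasDerivAt_line hx hz ξ)
  refine IsLocalMax.hasDerivAt_eq_zero ?_ hd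
  filter_upwards [eventually_ne_zero hx ξ] with t ht
  simp only [zero_smul, add_zero]
  rw [hxv]
  exact hS.inner_le_suppFn v hz (hS.mem_slice ht z)

/-- Positive curvature, read in the parameterization. -/
theorem inner_fderiv_fderiv_neg (hS : OvaloidFamily S I) {v x : E} {z : ℝ} (hv : v ≠ 0) (hx : x ≠ 0)
    (hz : z ∈ I) (hxv : S (x, z) = suppPt S (v, z)) {η : E} (hη : ¬ ∃ r : ℝ, η = r • x) :
    ⟪v, fderiv ℝ (fderiv ℝ S) (x, z) (η, 0) (η, 0)⟫_ℝ < 0 := by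
  obtain ⟨U, f, hpU, hf, ⟨r, hr, hfd⟩, hpos⟩ := hS.exists_definingFunction hv hz
  rw [← hxv] at hpU hfd hpos
  have hcont : ContinuousAt (fun t : ℝ => S (x + t • η, z)) 0 :=
    (hS.hasDerivAt_line hx hz η).continuousAt
  have hU : ∀ᶠ t : ℝ in 𝓝 0, S (x + t • η, z) ∈ U :=
    hcont.eventually (by simpa using hf.isOpen.mem_nhds hpU)
  have hne := eventually_ne_zero hx η
  have hder : ∀ t : ℝ, x + t • η ≠ 0 →
      HasDerivAt (fun s : ℝ => S (x + s • η, z)) (fderiv ℝ S (x + t • η, z) (η, 0)) t := fun t ht => by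
    have := hasDerivAt_comp_line (f := S) (a := (x, z)) (v := (η, 0)) (t := t)
      (by simpa using (hS.contDiffAt ht hz).differentiableAt (by simp))
    simpa using this
  -- f vanishes along the parameterized slice. Its second derivative there gives f''(S_η, S_η) +
  -- f'(S_ηη) = 0 with f' = r⟨v, ·⟩, so a positive first term makes ⟨v, S_ηη⟩ negative.
  have h0 : (fun t : ℝ => f (S (x + t • η, z))) =ᶠ[𝓝 0] fun _ => 0 := by
    filter_upwards [hU, hne] with t ht ht'
    exact (hf.zero_iff _ ht).2 (hS.mem_slice ht' z)
  have h1 : (fun t : ℝ => fderiv ℝ f (S (x + t • η, z)) (fderiv ℝ S (x + t • η, z) (η, 0)))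
      =ᶠ[𝓝 0] fun _ => 0 := by
    filter_upwards [hU, hne, h0.eventuallyEq_nhds] with t ht ht' ht0
    have hft := ((hf.contDiffAt ht).differentiableAt (by simp)).hasFDerivAt
    exact (hft.comp_hasDerivAt t (hder t ht')).unique
      ((hasDerivAt_const _ _).congr_of_eventuallyEq ht0)
  have hd1 := hS.hasDerivAt_line hx hz η
  have hd2 := hS.hasDerivAt_fderiv_line hx hz η η
  have hD : DifferentiableAt ℝ (fderiv ℝ f) (S (x + (0 : ℝ) • η, z)) := by
    rw [zero_smul, add_zero]
    exact ((hf.contDiffAt_two hpU).fderiv_right (m := 1) (by norm_num)).differentiableAt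
      (by norm_num)
  have h2 : HasDerivAt (fun t : ℝ => fderiv ℝ f (S (x + t • η, z)))
      (fderiv ℝ (fderiv ℝ f) (S (x, z)) (fderiv ℝ S (x, z) (η, 0))) 0 := by
    have := hD.hasFDerivAt.comp_hasDerivAt (0 : ℝ) hd1
    rwa [zero_smul, add_zero] at this
  have h3 : HasDerivAt
      (fun t : ℝ => fderiv ℝ f (S (x + t • η, z)) (fderiv ℝ S (x + t • η, z) (η, 0))) _ 0 :=
    HasDerivAt.clm_apply h2 hd2
  replace h3 := h3.unique ((hasDerivAt_const (0 : ℝ) (0 : ℝ)).congr_of_eventuallyEq h1)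
  simp only [zero_smul, add_zero] at h3
  rw [hfd] at h3
  have h4 := hpos (fderiv ℝ S (x, z) (η, 0)) (fun h => hη (hS.immersion x hx z hz η h))
    (hS.inner_fderiv_eq_zero hx hz hxv η)
  nlinarith

end OvaloidFamily

end Family

/-! ### Smoothness of the support parameterization -/

section SupportSmooth

theorem ContinuousLinearMap.isInvertible_of_injective {F G : Type*} [NormedAddCommGroup F]
    [NormedSpace ℝ F] [FiniteDimensional ℝ F] [NormedAddCommGroup G] [NormedSpace ℝ G]
    [FiniteDimensional ℝ G] (A : F →L[ℝ] G) (hA : Function.Injective A)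
    (hfr : Module.finrank ℝ F = Module.finrank ℝ G) : A.IsInvertible :=
  ⟨(LinearEquiv.ofInjectiveOfFinrankEq (A : F →ₗ[ℝ] G) hA hfr).toContinuousLinearEquiv, by
    ext x; rfl⟩

theorem finrank_continuousDual {F : Type*} [NormedAddCommGroup F] [NormedSpace ℝ F]
    [FiniteDimensional ℝ F] : Module.finrank ℝ F = Module.finrank ℝ (F →L[ℝ] ℝ) := by
  rw [← (LinearMap.toContinuousLinearMap (𝕜 := ℝ) (E := F) (F' := ℝ)).finrank_eq]
  exact (Subspace.dual_finrank_eq (K := ℝ) (V := F)).symm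

variable {E : Type*} [NormedAddCommGroup E] [InnerProductSpace ℝ E] [CompleteSpace E]
  {S : E × ℝ → E} {I : Set ℝ} [FiniteDimensional ℝ E] [Nontrivial E]

namespace OvaloidFamily

/-- The parameter of the boundary point with a given normal depends continuously on the data. -/
theorem eventually_param_mem (hS : OvaloidFamily S I) {v₀ x₀ : E} {z₀ : ℝ} (hv₀ : v₀ ≠ 0)
    (hz₀ : z₀ ∈ I) (hx₀ : ‖x₀‖ = 1) (hxv : S (x₀, z₀) = suppPt S (v₀, z₀)) {W : Set E}
    (hW : W ∈ 𝓝 x₀) : ∀ᶠ p : E × ℝ in 𝓝 (v₀, z₀), ∀ x, ‖x‖ = 1 → S (x, p.2) = suppPt S p → x ∈ W := by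
  have hne : ∀ x : E, ‖x‖ = 1 → x ≠ 0 := fun x hx h => by simp [h] at hx
  have hK : IsCompact (Metric.sphere (0 : E) 1 \ interior W) :=
    (isCompact_sphere 0 1).diff isOpen_interior
  -- Off a neighbourhood of x₀ the value of ⟨v, S(x, z)⟩ stays strictly below its value at x₀,
  -- uniformly by compactness. Hence no maximizing parameter lies there.
  have hev : ∀ᶠ p : E × ℝ in 𝓝 (v₀, z₀), ∀ x ∈ Metric.sphere (0 : E) 1 \ interior W,
      ⟪p.1, S (x, p.2)⟫_ℝ < ⟪p.1, S (x₀, p.2)⟫_ℝ := by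
    refine hK.eventually_forall_of_forall_eventually fun x hx => ?_
    have hx1 : ‖x‖ = 1 := by simpa using hx.1
    have hcomp : ∀ y : E, y ≠ 0 → ContinuousAt (fun q : (E × ℝ) × E => S (y, q.1.2)) ((v₀, z₀), x) :=
      fun y hy => ContinuousAt.comp (g := S) (f := fun q : (E × ℝ) × E => (y, q.1.2))
        (hS.contDiffAt hy hz₀).continuousAt (by fun_prop)
    have c1 : ContinuousAt (fun q : (E × ℝ) × E => S (q.2, q.1.2)) ((v₀, z₀), x) :=
      ContinuousAt.comp (g := S) (f := fun q : (E × ℝ) × E => (q.2, q.1.2))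
        (hS.contDiffAt (hne x hx1) hz₀).continuousAt (by fun_prop)
    have c2 := hcomp x₀ (hne _ hx₀)
    have c0 : ContinuousAt (fun q : (E × ℝ) × E => q.1.1) ((v₀, z₀), x) := by fun_prop
    refine (c0.inner c1).eventually_lt (c0.inner c2) ?_
    dsimp only
    rw [hxv]
    refine hS.inner_lt_suppFn hv₀ hz₀ (hS.mem_slice (hne x hx1) z₀) fun h => ?_
    have : x = x₀ := hS.injOn z₀ hz₀ hx.1 (by simpa using hx₀) (h.trans hxv.symm)
    exact hx.2 (this ▸ mem_interior_iff_mem_nhds.2 hW)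
  filter_upwards [hev, hS.domain_mem_nhds hv₀ hz₀] with p hp hpd x hx hxp
  by_contra hxW
  have h1 := hp x ⟨by simpa using hx, fun h => hxW (interior_subset h)⟩
  rw [hxp] at h1
  exact absurd (hS.inner_le_suppFn p.1 hpd.2 (hS.mem_slice (hne _ hx₀) p.2)) (not_le.2 h1)

/-- The maximizing parameter is obtained from the implicit function theorem applied to the critical
point equation; nondegeneracy is positive curvature. -/
theorem contDiffAt_suppPt (hS : OvaloidFamily S I) {v₀ : E} {z₀ : ℝ} (hv₀ : v₀ ≠ 0)
    (hz₀ : z₀ ∈ I) : ContDiffAt ℝ ∞ (suppPt S) (v₀, z₀) := by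
  have hne : ∀ x : E, ‖x‖ = 1 → x ≠ 0 := fun x hx h => by simp [h] at hx
  obtain ⟨x₀, hx₀', hxv⟩ := hS.suppPt_mem hv₀ hz₀
  have hx₀ : ‖x₀‖ = 1 := by simpa using hx₀'
  dsimp only at hxv
  set u : (E × ℝ) × E := ((v₀, z₀), x₀) with hu
  -- Ψ is the differential in x of ⟨v, S(x, z)⟩ + (‖x‖² - 1)²/4. Homogeneity makes the first term
  -- degenerate in the radial direction; the second removes this and vanishes to first order on unit
  -- vectors.
  set Ψ : (E × ℝ) × E → (E →L[ℝ] ℝ) := fun q =>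
    (innerSL ℝ q.1.1) ∘L ((fderiv ℝ S (q.2, q.1.2)) ∘L ContinuousLinearMap.inl ℝ E ℝ)
      + (‖q.2‖ ^ 2 - 1) • innerSL ℝ q.2 with hΨ
  have hΨ_apply : ∀ q ξ, Ψ q ξ = ⟪q.1.1, fderiv ℝ S (q.2, q.1.2) (ξ, 0)⟫_ℝ
      + (‖q.2‖ ^ 2 - 1) * ⟪q.2, ξ⟫_ℝ := fun q ξ => by
    simp [hΨ, innerSL_apply_apply]
  have hΨ_smooth : ContDiffAt ℝ ∞ Ψ u := by
    have h1 : ContDiffAt ℝ ∞ (fun q : (E × ℝ) × E => fderiv ℝ S (q.2, q.1.2)) u :=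
      ContDiffAt.comp (g := fderiv ℝ S) (f := fun q : (E × ℝ) × E => (q.2, q.1.2)) u
        ((hS.contDiffAt (hne _ hx₀) hz₀).fderiv_right (m := ∞) (by simp)) (by fun_prop)
    have h2 : ContDiffAt ℝ ∞ (fun q : (E × ℝ) × E => innerSL ℝ q.1.1) u :=
      ((innerSL ℝ).contDiff.comp (by fun_prop)).contDiffAt
    have h3 : ContDiffAt ℝ ∞ (fun q : (E × ℝ) × E => innerSL ℝ q.2) u :=
      ((innerSL ℝ).contDiff.comp (by fun_prop)).contDiffAt
    have h4 : ContDiffAt ℝ ∞ (fun q : (E × ℝ) × E => ‖q.2‖ ^ 2 - 1) u :=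
      ((contDiff_snd.norm_sq ℝ).sub contDiff_const).contDiffAt
    exact (h2.clm_comp (h1.clm_comp contDiffAt_const)).add (h4.smul h3)
  have hcrit : Ψ u = 0 := by
    ext ξ
    rw [hΨ_apply]
    simp only [hu, hx₀]
    rw [hS.inner_fderiv_eq_zero (hne _ hx₀) hz₀ hxv]
    simp
  have hder : ∀ η ξ, fderiv ℝ Ψ u (0, η) ξ
      = ⟪v₀, fderiv ℝ (fderiv ℝ S) (x₀, z₀) (η, 0) (ξ, 0)⟫_ℝ + 2 * ⟪x₀, η⟫_ℝ * ⟪x₀, ξ⟫_ℝ := by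
    intro η ξ
    have h1 := hasDerivAt_comp_line (f := Ψ) (a := u) (v := (0, η)) (t := 0)
      (by simpa using hΨ_smooth.differentiableAt (by simp))
    have h2 : HasDerivAt (fun t : ℝ => Ψ (u + t • (0, η)) ξ) (fderiv ℝ Ψ u (0, η) ξ) 0 := by
      rw [zero_smul, add_zero] at h1
      exact (ContinuousLinearMap.apply ℝ ℝ ξ).hasFDerivAt.comp_hasDerivAt (0 : ℝ) h1
    have hl : HasDerivAt (fun t : ℝ => x₀ + t • η) η 0 := by
      simpa using ((hasDerivAt_id (0 : ℝ)).smul_const η).const_add x₀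
    have h3 : HasDerivAt (fun t : ℝ => ⟪v₀, fderiv ℝ S (x₀ + t • η, z₀) (ξ, 0)⟫_ℝ)
        ⟪v₀, fderiv ℝ (fderiv ℝ S) (x₀, z₀) (η, 0) (ξ, 0)⟫_ℝ 0 := by
      simpa using (hasDerivAt_const (0 : ℝ) v₀).inner ℝ
        (hS.hasDerivAt_fderiv_line (hne _ hx₀) hz₀ η ξ)
    have h4 : HasDerivAt (fun t : ℝ => ‖x₀ + t • η‖ ^ 2 - 1) (2 * ⟪x₀, η⟫_ℝ) 0 := by
      simpa using hl.norm_sq.sub_const 1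
    have h5 : HasDerivAt (fun t : ℝ => ⟪x₀ + t • η, ξ⟫_ℝ) ⟪η, ξ⟫_ℝ 0 := by
      simpa using hl.inner ℝ (hasDerivAt_const (0 : ℝ) ξ)
    have h6 := h3.add (h4.mul h5)
    have h7 : (fun t : ℝ => Ψ (u + t • (0, η)) ξ) = _ := funext fun t => by
      rw [hΨ_apply]
    rw [h7] at h2
    have h8 := h2.unique (h6.congr_of_eventuallyEq (Eventually.of_forall fun t => by simp [hu]))
    rw [h8]
    simp [hx₀]
  -- Testing a kernel vector η against x₀ isolates the radial term and gives η ⊥ x₀. Testing it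
  -- against itself then contradicts the negativity of ⟨v, S_ηη⟩ unless η = 0.
  have hinj : Function.Injective (fderiv ℝ Ψ u ∘L ContinuousLinearMap.inr ℝ (E × ℝ) E) := by
    rw [injective_iff_map_eq_zero]
    intro η hη
    have hzero : ∀ ξ, ⟪v₀, fderiv ℝ (fderiv ℝ S) (x₀, z₀) (η, 0) (ξ, 0)⟫_ℝ
        + 2 * ⟪x₀, η⟫_ℝ * ⟪x₀, ξ⟫_ℝ = 0 := fun ξ => by
      rw [← hder]
      simpa using congrArg (fun g : E →L[ℝ] ℝ => g ξ) hη
    have h1 := hzero x₀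
    rw [hS.fderiv_fderiv_self (hne _ hx₀) hz₀, inner_neg_right,
      hS.inner_fderiv_eq_zero (hne _ hx₀) hz₀ hxv, real_inner_self_eq_norm_sq, hx₀] at h1
    have h2 : ⟪x₀, η⟫_ℝ = 0 := by linarith
    have h3 := hzero η
    rw [h2] at h3
    by_contra hη0
    have h4 := hS.inner_fderiv_fderiv_neg hv₀ (hne _ hx₀) hz₀ hxv (η := η) (by
      rintro ⟨r, rfl⟩
      rw [inner_smul_right, real_inner_self_eq_norm_sq, hx₀] at h2
      simp only [one_pow, mul_one] at h2
      exact hη0 (by rw [h2, zero_smul]))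
    linarith
  have hinv := ContinuousLinearMap.isInvertible_of_injective _ hinj finrank_continuousDual
  set ψ := hΨ_smooth.implicitFunction (by simp) hinv with hψ
  have hψs : ContDiffAt ℝ ∞ ψ (v₀, z₀) := hΨ_smooth.contDiffAt_implicitFunction (by simp) hinv
  have hψ0 : ψ (v₀, z₀) = x₀ := hΨ_smooth.implicitFunction_apply_self (by simp) hinv
  have hloc : ∀ᶠ q in 𝓝 (v₀, z₀) ×ˢ 𝓝 x₀, Ψ q = Ψ u ↔ ψ q.1 = q.2 := by
    rw [← nhds_prod_eq]
    exact hΨ_smooth.eventually_apply_eq_iff_implicitFunction (by simp) hinv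
  rw [Filter.eventually_prod_iff] at hloc
  obtain ⟨P, hP, W, hW, hPW⟩ := hloc
  -- A unit maximizing parameter solves the equation Ψ = 0 and is close to x₀, so local uniqueness
  -- identifies it with ψ.
  have heq : suppPt S =ᶠ[𝓝 (v₀, z₀)] fun p => S (ψ p, p.2) := by
    filter_upwards [hP, hS.eventually_param_mem hv₀ hz₀ hx₀ hxv hW, hS.domain_mem_nhds hv₀ hz₀]
      with p hp hpW hpd
    obtain ⟨x, hx', hxp⟩ := hS.suppPt_mem hpd.1 hpd.2
    have hx : ‖x‖ = 1 := by simpa using hx'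
    dsimp only at hxp
    have h1 := (hPW hp (hpW x hx hxp)).1 (by
      rw [hcrit]
      ext ξ
      rw [hΨ_apply]
      simp only [hx]
      rw [hS.inner_fderiv_eq_zero (hne _ hx) hpd.2 hxp]
      simp)
    rw [← hxp]
    exact congrArg (fun y => S (y, p.2)) h1.symm
  refine ContDiffAt.congr_of_eventuallyEq ?_ heq
  refine ContDiffAt.comp (g := S) (f := fun p : E × ℝ => (ψ p, p.2)) (v₀, z₀) ?_
    (hψs.prodMk contDiffAt_snd)
  simp only [hψ0]
  exact hS.contDiffAt (hne _ hx₀) hz₀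

theorem contDiffAt_suppFn (hS : OvaloidFamily S I) {v : E} {z : ℝ} (hv : v ≠ 0) (hz : z ∈ I) :
    ContDiffAt ℝ ∞ (suppFn S) (v, z) :=
  contDiffAt_fst.inner ℝ (hS.contDiffAt_suppPt hv hz)

end OvaloidFamily

end SupportSmooth

/-! ### First derivatives of the support function and radii of curvature -/

section SupportCalculus

variable {E : Type*} [NormedAddCommGroup E] [InnerProductSpace ℝ E]

theorem hasDerivAt_fst_line {F : Type*} [NormedAddCommGroup F] [NormedSpace ℝ F] {G : E × ℝ → F}
    {x : E} {z : ℝ} (hG : DifferentiableAt ℝ G (x, z)) (ξ : E) :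
    HasDerivAt (fun t : ℝ => G (x + t • ξ, z)) (fderiv ℝ G (x, z) (ξ, 0)) 0 := by
  have := hasDerivAt_comp_line (f := G) (a := (x, z)) (v := (ξ, 0)) (t := 0) (by simpa using hG)
  simpa using this

variable [CompleteSpace E] {S : E × ℝ → E} {I : Set ℝ} [FiniteDimensional ℝ E] [Nontrivial E]

namespace OvaloidFamily

theorem differentiableAt_suppPt (hS : OvaloidFamily S I) {v : E} (hv : v ≠ 0) {z : ℝ} (hz : z ∈ I) :
    DifferentiableAt ℝ (suppPt S) (v, z) :=
  (hS.contDiffAt_suppPt hv hz).differentiableAt (by simp)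

theorem fderiv_suppPt_self (hS : OvaloidFamily S I) {v : E} (hv : v ≠ 0) {z : ℝ} (hz : z ∈ I) :
    fderiv ℝ (suppPt S) (v, z) (v, 0) = 0 := by
  have h1 : (fun t : ℝ => suppPt S (v + t • v, z)) =ᶠ[𝓝 0] fun _ => suppPt S (v, z) := by
    filter_upwards [lt_mem_nhds (show (-1 : ℝ) < 0 by norm_num)] with t ht
    rw [show v + t • v = (1 + t) • v by module]
    exact suppPt_smul (by linarith) v z
  exact (hasDerivAt_fst_line (hS.differentiableAt_suppPt hv hz) v).unique
    ((hasDerivAt_const _ _).congr_of_eventuallyEq h1)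

/-- With the form ⟨v, ·⟩ kept fixed, moving the normal can only lower its value at the support
point. Hence the derivative of the support point is tangent. -/
theorem inner_fderiv_suppPt (hS : OvaloidFamily S I) {v : E} (hv : v ≠ 0) {z : ℝ} (hz : z ∈ I)
    (ξ : E) : ⟪v, fderiv ℝ (suppPt S) (v, z) (ξ, 0)⟫_ℝ = 0 := by
  have hd : HasDerivAt (fun t : ℝ => ⟪v, suppPt S (v + t • ξ, z)⟫_ℝ)
      ⟪v, fderiv ℝ (suppPt S) (v, z) (ξ, 0)⟫_ℝ 0 := by
    simpa using (hasDerivAt_const (0 : ℝ) v).inner ℝ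
      (hasDerivAt_fst_line (hS.differentiableAt_suppPt hv hz) ξ)
  refine IsLocalMax.hasDerivAt_eq_zero ?_ hd
  filter_upwards [eventually_ne_zero hv ξ] with t ht
  simp only [zero_smul, add_zero]
  exact hS.inner_le_suppFn v hz (hS.suppPt_mem ht hz)

/-- The gradient of the support function is the support parameterization. -/
theorem fderiv_suppFn (hS : OvaloidFamily S I) {v : E} (hv : v ≠ 0) {z : ℝ} (hz : z ∈ I) (ξ : E) :
    fderiv ℝ (suppFn S) (v, z) (ξ, 0) = ⟪ξ, suppPt S (v, z)⟫_ℝ := by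
  have h : fderiv ℝ (suppFn S) (v, z) (ξ, 0) = _ :=
    fderiv_inner_apply ℝ (differentiableAt_fst (𝕜 := ℝ) (p := (v, z)))
      (hS.differentiableAt_suppPt hv hz) (ξ, 0)
  rw [h, hS.inner_fderiv_suppPt hv hz]
  simp [fderiv_fst]

/-- The factor between df and ⟨v, ·⟩ is written as df(v)/‖v‖², an expression that can be
differentiated along the support parameterization. -/
theorem fderiv_definingFunction (hS : OvaloidFamily S I) {v : E} (hv : v ≠ 0) {z : ℝ} (hz : z ∈ I)
    {U : Set E} {f : E → ℝ} (hf : IsOuterDefiningFunction (slice S z) U f)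
    (hU : suppPt S (v, z) ∈ U) :
    0 < fderiv ℝ f (suppPt S (v, z)) v ∧ ∀ w, fderiv ℝ f (suppPt S (v, z)) w
      = fderiv ℝ f (suppPt S (v, z)) v / ‖v‖ ^ 2 * ⟪v, w⟫_ℝ := by
  have hgm : unitNormal f (suppPt S (v, z)) = ‖v‖⁻¹ • v := by
    rw [← (hS.ovaloid z hz).gaussMap_supportParam (norm_inv_norm_smul hv)]
    exact (IsOuterUnitNormal.gaussMap_eq ⟨U, f, hU, hS.suppPt_mem hv hz, hf, rfl⟩).symm
  have hg := norm_pos_iff.2 (hf.regular _ hU)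
  have hvn := norm_pos_iff.2 hv
  have hgr : gradient f (suppPt S (v, z)) = (‖gradient f (suppPt S (v, z))‖ * ‖v‖⁻¹) • v := by
    rw [mul_smul, ← hgm, unitNormal, smul_inv_smul₀ hg.ne']
  have hfd : ∀ w, fderiv ℝ f (suppPt S (v, z)) w
      = ‖gradient f (suppPt S (v, z))‖ * ‖v‖⁻¹ * ⟪v, w⟫_ℝ := fun w => by
    rw [← inner_gradient, ← real_inner_smul_left, ← hgr]
  rw [hfd v, real_inner_self_eq_norm_sq]
  refine ⟨by positivity, fun w => ?_⟩
  rw [hfd w]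
  field_simp

/-- Differentiating the gradient of a defining function along the support parameterization. -/
theorem exists_fderiv_fderiv_eq (hS : OvaloidFamily S I) {v : E} (hv : v ≠ 0) {z : ℝ} (hz : z ∈ I)
    {U : Set E} {f : E → ℝ} (hf : IsOuterDefiningFunction (slice S z) U f)
    (hU : suppPt S (v, z) ∈ U) : ∃ r > 0, ∀ ξ w, ⟪v, w⟫_ℝ = 0 →
      fderiv ℝ (fderiv ℝ f) (suppPt S (v, z)) (fderiv ℝ (suppPt S) (v, z) (ξ, 0)) w
        = r * ⟪ξ, w⟫_ℝ := by
  refine ⟨fderiv ℝ f (suppPt S (v, z)) v / ‖v‖ ^ 2,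
    div_pos (hS.fderiv_definingFunction hv hz hf hU).1 (by positivity), fun ξ w hw => ?_⟩
  have hγ := hasDerivAt_fst_line (hS.differentiableAt_suppPt hv hz) ξ
  have hl : HasDerivAt (fun t : ℝ => v + t • ξ) ξ 0 := by
    simpa using ((hasDerivAt_id (0 : ℝ)).smul_const ξ).const_add v
  have hD : DifferentiableAt ℝ (fderiv ℝ f) (suppPt S (v + (0 : ℝ) • ξ, z)) := by
    rw [zero_smul, add_zero]
    exact ((hf.contDiffAt_two hU).fderiv_right (m := 1) (by norm_num)).differentiableAt
      (by norm_num)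
  have h2 : HasDerivAt (fun t : ℝ => fderiv ℝ f (suppPt S (v + t • ξ, z)))
      (fderiv ℝ (fderiv ℝ f) (suppPt S (v, z)) (fderiv ℝ (suppPt S) (v, z) (ξ, 0))) 0 := by
    have := hD.hasFDerivAt.comp_hasDerivAt (0 : ℝ) hγ
    rwa [zero_smul, add_zero] at this
  have h3 : HasDerivAt (fun t : ℝ => fderiv ℝ f (suppPt S (v + t • ξ, z)) w)
      (fderiv ℝ (fderiv ℝ f) (suppPt S (v, z)) (fderiv ℝ (suppPt S) (v, z) (ξ, 0)) w) 0 :=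
    (ContinuousLinearMap.apply ℝ ℝ w).hasFDerivAt.comp_hasDerivAt (0 : ℝ) h2
  have h4 : HasDerivAt (fun t : ℝ => fderiv ℝ f (suppPt S (v + t • ξ, z)) (v + t • ξ)) _ 0 :=
    HasDerivAt.clm_apply h2 hl
  have h5 := h4.div hl.norm_sq (by simpa using hv)
  have h6 : HasDerivAt (fun t : ℝ => ⟪v + t • ξ, w⟫_ℝ) ⟪ξ, w⟫_ℝ 0 := by
    simpa using hl.inner ℝ (hasDerivAt_const (0 : ℝ) w)
  have h7 := h5.mul h6
  have hev : (fun t : ℝ => fderiv ℝ f (suppPt S (v + t • ξ, z)) w) =ᶠ[𝓝 0]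
      fun t : ℝ => fderiv ℝ f (suppPt S (v + t • ξ, z)) (v + t • ξ) / ‖v + t • ξ‖ ^ 2
        * ⟪v + t • ξ, w⟫_ℝ := by
    filter_upwards [eventually_ne_zero hv ξ, hγ.continuousAt.eventually
      (p := fun y => y ∈ U) (by simpa using hf.isOpen.mem_nhds hU)] with t ht htU
    exact (hS.fderiv_definingFunction ht hz hf htU).2 w
  have h8 := h3.unique (h7.congr_of_eventuallyEq hev)
  rw [h8]
  simp [hw]

/-- Positivity of the radii of curvature. -/
theorem inner_fderiv_suppPt_pos (hS : OvaloidFamily S I) {v : E} (hv : v ≠ 0) {z : ℝ} (hz : z ∈ I)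
    {ξ : E} (hξ : ¬ ∃ r : ℝ, ξ = r • v) : 0 < ⟪ξ, fderiv ℝ (suppPt S) (v, z) (ξ, 0)⟫_ℝ := by
  obtain ⟨U, f, hpU, hf, -, hpos⟩ := hS.exists_definingFunction hv hz
  obtain ⟨r, hr, h⟩ := hS.exists_fderiv_fderiv_eq hv hz hf hpU
  set τ := fderiv ℝ (suppPt S) (v, z) (ξ, 0) with hτ
  have hτv : ⟪v, τ⟫_ℝ = 0 := hS.inner_fderiv_suppPt hv hz ξ
  by_cases h0 : τ = 0
  · exfalso
    have h1 : ∀ w, ⟪v, w⟫_ℝ = 0 → ⟪ξ, w⟫_ℝ = 0 := fun w hw => by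
      have := h ξ w hw
      rw [← hτ, h0] at this
      simp only [map_zero, zero_apply] at this
      exact (mul_eq_zero.1 this.symm).resolve_left hr.ne'
    -- The component of ξ orthogonal to v. Being orthogonal to ξ as well, it vanishes, which makes ξ
    -- radial.
    set w := ξ - (⟪v, ξ⟫_ℝ / ‖v‖ ^ 2) • v with hw
    have hvn : ‖v‖ ^ 2 ≠ 0 := by simpa using hv
    have hvw : ⟪v, w⟫_ℝ = 0 := by
      rw [hw, inner_sub_right, inner_smul_right, real_inner_self_eq_norm_sq]
      field_simp
      ring
    have hww : ⟪w, w⟫_ℝ = 0 := by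
      conv_lhs => rw [hw]
      rw [inner_sub_left, inner_smul_left, hvw, h1 w hvw]
      simp
    exact hξ ⟨_, sub_eq_zero.1 (inner_self_eq_zero.1 hww)⟩
  · have h1 := hpos τ h0 hτv
    rw [h ξ τ hτv] at h1
    exact pos_of_mul_pos_right h1 hr.le

/-- The derivative of the support parameterization acts on v^⊥. There it is injective, since its
quadratic form is positive, and so surjective. -/
theorem exists_fderiv_suppPt_eq (hS : OvaloidFamily S I) {v : E} (hv : v ≠ 0) {z : ℝ} (hz : z ∈ I)
    {w : E} (hw : ⟪v, w⟫_ℝ = 0) : ∃ ξ, fderiv ℝ (suppPt S) (v, z) (ξ, 0) = w := by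
  have memW : ∀ x, x ∈ (ℝ ∙ v)ᗮ ↔ ⟪v, x⟫_ℝ = 0 := fun x =>
    Submodule.mem_orthogonal_singleton_iff_inner_right
  set A : E →ₗ[ℝ] E := (fderiv ℝ (suppPt S) (v, z) ∘L ContinuousLinearMap.inl ℝ E ℝ).toLinearMap
    with hA
  have hA' : ∀ x, A x = fderiv ℝ (suppPt S) (v, z) (x, 0) := fun x => by simp [hA]
  have hinv : ∀ x ∈ (ℝ ∙ v)ᗮ, A x ∈ (ℝ ∙ v)ᗮ := fun x _ => by
    rw [memW, hA']
    exact hS.inner_fderiv_suppPt hv hz x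
  have hinj : Function.Injective (A.restrict hinv) := by
    rw [injective_iff_map_eq_zero]
    intro x hx
    have hx0 : A x = 0 := congrArg Subtype.val hx
    by_contra hne
    have hpos := hS.inner_fderiv_suppPt_pos hv hz (ξ := x) (by
      rintro ⟨r, hr⟩
      have := (memW x).1 x.2
      rw [hr, inner_smul_right, real_inner_self_eq_norm_sq] at this
      have h0 : r = 0 := (mul_eq_zero.1 this).resolve_right (by simpa using hv)
      exact hne (Subtype.ext (by rw [hr, h0, zero_smul]; rfl)))
    rw [← hA', hx0, inner_zero_right] at hpos
    exact lt_irrefl _ hpos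
  obtain ⟨ξ, hξ⟩ := (LinearMap.injective_iff_surjective.1 hinj) ⟨w, (memW w).2 hw⟩
  exact ⟨ξ, by rw [← hA']; exact congrArg Subtype.val hξ⟩

/-- Every defining function has positive definite Hessian on the tangent space. -/
theorem fderiv_fderiv_pos (hS : OvaloidFamily S I) {v : E} (hv : v ≠ 0) {z : ℝ} (hz : z ∈ I)
    {U : Set E} {f : E → ℝ} (hf : IsOuterDefiningFunction (slice S z) U f)
    (hU : suppPt S (v, z) ∈ U) {w : E} (hw : w ≠ 0) (hw0 : fderiv ℝ f (suppPt S (v, z)) w = 0) :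
    0 < fderiv ℝ (fderiv ℝ f) (suppPt S (v, z)) w w := by
  obtain ⟨hp, hfd⟩ := hS.fderiv_definingFunction hv hz hf hU
  have hvw : ⟪v, w⟫_ℝ = 0 := by
    rw [hfd w] at hw0
    exact (mul_eq_zero.1 hw0).resolve_left (div_pos hp (by positivity)).ne'
  -- Writing w as a derivative of the support parameterization turns the Hessian at w into a
  -- positive multiple of a radius-of-curvature form, independently of how f was chosen.
  obtain ⟨ξ, rfl⟩ := hS.exists_fderiv_suppPt_eq hv hz hvw
  obtain ⟨r, hr, h⟩ := hS.exists_fderiv_fderiv_eq hv hz hf hU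
  rw [h ξ _ hvw]
  refine mul_pos hr (hS.inner_fderiv_suppPt_pos hv hz ?_)
  rintro ⟨s, rfl⟩
  apply hw
  rw [show ((s • v, 0) : E × ℝ) = s • (v, 0) by simp, map_smul, hS.fderiv_suppPt_self hv hz,
    smul_zero]

theorem mem_outside_slice_iff (hS : OvaloidFamily S I) {z : ℝ} (hz : z ∈ I) {y : E} :
    y ∈ outside (slice S z) ↔ ∃ v : E, ‖v‖ = 1 ∧ suppFn S (v, z) < ⟪v, y⟫_ℝ := by
  rw [(hS.ovaloid z hz).mem_outside_iff]
  refine exists_congr fun v => and_congr_right fun hv => ?_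
  rw [suppFn, suppPt_of_norm_one hv]

theorem exists_eq_suppPt (hS : OvaloidFamily S I) {z : ℝ} (hz : z ∈ I) {y : E}
    (hy : y ∈ slice S z) : ∃ v : E, ‖v‖ = 1 ∧ y = suppPt S (v, z) := by
  obtain ⟨-, v, hv, h⟩ := (hS.mem_slice_iff hz).1 hy
  refine ⟨v, hv, by_contra fun hne => ?_⟩
  exact (hS.inner_lt_suppFn (by rintro rfl; simp at hv) hz hy hne).ne h

end OvaloidFamily

end SupportCalculus

/-! ### Local defining functions of the tube, and their restrictions to planes -/

section LocalDefining

variable {E : Type*} [NormedAddCommGroup E] [InnerProductSpace ℝ E]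

theorem hasDerivAt_norm_line {x : E} (hx : x ≠ 0) (η : E) :
    HasDerivAt (fun t : ℝ => ‖x + t • η‖) (⟪x, η⟫_ℝ / ‖x‖) 0 := by
  have hl : HasDerivAt (fun t : ℝ => x + t • η) η 0 := by
    simpa using ((hasDerivAt_id (0 : ℝ)).smul_const η).const_add x
  have h := hl.norm_sq.sqrt (by simpa using hx)
  simp only [Real.sqrt_sq (norm_nonneg _), zero_smul, add_zero] at h
  rwa [mul_div_mul_left _ _ two_ne_zero] at h

/-- The graph of the affine function `y ↦ a + ⟨w, y⟩`. -/
theorem contDiff_graph (w : E) (a : ℝ) : ContDiff ℝ ∞ fun y : E => ((y, a + ⟪w, y⟫_ℝ) : E × ℝ) :=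
  contDiff_id.prodMk (contDiff_const.add (contDiff_const.inner ℝ contDiff_id))

theorem fderiv_comp_graph {F : E × ℝ → ℝ} {w y : E} {a : ℝ}
    (hF : DifferentiableAt ℝ F (y, a + ⟪w, y⟫_ℝ)) (v : E) :
    fderiv ℝ (fun y => F (y, a + ⟪w, y⟫_ℝ)) y v
      = fderiv ℝ F (y, a + ⟪w, y⟫_ℝ) (v, ⟪w, v⟫_ℝ) := by
  have h1 := hasDerivAt_comp_line (f := fun y => F (y, a + ⟪w, y⟫_ℝ)) (a := y) (v := v) (t := 0)
    (by rw [zero_smul, add_zero]; exact hF.comp y ((contDiff_graph w a).differentiable (by simp) y))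
  have h2 := hasDerivAt_comp_line (f := F) (a := (y, a + ⟪w, y⟫_ℝ)) (v := (v, ⟪w, v⟫_ℝ)) (t := 0)
    (by simpa using hF)
  simp only [zero_smul, add_zero] at h1 h2
  refine h1.unique (h2.congr_of_eventuallyEq (Eventually.of_forall fun t => ?_))
  simp [inner_add_right, inner_smul_right, add_assoc]

theorem fderiv_fderiv_comp_graph {F : E × ℝ → ℝ} {w y : E} {a : ℝ}
    (hF : ContDiffAt ℝ 2 F (y, a + ⟪w, y⟫_ℝ)) (v : E) :
    fderiv ℝ (fderiv ℝ (fun y => F (y, a + ⟪w, y⟫_ℝ))) y v v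
      = fderiv ℝ (fderiv ℝ F) (y, a + ⟪w, y⟫_ℝ) (v, ⟪w, v⟫_ℝ) (v, ⟪w, v⟫_ℝ) := by
  have h1 := deriv_deriv_comp_line (f := fun y => F (y, a + ⟪w, y⟫_ℝ)) (a := y) (v := v) (t := 0)
    (by
      rw [zero_smul, add_zero]
      exact hF.comp y ((contDiff_graph w a).of_le ENat.LEInfty.out).contDiffAt)
  have h2 := deriv_deriv_comp_line (f := F) (a := (y, a + ⟪w, y⟫_ℝ)) (v := (v, ⟪w, v⟫_ℝ)) (t := 0)
    (by simpa using hF)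
  simp only [zero_smul, add_zero] at h1 h2
  rw [← h1, ← h2]
  congr 2
  funext t
  simp [inner_add_right, inner_smul_right, add_assoc]

variable [CompleteSpace E]

/-- One function F on E × ℝ serves all planes near a given one: its restriction to a plane is a
defining function of the section once F detects the section and its exterior, and dF does not vanish
on the plane. Both horizontal and tilted sections use this. -/
theorem exists_isOuterDefiningFunction_graph {O : Set E} {F : E × ℝ → ℝ} {w y₀ : E} {a : ℝ}
    (hF : ∀ᶠ q in 𝓝 (y₀, a + ⟪w, y₀⟫_ℝ), ContDiffAt ℝ ∞ F q)
    (hreg : ∃ v, fderiv ℝ F (y₀, a + ⟪w, y₀⟫_ℝ) (v, ⟪w, v⟫_ℝ) ≠ 0)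
    (hsign : ∀ᶠ y in 𝓝 y₀, (F (y, a + ⟪w, y⟫_ℝ) = 0 ↔ y ∈ O) ∧
      (0 < F (y, a + ⟪w, y⟫_ℝ) ↔ y ∈ outside O)) :
    ∃ U, y₀ ∈ U ∧ IsOuterDefiningFunction O U fun y => F (y, a + ⟪w, y⟫_ℝ) := by
  obtain ⟨v, hv⟩ := hreg
  have hg : ContinuousAt (fun y : E => ((y, a + ⟪w, y⟫_ℝ) : E × ℝ)) y₀ :=
    (contDiff_graph w a).continuous.continuousAt
  have hc : ContinuousAt (fun y => fderiv ℝ F (y, a + ⟪w, y⟫_ℝ) (v, ⟪w, v⟫_ℝ)) y₀ := by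
    have h1 : ContinuousAt (fderiv ℝ F) (y₀, a + ⟪w, y₀⟫_ℝ) :=
      (hF.self_of_nhds.fderiv_right (m := 0) (by simp)).continuousAt
    exact (ContinuousAt.comp (f := fun y : E => ((y, a + ⟪w, y⟫_ℝ) : E × ℝ)) h1 hg).clm_apply
      continuousAt_const
  obtain ⟨U, hU, hUo, hy₀⟩ := eventually_nhds_iff.1
    ((hg.eventually hF).and (hsign.and (hc.eventually_ne hv)))
  refine ⟨U, hy₀, hUo, fun y hy => ?_, fun y hy => ?_, fun y hy => (hU y hy).2.1.1,
    fun y hy => (hU y hy).2.1.2⟩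
  · exact ((hU y hy).1.comp y (contDiff_graph w a).contDiffAt).contDiffWithinAt
  · rw [gradient_ne_zero_iff]
    intro h0
    apply (hU y hy).2.2
    rw [← fderiv_comp_graph ((hU y hy).1.differentiableAt (by simp)), h0]
    rfl

variable {S : E × ℝ → E} {I : Set ℝ} [FiniteDimensional ℝ E] [Nontrivial E]

namespace OvaloidFamily

theorem eventually_interior (hS : OvaloidFamily S I) {z : ℝ} (hz : z ∈ I) {m : E}
    (hm : ∀ v : E, ‖v‖ = 1 → ⟪v, m⟫_ℝ < suppFn S (v, z)) :
    ∀ᶠ z' in 𝓝 z, ∀ v : E, ‖v‖ = 1 → ⟪v, m⟫_ℝ < suppFn S (v, z') := by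
  have : ∀ᶠ z' in 𝓝 z, ∀ v ∈ Metric.sphere (0 : E) 1, ⟪v, m⟫_ℝ < suppFn S (v, z') := by
    refine (isCompact_sphere (0 : E) 1).eventually_forall_of_forall_eventually fun v hv => ?_
    have hv1 : ‖v‖ = 1 := by simpa using hv
    have hv0 : v ≠ 0 := by rintro rfl; simp at hv1
    have c1 : ContinuousAt (fun q : ℝ × E => suppFn S (q.2, q.1)) (z, v) :=
      ContinuousAt.comp (g := suppFn S) (f := fun q : ℝ × E => (q.2, q.1))
        (hS.contDiffAt_suppFn hv0 hz).continuousAt (by fun_prop)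
    have c2 : ContinuousAt (fun q : ℝ × E => ⟪q.2, m⟫_ℝ) (z, v) := by fun_prop
    exact c2.eventually_lt c1 (hm v hv1)
  filter_upwards [this] with z' h v hv using h v (by simpa using hv)

/-- The radial coordinates `x ↦ m + ‖x‖ (Γ(x, z) - m)` around an interior point. -/
noncomputable def radialMap (S : E × ℝ → E) (m : E) (p : E × ℝ) : E × ℝ :=
  (m + ‖p.1‖ • (suppPt S p - m), p.2)

theorem contDiffAt_radialMap (hS : OvaloidFamily S I) (m : E) {x : E} (hx : x ≠ 0) {z : ℝ}
    (hz : z ∈ I) : ContDiffAt ℝ ∞ (radialMap S m) (x, z) :=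
  (contDiffAt_const.add ((contDiffAt_fst.norm ℝ hx).smul
    ((hS.contDiffAt_suppPt hx hz).sub contDiffAt_const))).prodMk contDiffAt_snd

/-- Pair the horizontal component with x. The derivative of the support point drops out, and since
⟨x, Γ - m⟩ > 0 the vector η is orthogonal to x. The derivative of Γ along η then vanishes, so η is
also radial, and thus zero. -/
theorem injective_fderiv_radialMap (hS : OvaloidFamily S I) {m : E} {x : E} (hx : x ≠ 0) {z : ℝ}
    (hz : z ∈ I) (hm : ⟪x, m⟫_ℝ < suppFn S (x, z)) :
    Function.Injective (fderiv ℝ (radialMap S m) (x, z)) := by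
  rw [injective_iff_map_eq_zero]
  rintro ⟨η, ζ⟩ h0
  have hd : DifferentiableAt ℝ (radialMap S m) (x, z) :=
    (hS.contDiffAt_radialMap m hx hz).differentiableAt (by simp)
  have h1 : fderiv ℝ (fun p => (radialMap S m p).2) (x, z) (η, ζ) = 0 := by
    rw [hd.hasFDerivAt.snd.fderiv]
    simp [h0]
  have hζ : ζ = 0 := by
    have : (fun p => (radialMap S m p).2) = (Prod.snd : E × ℝ → ℝ) := rfl
    rw [this, fderiv_snd] at h1
    simpa using h1
  subst hζ
  have hxn := norm_pos_iff.2 hx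
  have h2 := (hasDerivAt_fst_line hd η).fst
  rw [h0] at h2
  have h3 := (((hasDerivAt_norm_line hx η).smul
    ((hasDerivAt_fst_line (hS.differentiableAt_suppPt hx hz) η).sub_const m)).const_add m)
  have h4 := h3.unique h2
  simp only [zero_smul, add_zero] at h4
  have h5 := congrArg (fun y => ⟪x, y⟫_ℝ) h4
  simp only [inner_add_right, inner_smul_right, inner_sub_right, hS.inner_fderiv_suppPt hx hz,
    Prod.fst_zero, inner_zero_right, mul_zero, zero_add] at h5
  have h6 : ⟪x, η⟫_ℝ / ‖x‖ = 0 :=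
    (mul_eq_zero.1 h5).resolve_right (sub_pos.2 hm).ne'
  have h7 : ⟪x, η⟫_ℝ = 0 := (div_eq_zero_iff.1 h6).resolve_right hxn.ne'
  rw [h6, zero_smul, add_zero] at h4
  have h8 : fderiv ℝ (suppPt S) (x, z) (η, 0) = 0 :=
    (smul_eq_zero.1 h4).resolve_left hxn.ne'
  have h9 : ∃ r : ℝ, η = r • x := by
    by_contra hcon
    have := hS.inner_fderiv_suppPt_pos hx hz hcon
    rw [h8, inner_zero_right] at this
    exact lt_irrefl _ this
  obtain ⟨r, rfl⟩ := h9
  rw [inner_smul_right, real_inner_self_eq_norm_sq] at h7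
  have : r = 0 := (mul_eq_zero.1 h7).resolve_right (by positivity)
  simp [this]

/-- For ‖x‖ < 1 the image lies strictly between the interior point m and a boundary point, below
every support value; for ‖x‖ > 1 it exceeds the support value in the direction x. -/
theorem radialMap_sign (hS : OvaloidFamily S I) {m x : E} (hx : x ≠ 0) {z : ℝ} (hz : z ∈ I)
    (hm : ∀ v : E, ‖v‖ = 1 → ⟪v, m⟫_ℝ < suppFn S (v, z)) :
    (‖x‖ - 1 = 0 ↔ (radialMap S m (x, z)).1 ∈ slice S z) ∧
      (0 < ‖x‖ - 1 ↔ ∃ v : E, ‖v‖ = 1 ∧ suppFn S (v, z) < ⟪v, (radialMap S m (x, z)).1⟫_ℝ) := by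
  have hxn := norm_pos_iff.2 hx
  set y := (radialMap S m (x, z)).1 with hy
  have hyv : ∀ v : E, ⟪v, y⟫_ℝ = ⟪v, m⟫_ℝ + ‖x‖ * (⟪v, suppPt S (x, z)⟫_ℝ - ⟪v, m⟫_ℝ) := fun v => by
    simp only [hy, radialMap, inner_add_right, inner_smul_right, inner_sub_right]
  have hA : ‖x‖ = 1 → y ∈ slice S z := fun h => by
    have : y = suppPt S (x, z) := by simp [hy, radialMap, h]
    rw [this]
    exact hS.suppPt_mem hx hz
  have hB : ‖x‖ < 1 → ∀ v : E, ‖v‖ = 1 → ⟪v, y⟫_ℝ < suppFn S (v, z) := fun h v hv => by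
    rw [hyv]
    have h1 := hm v hv
    have h2 := hS.inner_le_suppFn v hz (hS.suppPt_mem hx hz)
    nlinarith [mul_pos (sub_pos.2 h) (sub_pos.2 h1), mul_nonneg hxn.le (sub_nonneg.2 h2)]
  have hC : 1 < ‖x‖ → ∃ v : E, ‖v‖ = 1 ∧ suppFn S (v, z) < ⟪v, y⟫_ℝ := fun h => by
    refine ⟨‖x‖⁻¹ • x, norm_inv_norm_smul hx, ?_⟩
    have h1 := hm _ (norm_inv_norm_smul hx)
    have h2 : suppFn S (‖x‖⁻¹ • x, z) = ⟪‖x‖⁻¹ • x, suppPt S (x, z)⟫_ℝ := by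
      rw [suppFn, suppPt_smul (inv_pos.2 hxn)]
    rw [hyv, ← h2]
    nlinarith
  rcases lt_trichotomy ‖x‖ 1 with h | h | h
  · refine ⟨iff_of_false (by linarith) fun hmem => ?_, iff_of_false (by linarith) ?_⟩
    · obtain ⟨-, v, hv, h2⟩ := (hS.mem_slice_iff hz).1 hmem
      exact (hB h v hv).ne h2
    · rintro ⟨v, hv, h2⟩
      exact lt_asymm h2 (hB h v hv)
  · refine ⟨iff_of_true (by linarith) (hA h), iff_of_false (by linarith) ?_⟩
    rintro ⟨v, hv, h2⟩
    exact absurd (hS.inner_le_suppFn v hz (hA h)) (not_le.2 h2)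
  · refine ⟨iff_of_false (by linarith) fun hmem => ?_, iff_of_true (by linarith) (hC h)⟩
    obtain ⟨v, hv, h2⟩ := hC h
    exact absurd (hS.inner_le_suppFn v hz hmem) (not_le.2 h2)

/-- A local defining function of the union of the slices, smooth in `(y, z)`. -/
theorem exists_local_definingFunction (hS : OvaloidFamily S I) {m v₀ : E} {z₁ : ℝ} (hz : z₁ ∈ I)
    (hv₀ : ‖v₀‖ = 1) (hm : ∀ v : E, ‖v‖ = 1 → ⟪v, m⟫_ℝ < suppFn S (v, z₁)) :
    ∃ F : E × ℝ → ℝ, (∀ᶠ q in 𝓝 (suppPt S (v₀, z₁), z₁), ContDiffAt ℝ ∞ F q) ∧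
      (∀ᶠ q in 𝓝 (suppPt S (v₀, z₁), z₁), (F q = 0 ↔ q.1 ∈ slice S q.2) ∧
        (0 < F q ↔ ∃ v : E, ‖v‖ = 1 ∧ suppFn S (v, q.2) < ⟪v, q.1⟫_ℝ)) ∧
      (∃ w, fderiv ℝ F (suppPt S (v₀, z₁), z₁) (w, 0) ≠ 0) ∧
      ∀ w, w ≠ 0 → fderiv ℝ F (suppPt S (v₀, z₁), z₁) (w, 0) = 0 →
        0 < fderiv ℝ (fderiv ℝ F) (suppPt S (v₀, z₁), z₁) (w, 0) (w, 0) := by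
  have hv0 : v₀ ≠ 0 := by rintro rfl; simp at hv₀
  set P := radialMap S m with hP
  set b : E × ℝ := (suppPt S (v₀, z₁), z₁) with hb
  have hPb : P (v₀, z₁) = b := by simp [hP, hb, radialMap, hv₀]
  have hequiv : ∀ p : E × ℝ, p.1 ≠ 0 → p.2 ∈ I → ⟪p.1, m⟫_ℝ < suppFn S p →
      ∃ A : (E × ℝ) ≃L[ℝ] (E × ℝ), HasFDerivAt P (A : E × ℝ →L[ℝ] E × ℝ) p := fun p h1 h2 h3 => by
    obtain ⟨A, hA⟩ := ContinuousLinearMap.isInvertible_of_injective _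
      (hS.injective_fderiv_radialMap h1 h2 h3) rfl
    exact ⟨A, hA ▸ ((hS.contDiffAt_radialMap m h1 h2).differentiableAt (by simp)).hasFDerivAt⟩
  obtain ⟨A, hA⟩ := hequiv (v₀, z₁) hv0 hz (hm v₀ hv₀)
  have hPs := hS.contDiffAt_radialMap m hv0 hz
  set e := hPs.toOpenPartialHomeomorph P hA (by simp) with he
  have hecoe : ∀ p, e p = P p := fun p => rfl
  have hsrc : (v₀, z₁) ∈ e.source := hPs.mem_toOpenPartialHomeomorph_source hA (by simp)
  have htgt : b ∈ e.target := by rw [← hPb]; exact e.map_source hsrc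
  have hsymmb : e.symm b = (v₀, z₁) := by rw [← hPb]; exact e.left_inv hsrc
  have hgood : ∀ᶠ p : E × ℝ in 𝓝 (v₀, z₁), p.1 ≠ 0 ∧ p.2 ∈ I ∧
      (∀ v : E, ‖v‖ = 1 → ⟪v, m⟫_ℝ < suppFn S (v, p.2)) ∧ ⟪p.1, m⟫_ℝ < suppFn S p := by
    have h1 : ∀ᶠ p : E × ℝ in 𝓝 (v₀, z₁), ∀ v : E, ‖v‖ = 1 → ⟪v, m⟫_ℝ < suppFn S (v, p.2) :=
      (continuous_snd.tendsto (v₀, z₁)).eventually (hS.eventually_interior hz hm)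
    have h2 : ∀ᶠ p : E × ℝ in 𝓝 (v₀, z₁), ⟪p.1, m⟫_ℝ < suppFn S p :=
      ContinuousAt.eventually_lt (by fun_prop) (hS.contDiffAt_suppFn hv0 hz).continuousAt (hm v₀ hv₀)
    filter_upwards [h1, h2, hS.domain_mem_nhds hv0 hz] with p h1 h2 h3
    exact ⟨h3.1, h3.2, h1, h2⟩
  have hsymm : ContinuousAt e.symm b := e.continuousAt_symm htgt
  have hgood' : ∀ᶠ q in 𝓝 b, q ∈ e.target ∧ (e.symm q).1 ≠ 0 ∧ (e.symm q).2 ∈ I ∧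
      (∀ v : E, ‖v‖ = 1 → ⟪v, m⟫_ℝ < suppFn S (v, (e.symm q).2)) ∧
      ⟪(e.symm q).1, m⟫_ℝ < suppFn S (e.symm q) :=
    (show ∀ᶠ q in 𝓝 b, q ∈ e.target from e.open_target.mem_nhds htgt).and (hsymm.eventually (hsymmb ▸ hgood))
  -- In radial coordinates around m the tube is ‖x‖ = 1.
  set F : E × ℝ → ℝ := fun q => ‖(e.symm q).1‖ - 1 with hF
  have hsmooth : ∀ᶠ q in 𝓝 b, ContDiffAt ℝ ∞ F q := by
    filter_upwards [hgood'] with q hq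
    obtain ⟨A', hA'⟩ := hequiv (e.symm q) hq.2.1 hq.2.2.1 hq.2.2.2.2
    have h1 : ContDiffAt ℝ ∞ e.symm q := e.contDiffAt_symm hq.1 hA'
      (hS.contDiffAt_radialMap m hq.2.1 hq.2.2.1)
    exact (h1.fst.norm ℝ hq.2.1).sub contDiffAt_const
  have hsign : ∀ᶠ q in 𝓝 b, (F q = 0 ↔ q.1 ∈ slice S q.2) ∧
      (0 < F q ↔ ∃ v : E, ‖v‖ = 1 ∧ suppFn S (v, q.2) < ⟪v, q.1⟫_ℝ) := by
    filter_upwards [hgood'] with q hq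
    have h1 : P (e.symm q) = q := e.right_inv hq.1
    have h2 := congrArg Prod.snd h1
    replace h2 : (e.symm q).2 = q.2 := h2
    have h3 := hS.radialMap_sign hq.2.1 hq.2.2.1 hq.2.2.2.1
    have h4 : radialMap S m ((e.symm q).1, (e.symm q).2) = q := h1
    rw [h4, h2] at h3
    exact h3
  have hreg : ∃ w, fderiv ℝ F b (w, 0) ≠ 0 := by
    refine ⟨suppPt S (v₀, z₁) - m, ?_⟩
    have h1 := hasDerivAt_comp_line (f := F) (a := b) (v := (suppPt S (v₀, z₁) - m, 0)) (t := 0)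
      (by simpa using hsmooth.self_of_nhds.differentiableAt (by simp))
    have hline : ContinuousAt (fun t : ℝ => (((1 + t) • v₀, z₁) : E × ℝ)) 0 := by fun_prop
    -- On the horizontal ray from m through the support point, F grows at unit rate, so dF ≠ 0
    -- there.
    have h2 : (fun t : ℝ => F (b + t • (suppPt S (v₀, z₁) - m, 0))) =ᶠ[𝓝 0] fun t => t := by
      filter_upwards [hline.eventually (p := fun p => p ∈ e.source)
        (by simpa using e.open_source.mem_nhds hsrc),
        lt_mem_nhds (show (-1 : ℝ) < 0 by norm_num)] with t ht ht1
      have h3 : b + t • (suppPt S (v₀, z₁) - m, 0) = e ((1 + t) • v₀, z₁) := by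
        rw [hecoe]
        have hn : ‖(1 + t) • v₀‖ = 1 + t := by
          rw [norm_smul, hv₀, mul_one, Real.norm_of_nonneg (by linarith)]
        simp only [hP, radialMap, hn, hb, suppPt_smul (show 0 < 1 + t by linarith)]
        ext1
        · simp only [Prod.fst_add, Prod.smul_fst]
          module
        · simp
      have hn : ‖(1 + t) • v₀‖ = 1 + t := by
        rw [norm_smul, hv₀, mul_one, Real.norm_of_nonneg (by linarith)]
      rw [h3]
      simp only [hF, e.left_inv ht, hn]
      ring
    have h3 := h1.unique ((hasDerivAt_id (0 : ℝ)).congr_of_eventuallyEq h2)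
    simp only [zero_smul, add_zero] at h3
    rw [h3]
    exact one_ne_zero
  refine ⟨F, hsmooth, hsign, hreg, fun w hw hw0 => ?_⟩
  have hb' : (suppPt S (v₀, z₁), z₁ + ⟪(0 : E), suppPt S (v₀, z₁)⟫_ℝ) = b := by simp [hb]
  obtain ⟨U, hU, hfU⟩ := exists_isOuterDefiningFunction_graph (O := slice S z₁) (F := F)
    (w := 0) (y₀ := suppPt S (v₀, z₁)) (a := z₁) (by rwa [hb']) (by simpa [hb'] using hreg) (by
      have hg : ContinuousAt (fun y : E => ((y, z₁ + ⟪(0 : E), y⟫_ℝ) : E × ℝ)) (suppPt S (v₀, z₁)) :=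
        (contDiff_graph 0 z₁).continuous.continuousAt
      filter_upwards [hg.eventually (hb' ▸ hsign)] with y hy
      simpa [hS.mem_outside_slice_iff hz] using hy)
  have h2 := hS.fderiv_fderiv_pos hv0 hz hfU hU hw (by
    rw [fderiv_comp_graph (by rw [hb']; exact hsmooth.self_of_nhds.differentiableAt (by simp)), hb']
    simpa using hw0)
  rw [fderiv_fderiv_comp_graph
    (by rw [hb']; exact hsmooth.self_of_nhds.of_le ENat.LEInfty.out), hb'] at h2
  simpa using h2

/-- Slightly tilted sections are still positively curved. -/
theorem eventually_tilted (hS : OvaloidFamily S I) {m : E} {z₀ : ℝ} (hz : z₀ ∈ I)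
    (hm : ∀ v : E, ‖v‖ = 1 → ⟪v, m⟫_ℝ < suppFn S (v, z₀)) :
    ∀ᶠ p : ℝ × E in 𝓝 (z₀, 0), ∀ x ∈ Metric.sphere (0 : E) 1, ∃ F : E × ℝ → ℝ,
      (∀ᶠ q in 𝓝 (suppPt S (x, p.1), p.1), ContDiffAt ℝ ∞ F q) ∧
      (∀ᶠ q in 𝓝 (suppPt S (x, p.1), p.1), (F q = 0 ↔ q.1 ∈ slice S q.2) ∧
        (0 < F q ↔ ∃ v : E, ‖v‖ = 1 ∧ suppFn S (v, q.2) < ⟪v, q.1⟫_ℝ)) ∧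
      (∃ v, fderiv ℝ F (suppPt S (x, p.1), p.1) (v, ⟪p.2, v⟫_ℝ) ≠ 0) ∧
      ∀ v, v ≠ 0 → fderiv ℝ F (suppPt S (x, p.1), p.1) (v, ⟪p.2, v⟫_ℝ) = 0 →
        0 < fderiv ℝ (fderiv ℝ F) (suppPt S (x, p.1), p.1) (v, ⟪p.2, v⟫_ℝ) (v, ⟪p.2, v⟫_ℝ) := by
  refine (isCompact_sphere (0 : E) 1).eventually_forall_of_forall_eventually fun x₀ hx₀ => ?_
  have hx1 : ‖x₀‖ = 1 := by simpa using hx₀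
  have hx0 : x₀ ≠ 0 := by rintro rfl; simp at hx1
  obtain ⟨F, hF, hsign, ⟨v₁, hreg⟩, hpos⟩ := hS.exists_local_definingFunction hz hx1 hm
  set B : (ℝ × E) × E → E × ℝ := fun t => (suppPt S (t.2, t.1.1), t.1.1) with hB
  have hBc : ContinuousAt B ((z₀, 0), x₀) := by
    refine ContinuousAt.prodMk ?_ (by fun_prop)
    exact ContinuousAt.comp (g := suppPt S) (f := fun t : (ℝ × E) × E => (t.2, t.1.1))
      (hS.contDiffAt_suppPt hx0 hz).continuousAt (by fun_prop)
  -- The embedding of E as the direction space of the tilted plane. Pulled back by it, dF and D²F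
  -- depend continuously on the tilt, so positivity on the kernel persists from the horizontal case.
  set L : (ℝ × E) × E → E →L[ℝ] E × ℝ := fun t =>
    (ContinuousLinearMap.id ℝ E).prod (innerSL ℝ t.1.2) with hL
  have hLc : Continuous L := by
    have h : L = fun t => ContinuousLinearMap.inl ℝ E ℝ ∘L ContinuousLinearMap.id ℝ E
        + ContinuousLinearMap.inr ℝ E ℝ ∘L innerSL ℝ t.1.2 := by
      funext t
      ext v <;> simp [hL]
    rw [h]
    exact continuous_const.add (continuous_const.clm_comp
      ((innerSL ℝ).continuous.comp (by fun_prop)))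
  have hLa : ∀ t v, L t v = (v, ⟪t.1.2, v⟫_ℝ) := fun t v => by simp [hL, innerSL_apply_apply]
  have hs := hF.self_of_nhds
  have c1 : ContinuousAt (fun t => fderiv ℝ F (B t)) ((z₀, 0), x₀) :=
    ContinuousAt.comp (f := B) (hs.fderiv_right (m := 0) (by simp)).continuousAt hBc
  have c2 : ContinuousAt (fun t => fderiv ℝ (fderiv ℝ F) (B t)) ((z₀, 0), x₀) :=
    ContinuousAt.comp (f := B) ((hs.fderiv_right (m := ∞) (by simp)).fderiv_right (m := 0)
      (by simp)).continuousAt hBc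
  have hker := eventually_pos_on_ker (t₀ := (((z₀, 0), x₀) : (ℝ × E) × E))
    (ℓ := fun t => fderiv ℝ F (B t) ∘L L t)
    (Q := fun t => ((ContinuousLinearMap.compL ℝ E (E × ℝ) ℝ).flip (L t)) ∘L
      (fderiv ℝ (fderiv ℝ F) (B t)) ∘L L t)
    (c1.clm_comp hLc.continuousAt)
    ((((ContinuousLinearMap.compL ℝ E (E × ℝ) ℝ).flip.continuous.comp hLc).continuousAt).clm_comp
      (c2.clm_comp hLc.continuousAt))
    (fun v hv h0 => by
      simp only [ContinuousLinearMap.comp_apply, hLa, inner_zero_left, hB] at h0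
      simpa [hLa, hB] using hpos v hv h0)
  have c3 : ContinuousAt (fun t => fderiv ℝ F (B t) (L t v₁)) ((z₀, 0), x₀) :=
    c1.clm_apply (hLc.clm_apply continuous_const).continuousAt
  filter_upwards [hBc.eventually hF.eventually_nhds, hBc.eventually hsign.eventually_nhds, hker,
    c3.eventually_ne (by simpa [hLa, hB] using hreg)] with t h1 h2 h3 h4
  refine ⟨F, h1, h2, ⟨v₁, by simpa [hLa, hB] using h4⟩, fun v hv h0 => ?_⟩
  simpa [hLa, hB] using h3 v hv (by simpa [hLa, hB] using h0)

end OvaloidFamily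

end LocalDefining

/-! ### Tilted sections -/

section Tilt

variable {E : Type*} [NormedAddCommGroup E] [InnerProductSpace ℝ E] [CompleteSpace E]

/-- Uniform bounds for a family of ovaloids near height `z₀`. -/
structure TiltBox (S : E × ℝ → E) (I : Set ℝ) (z₀ : ℝ) (m : E) (η R L δ ε : ℝ) : Prop where
  family : OvaloidFamily S I
  η_pos : 0 < η
  R_pos : 0 < R
  L_nonneg : 0 ≤ L
  δ_pos : 0 < δ
  ε_pos : 0 < ε
  subset : Icc (z₀ - η) (z₀ + η) ⊆ I
  bound : ∀ x : E, ‖x‖ = 1 → ∀ z ∈ Icc (z₀ - η) (z₀ + η), ‖S (x, z)‖ ≤ R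
  lip : ∀ x : E, ‖x‖ = 1 → ∀ z ∈ Icc (z₀ - η) (z₀ + η), ∀ z' ∈ Icc (z₀ - η) (z₀ + η),
    ‖S (x, z) - S (x, z')‖ ≤ L * |z - z'|
  interior : ∀ v : E, ‖v‖ = 1 → ∀ z ∈ Icc (z₀ - η) (z₀ + η), ⟪v, m⟫_ℝ + δ ≤ suppFn S (v, z)
  tilted : ∀ z : ℝ, ∀ w : E, |z - z₀| < ε → ‖w‖ < ε → ∀ x ∈ Metric.sphere (0 : E) 1,
    ∃ F : E × ℝ → ℝ, (∀ᶠ q in 𝓝 (suppPt S (x, z), z), ContDiffAt ℝ ∞ F q) ∧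
      (∀ᶠ q in 𝓝 (suppPt S (x, z), z), (F q = 0 ↔ q.1 ∈ slice S q.2) ∧
        (0 < F q ↔ ∃ v : E, ‖v‖ = 1 ∧ suppFn S (v, q.2) < ⟪v, q.1⟫_ℝ)) ∧
      (∃ v, fderiv ℝ F (suppPt S (x, z), z) (v, ⟪w, v⟫_ℝ) ≠ 0) ∧
      ∀ v, v ≠ 0 → fderiv ℝ F (suppPt S (x, z), z) (v, ⟪w, v⟫_ℝ) = 0 →
        0 < fderiv ℝ (fderiv ℝ F) (suppPt S (x, z), z) (v, ⟪w, v⟫_ℝ) (v, ⟪w, v⟫_ℝ)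

/-- The plane `z = a + ⟨w, y⟩` is close enough to the plane `z = z₀`. -/
structure Admissible (z₀ η R L δ ε : ℝ) (w : E) (a : ℝ) : Prop where
  height : |a - z₀| < η / 2
  slope : ‖w‖ * (R + 1) < η / 2
  contr : ‖w‖ * L < 1 / 2
  near : |a - z₀| + ‖w‖ * R < ε
  small : ‖w‖ < ε
  star : L * (‖w‖ * (2 * R)) < δ

/-- The part near height `z₀` of the section by the plane `z = a + ⟨w, y⟩`, projected to `E`. -/
def tiltSet (S : E × ℝ → E) (z₀ η : ℝ) (w : E) (a : ℝ) : Set E :=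
  {y | a + ⟪w, y⟫_ℝ ∈ Icc (z₀ - η) (z₀ + η) ∧ y ∈ slice S (a + ⟪w, y⟫_ℝ)}

variable {S : E × ℝ → E} {I : Set ℝ} {z₀ : ℝ} {m : E} {η R L δ ε : ℝ}

theorem eventually_admissible (hη : 0 < η) (hδ : 0 < δ) (hε : 0 < ε) :
    ∀ᶠ p : E × ℝ in 𝓝 (0, z₀), Admissible z₀ η R L δ ε p.1 p.2 := by
  have h1 : ∀ᶠ p : E × ℝ in 𝓝 (0, z₀), |p.2 - z₀| < η / 2 :=
    ContinuousAt.eventually_lt (by fun_prop) continuousAt_const (by simpa using hη)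
  have h2 : ∀ᶠ p : E × ℝ in 𝓝 (0, z₀), ‖p.1‖ * (R + 1) < η / 2 :=
    ContinuousAt.eventually_lt (by fun_prop) continuousAt_const (by simpa using hη)
  have h3 : ∀ᶠ p : E × ℝ in 𝓝 (0, z₀), ‖p.1‖ * L < 1 / 2 :=
    ContinuousAt.eventually_lt (by fun_prop) continuousAt_const (by simp)
  have h4 : ∀ᶠ p : E × ℝ in 𝓝 (0, z₀), |p.2 - z₀| + ‖p.1‖ * R < ε :=
    ContinuousAt.eventually_lt (by fun_prop) continuousAt_const (by simpa using hε)
  have h5 : ∀ᶠ p : E × ℝ in 𝓝 (0, z₀), ‖p.1‖ < ε :=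
    ContinuousAt.eventually_lt (by fun_prop) continuousAt_const (by simpa using hε)
  have h6 : ∀ᶠ p : E × ℝ in 𝓝 (0, z₀), L * (‖p.1‖ * (2 * R)) < δ :=
    ContinuousAt.eventually_lt (by fun_prop) continuousAt_const (by simpa using hδ)
  filter_upwards [h1, h2, h3, h4, h5, h6] with p h1 h2 h3 h4 h5 h6
  exact ⟨h1, h2, h3, h4, h5, h6⟩

variable [FiniteDimensional ℝ E] [Nontrivial E]

/-- All constants come from compactness of the sphere times a short closed interval: R and L bound S
and its z-derivative, δ is the least gap between the support function and m, and ε comes from the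
stability of curvature under tilting. -/
theorem OvaloidFamily.exists_tiltBox (hS : OvaloidFamily S I) (hz₀ : z₀ ∈ I) :
    ∃ (m : E) (η R L δ ε : ℝ), TiltBox S I z₀ m η R L δ ε := by
  have hne : ∀ x : E, ‖x‖ = 1 → x ≠ 0 := fun x hx h => by simp [h] at hx
  obtain ⟨m, hm'⟩ := (hS.ovaloid z₀ hz₀).exists_interior_point
  have hm : ∀ v : E, ‖v‖ = 1 → ⟪v, m⟫_ℝ < suppFn S (v, z₀) := fun v hv => by
    rw [suppFn, suppPt_of_norm_one hv]
    exact hm' v hv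
  obtain ⟨η₁, hη₁, hball⟩ := Metric.eventually_nhds_iff.1
    ((hS.eventually_interior hz₀ hm).and (hS.isOpen.mem_nhds hz₀))
  set η := η₁ / 2 with hη
  have hJ : ∀ z ∈ Icc (z₀ - η) (z₀ + η), dist z z₀ < η₁ := fun z hz => by
    rw [Real.dist_eq, abs_lt]
    constructor <;> linarith [hz.1, hz.2]
  have hsub : Icc (z₀ - η) (z₀ + η) ⊆ I := fun z hz => (hball (hJ z hz)).2
  set K : Set (E × ℝ) := Metric.sphere 0 1 ×ˢ Icc (z₀ - η) (z₀ + η) with hK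
  have hKc : IsCompact K := (isCompact_sphere 0 1).prod isCompact_Icc
  have hKd : ∀ p ∈ K, p.1 ≠ 0 ∧ p.2 ∈ I := fun p hp => ⟨hne _ (by simpa using hp.1), hsub hp.2⟩
  obtain ⟨R, hR⟩ := hKc.exists_bound_of_continuousOn (f := S) fun p hp =>
    (hS.contDiffAt (hKd p hp).1 (hKd p hp).2).continuousAt.continuousWithinAt
  obtain ⟨L, hL⟩ := hKc.exists_bound_of_continuousOn (f := fun p => fderiv ℝ S p (0, 1)) fun p hp => by
    have h1 : ContinuousAt (fderiv ℝ S) p :=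
      ((hS.contDiffAt (hKd p hp).1 (hKd p hp).2).fderiv_right (m := 0) (by simp)).continuousAt
    exact (h1.clm_apply continuousAt_const).continuousWithinAt
  obtain ⟨v₁, hv₁⟩ := NormedSpace.sphere_nonempty (x := (0 : E)) (r := 1) |>.2 zero_le_one
  obtain ⟨p₁, hp₁, hmin⟩ := hKc.exists_isMinOn (f := fun p => suppFn S p - ⟪p.1, m⟫_ℝ)
    ⟨(v₁, z₀), hv₁, ⟨by linarith, by linarith⟩⟩ fun p hp =>
      ((hS.contDiffAt_suppFn (hKd p hp).1 (hKd p hp).2).continuousAt.sub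
        (by fun_prop)).continuousWithinAt
  obtain ⟨ε, hε, hball'⟩ := Metric.eventually_nhds_iff.1 (hS.eventually_tilted hz₀ hm)
  refine ⟨m, η, max R 1, max L 0, suppFn S p₁ - ⟪p₁.1, m⟫_ℝ, ε, hS, by linarith,
    lt_max_of_lt_right one_pos, le_max_right _ _, ?_, hε, hsub, ?_, ?_, ?_, ?_⟩
  · exact sub_pos.2 ((hball (hJ p₁.2 hp₁.2)).1 p₁.1 (by simpa using hp₁.1))
  · intro x hx z hz
    exact (hR (x, z) ⟨by simpa using hx, hz⟩).trans (le_max_left _ _)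
  · intro x hx z hz z' hz'
    have hder : ∀ t ∈ Icc (z₀ - η) (z₀ + η), HasDerivWithinAt (fun t => S (x, t))
        (fderiv ℝ S (x, t) (0, 1)) (Icc (z₀ - η) (z₀ + η)) t := fun t ht => by
      have h1 := ((hS.contDiffAt (hne x hx) (hsub ht)).differentiableAt (by simp)).hasFDerivAt
      have h2 : HasDerivAt (fun t : ℝ => ((x, t) : E × ℝ)) (0, 1) t :=
        (hasDerivAt_const t x).prodMk (hasDerivAt_id t)
      exact (h1.comp_hasDerivAt t h2).hasDerivWithinAt
    have := (convex_Icc (z₀ - η) (z₀ + η)).norm_image_sub_le_of_norm_hasDerivWithin_le hder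
      (fun t ht => hL (x, t) ⟨by simpa using hx, ht⟩) hz' hz
    rw [Real.norm_eq_abs] at this
    exact this.trans (mul_le_mul_of_nonneg_right (le_max_left _ _) (abs_nonneg _))
  · intro v hv z hz
    have : suppFn S p₁ - ⟪p₁.1, m⟫_ℝ ≤ suppFn S (v, z) - ⟪v, m⟫_ℝ :=
      hmin (⟨by simpa using hv, hz⟩ : (v, z) ∈ K)
    linarith
  · intro z w hz hw
    exact hball' (y := (z, w)) (by
      rw [Prod.dist_eq, max_lt_iff]
      exact ⟨by rwa [Real.dist_eq], by simpa using hw⟩)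

namespace TiltBox

theorem z₀_mem (hB : TiltBox S I z₀ m η R L δ ε) : z₀ ∈ Icc (z₀ - η) (z₀ + η) :=
  ⟨by linarith [hB.η_pos], by linarith [hB.η_pos]⟩

theorem norm_suppPt_le (hB : TiltBox S I z₀ m η R L δ ε) {v : E} (hv : v ≠ 0) {z : ℝ}
    (hz : z ∈ Icc (z₀ - η) (z₀ + η)) : ‖suppPt S (v, z)‖ ≤ R := by
  obtain ⟨x, hx, h⟩ := hB.family.suppPt_mem hv (hB.subset hz)
  rw [← h]
  exact hB.bound x (by simpa using hx) z hz

theorem suppFn_le (hB : TiltBox S I z₀ m η R L δ ε) {v : E} (hv : ‖v‖ = 1) {z z' : ℝ}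
    (hz : z ∈ Icc (z₀ - η) (z₀ + η)) (hz' : z' ∈ Icc (z₀ - η) (z₀ + η)) :
    suppFn S (v, z) ≤ suppFn S (v, z') + L * |z - z'| := by
  have hv0 : v ≠ 0 := by rintro rfl; simp at hv
  obtain ⟨x, hx, h⟩ := hB.family.suppPt_mem hv0 (hB.subset hz)
  have hx1 : ‖x‖ = 1 := by simpa using hx
  have h1 := hB.family.inner_le_suppFn v (hB.subset hz')
    (hB.family.mem_slice (by rintro rfl; simp at hx1) z' : S (x, z') ∈ _)
  have h2 : suppFn S (v, z) = ⟪v, S (x, z')⟫_ℝ + ⟪v, S (x, z) - S (x, z')⟫_ℝ := by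
    rw [← inner_add_right, add_sub_cancel, suppFn, ← h]
  have h3 := real_inner_le_norm v (S (x, z) - S (x, z'))
  rw [hv, one_mul] at h3
  linarith [hB.lip x hx1 z hz z' hz']

theorem norm_le_of_inner_le (hB : TiltBox S I z₀ m η R L δ ε) {z : ℝ}
    (hz : z ∈ Icc (z₀ - η) (z₀ + η)) {y : E}
    (hy : ∀ v : E, ‖v‖ = 1 → ⟪v, y⟫_ℝ ≤ suppFn S (v, z)) : ‖y‖ ≤ R := by
  rcases eq_or_ne y 0 with rfl | hy0
  · simpa using hB.R_pos.le
  have h1 := hy _ (norm_inv_norm_smul hy0)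
  have hu := norm_inv_norm_smul hy0
  have hu0 : ‖y‖⁻¹ • y ≠ 0 := fun h => by rw [h, norm_zero] at hu; exact zero_ne_one hu
  rw [real_inner_smul_left, real_inner_self_eq_norm_sq] at h1
  have h2 : ‖y‖⁻¹ * ‖y‖ ^ 2 = ‖y‖ := by
    have := norm_ne_zero_iff.2 hy0
    field_simp
  have h3 := real_inner_le_norm (‖y‖⁻¹ • y) (suppPt S (‖y‖⁻¹ • y, z))
  rw [hu, one_mul] at h3
  rw [h2] at h1
  exact h1.trans (h3.trans (hB.norm_suppPt_le hu0 hz))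

theorem norm_interior_le (hB : TiltBox S I z₀ m η R L δ ε) : ‖m‖ ≤ R :=
  hB.norm_le_of_inner_le hB.z₀_mem fun v hv => by
    linarith [hB.interior v hv z₀ hB.z₀_mem, hB.δ_pos]

variable {w : E} {a : ℝ}

theorem _root_.Admissible.height_mem (ha : Admissible z₀ η R L δ ε w a) {y : E}
    (hy : ‖y‖ < R + 1) : a + ⟪w, y⟫_ℝ ∈ Ioo (z₀ - η) (z₀ + η) := by
  have h1 : |⟪w, y⟫_ℝ| ≤ ‖w‖ * (R + 1) :=
    (abs_real_inner_le_norm w y).trans (mul_le_mul_of_nonneg_left hy.le (norm_nonneg _))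
  have h2 := abs_le.1 h1
  have h3 := abs_lt.1 ha.height
  have h4 := ha.slope
  constructor <;> linarith [h2.1, h2.2, h3.1, h3.2]

theorem norm_le_of_mem_tiltSet (hB : TiltBox S I z₀ m η R L δ ε) {y : E}
    (hy : y ∈ tiltSet S z₀ η w a) : ‖y‖ ≤ R := by
  obtain ⟨x, hx, h⟩ := hy.2
  rw [← h]
  exact hB.bound x (by simpa using hx) _ hy.1

/-- The tilted plane meets the tube in a graph over the sphere. -/
theorem exists_height (hB : TiltBox S I z₀ m η R L δ ε) (ha : Admissible z₀ η R L δ ε w a) :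
    ∃ ζ : E → ℝ, ContinuousOn ζ (Metric.sphere 0 1) ∧ ∀ x ∈ Metric.sphere (0 : E) 1,
      ζ x ∈ Icc (z₀ - η) (z₀ + η) ∧ ∀ z ∈ Icc (z₀ - η) (z₀ + η),
        (z = a + ⟪w, S (x, z)⟫_ℝ ↔ z = ζ x) := by
  have hne : ∀ x ∈ Metric.sphere (0 : E) 1, x ≠ 0 := fun x hx h => by simp [h] at hx
  have hone : ∀ x ∈ Metric.sphere (0 : E) 1, ‖x‖ = 1 := fun x hx => by simpa using hx
  have hcS : ∀ x ∈ Metric.sphere (0 : E) 1, ∀ z ∈ Icc (z₀ - η) (z₀ + η), ContinuousAt S (x, z) :=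
    fun x hx z hz => (hB.family.contDiffAt (hne x hx) (hB.subset hz)).continuousAt
  -- Intermediate value theorem: over the interval of heights, the plane above S(x, z) stays
  -- strictly inside that interval.
  have hex : ∀ x ∈ Metric.sphere (0 : E) 1, ∃ z ∈ Icc (z₀ - η) (z₀ + η),
      z = a + ⟪w, S (x, z)⟫_ℝ := by
    intro x hx
    have hin : ∀ z ∈ Icc (z₀ - η) (z₀ + η), a + ⟪w, S (x, z)⟫_ℝ ∈ Ioo (z₀ - η) (z₀ + η) :=
      fun z hz => ha.height_mem (lt_of_le_of_lt (hB.bound x (hone x hx) z hz) (by linarith))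
    have hle : z₀ - η ≤ z₀ + η := by linarith [hB.η_pos]
    have hcont : ContinuousOn (fun z => z - (a + ⟪w, S (x, z)⟫_ℝ)) (Icc (z₀ - η) (z₀ + η)) := by
      intro z hz
      have h1 : ContinuousAt (fun z => S (x, z)) z :=
        ContinuousAt.comp (g := S) (f := fun z : ℝ => (x, z)) (hcS x hx z hz) (by fun_prop)
      exact (continuousAt_id.sub (continuousAt_const.add
        (continuousAt_const.inner h1))).continuousWithinAt
    obtain ⟨z, hz, h0⟩ := intermediate_value_Icc hle hcont
      (show (0 : ℝ) ∈ Icc _ _ from ⟨by linarith [(hin _ (left_mem_Icc.2 hle)).1],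
        by linarith [(hin _ (right_mem_Icc.2 hle)).2]⟩)
    exact ⟨z, hz, sub_eq_zero.1 h0⟩
  choose! ζ hζ hζeq using hex
  -- A contraction estimate: the z-dependence contributes at most ‖w‖L < 1/2 of |z' - z| and is
  -- absorbed. With x' = x it gives uniqueness of the height, and otherwise its continuity.
  have hdiff : ∀ x ∈ Metric.sphere (0 : E) 1, ∀ z ∈ Icc (z₀ - η) (z₀ + η),
      ∀ x' ∈ Metric.sphere (0 : E) 1, ∀ z' ∈ Icc (z₀ - η) (z₀ + η),
      z = a + ⟪w, S (x, z)⟫_ℝ → z' = a + ⟪w, S (x', z')⟫_ℝ →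
      |z' - z| ≤ 2 * (‖w‖ * ‖S (x', z) - S (x, z)‖) := by
    intro x hx z hz x' hx' z' hz' h h'
    have h1 : z' - z = ⟪w, S (x', z') - S (x', z)⟫_ℝ + ⟪w, S (x', z) - S (x, z)⟫_ℝ := by
      rw [← inner_add_right, sub_add_sub_cancel, inner_sub_right]
      linarith
    have h2 : |z' - z| ≤ ‖w‖ * ‖S (x', z') - S (x', z)‖ + ‖w‖ * ‖S (x', z) - S (x, z)‖ := by
      rw [h1]
      exact (abs_add_le _ _).trans (add_le_add (abs_real_inner_le_norm _ _)
        (abs_real_inner_le_norm _ _))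
    have h3 := mul_le_mul_of_nonneg_left (hB.lip x' (hone x' hx') z' hz' z hz) (norm_nonneg w)
    nlinarith [ha.contr, abs_nonneg (z' - z)]
  refine ⟨ζ, fun x hx => ?_, fun x hx => ⟨hζ x hx, fun z hz => ⟨fun h => ?_, ?_⟩⟩⟩
  · rw [ContinuousWithinAt, tendsto_iff_norm_sub_tendsto_zero]
    have h1 : ContinuousAt (fun x' => 2 * (‖w‖ * ‖S (x', ζ x) - S (x, ζ x)‖)) x := by
      have : ContinuousAt (fun x' => S (x', ζ x)) x :=
        ContinuousAt.comp (g := S) (f := fun x' : E => (x', ζ x)) (hcS x hx _ (hζ x hx))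
          (by fun_prop)
      exact continuousAt_const.mul (continuousAt_const.mul (this.sub continuousAt_const).norm)
    have h2 := h1.tendsto.mono_left (nhdsWithin_le_nhds (s := Metric.sphere (0 : E) 1))
    simp only [sub_self, norm_zero, mul_zero] at h2
    refine squeeze_zero' (Eventually.of_forall fun _ => norm_nonneg _) ?_ h2
    filter_upwards [self_mem_nhdsWithin] with x' hx'
    exact hdiff x hx _ (hζ x hx) x' hx' _ (hζ x' hx') (hζeq x hx) (hζeq x' hx')
  · have := hdiff x hx _ (hζ x hx) x hx z hz (hζeq x hx) h
    simp only [sub_self, norm_zero, mul_zero] at this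
    exact sub_eq_zero.1 (abs_eq_zero.1 (le_antisymm this (abs_nonneg _)))
  · rintro rfl
    exact hζeq x hx

theorem tiltSet_eq_image {ζ : E → ℝ}
    (hζ : ∀ x ∈ Metric.sphere (0 : E) 1, ζ x ∈ Icc (z₀ - η) (z₀ + η) ∧
      ∀ z ∈ Icc (z₀ - η) (z₀ + η), (z = a + ⟪w, S (x, z)⟫_ℝ ↔ z = ζ x)) :
    tiltSet S z₀ η w a = (fun x => S (x, ζ x)) '' Metric.sphere 0 1 := by
  ext y
  constructor
  · rintro ⟨h1, x, hx, h2⟩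
    refine ⟨x, hx, ?_⟩
    dsimp only at h2 ⊢
    rw [← ((hζ x hx).2 _ h1).1 (by rw [h2])]
    exact h2
  · rintro ⟨x, hx, rfl⟩
    have h := ((hζ x hx).2 _ (hζ x hx).1).2 rfl
    refine ⟨?_, ?_⟩
    · rw [← h]; exact (hζ x hx).1
    · rw [← h]; exact ⟨x, hx, rfl⟩

theorem isCompact_tiltSet (hB : TiltBox S I z₀ m η R L δ ε) (ha : Admissible z₀ η R L δ ε w a) :
    IsCompact (tiltSet S z₀ η w a) ∧ (1 < Module.rank ℝ E → IsConnected (tiltSet S z₀ η w a)) := by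
  obtain ⟨ζ, hζc, hζ⟩ := hB.exists_height ha
  rw [tiltSet_eq_image hζ]
  have hcont : ContinuousOn (fun x => S (x, ζ x)) (Metric.sphere 0 1) := fun x hx => by
    have h1 : ContinuousAt S (x, ζ x) := (hB.family.contDiffAt (by rintro rfl; simp at hx)
      (hB.subset (hζ x hx).1)).continuousAt
    exact ContinuousAt.comp_continuousWithinAt (f := fun x => (x, ζ x)) h1
      (continuousWithinAt_id.prodMk (hζc x hx))
  exact ⟨(isCompact_sphere 0 1).image_of_continuousOn hcont,
    fun h => (isConnected_sphere h 0 zero_le_one).image _ hcont⟩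

/-- The exterior of a tilted section. -/
theorem mem_outside_tiltSet_iff (hB : TiltBox S I z₀ m η R L δ ε)
    (ha : Admissible z₀ η R L δ ε w a) {y : E} : y ∈ outside (tiltSet S z₀ η w a) ↔
      R < ‖y‖ ∨ ∃ v : E, ‖v‖ = 1 ∧ suppFn S (v, a + ⟪w, y⟫_ℝ) < ⟪v, y⟫_ℝ := by
  -- P and N are disjoint open sets covering the complement of the section. N is bounded and
  -- contains m, so components inside N are bounded; points of P will escape along rays from m.
  set P : Set E := {y | R < ‖y‖ ∨ ∃ v : E, ‖v‖ = 1 ∧ suppFn S (v, a + ⟪w, y⟫_ℝ) < ⟪v, y⟫_ℝ} with hP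
  set N : Set E := {y | ‖y‖ ≤ R ∧ ∀ v : E, ‖v‖ = 1 → ⟪v, y⟫_ℝ < suppFn S (v, a + ⟪w, y⟫_ℝ)} with hN
  set O := tiltSet S z₀ η w a with hO
  have hmem : ∀ y : E, ‖y‖ ≤ R → a + ⟪w, y⟫_ℝ ∈ Ioo (z₀ - η) (z₀ + η) := fun y hy =>
    ha.height_mem (by linarith)
  have hJ : ∀ y : E, ‖y‖ ≤ R → a + ⟪w, y⟫_ℝ ∈ Icc (z₀ - η) (z₀ + η) := fun y hy =>
    Ioo_subset_Icc_self (hmem y hy)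
  have hPO : ∀ y ∈ P, y ∉ O := by
    rintro y (h | ⟨v, hv, h⟩) hyO
    · exact absurd (hB.norm_le_of_mem_tiltSet hyO) (not_le.2 h)
    · exact absurd (hB.family.inner_le_suppFn v (hB.subset hyO.1) hyO.2) (not_le.2 h)
  have hcover : ∀ y, y ∉ O → y ∈ N ∪ P := by
    intro y hyO
    by_cases hyP : y ∈ P
    · exact Or.inr hyP
    · have hyP' : ¬ (R < ‖y‖ ∨ ∃ v : E, ‖v‖ = 1 ∧ suppFn S (v, a + ⟪w, y⟫_ℝ) < ⟪v, y⟫_ℝ) := hyP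
      push Not at hyP'
      refine Or.inl ⟨hyP'.1, fun v hv => lt_of_le_of_ne (hyP'.2 v hv) fun heq => hyO ?_⟩
      exact ⟨hJ y hyP'.1, (hB.family.mem_slice_iff (hB.subset (hJ y hyP'.1))).2
        ⟨hyP'.2, v, hv, heq⟩⟩
  have hNP : ∀ y ∈ N, y ∉ P := by
    rintro y ⟨h1, h2⟩ (h3 | ⟨v, hv, h3⟩)
    · exact absurd h1 (not_le.2 h3)
    · exact lt_asymm h3 (h2 v hv)
  have hgc : Continuous fun y : E => a + ⟪w, y⟫_ℝ := by fun_prop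
  have hPopen : IsOpen P := by
    rw [isOpen_iff_mem_nhds]
    intro y hy
    by_cases hyR : R < ‖y‖
    · filter_upwards [continuous_norm.continuousAt.eventually (lt_mem_nhds hyR)] with y' hy'
      exact Or.inl hy'
    · rcases hy with h | ⟨v, hv, h⟩
      · exact absurd h hyR
      have hv0 : v ≠ 0 := by rintro rfl; simp at hv
      have c1 : ContinuousAt (fun y : E => suppFn S (v, a + ⟪w, y⟫_ℝ)) y :=
        ContinuousAt.comp (g := suppFn S) (f := fun y : E => (v, a + ⟪w, y⟫_ℝ))
          (hB.family.contDiffAt_suppFn hv0 (hB.subset (hJ y (not_lt.1 hyR)))).continuousAt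
          (by fun_prop)
      have c2 : ContinuousAt (fun y : E => ⟪v, y⟫_ℝ) y := by fun_prop
      filter_upwards [c1.eventually_lt c2 h] with y' hy'
      exact Or.inr ⟨v, hv, hy'⟩
  have hNopen : IsOpen N := by
    rw [isOpen_iff_mem_nhds]
    rintro y ⟨hyR, hy⟩
    have h1 : ∀ᶠ y' in 𝓝 y, ∀ v ∈ Metric.sphere (0 : E) 1,
        ⟪v, y'⟫_ℝ < suppFn S (v, a + ⟪w, y'⟫_ℝ) := by
      refine (isCompact_sphere (0 : E) 1).eventually_forall_of_forall_eventually fun v hv => ?_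
      have hv1 : ‖v‖ = 1 := by simpa using hv
      have hv0 : v ≠ 0 := by rintro rfl; simp at hv1
      have c1 : ContinuousAt (fun q : E × E => suppFn S (q.2, a + ⟪w, q.1⟫_ℝ)) (y, v) :=
        ContinuousAt.comp (g := suppFn S) (f := fun q : E × E => (q.2, a + ⟪w, q.1⟫_ℝ))
          (hB.family.contDiffAt_suppFn hv0 (hB.subset (hJ y hyR))).continuousAt (by fun_prop)
      have c2 : ContinuousAt (fun q : E × E => ⟪q.2, q.1⟫_ℝ) (y, v) := by fun_prop
      exact c2.eventually_lt c1 (hy v hv1)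
    have h2 : ∀ᶠ y' in 𝓝 y, a + ⟪w, y'⟫_ℝ ∈ Ioo (z₀ - η) (z₀ + η) :=
      hgc.continuousAt.eventually (isOpen_Ioo.mem_nhds (hmem y hyR))
    filter_upwards [h1, h2] with y' h1 h2
    have h3 : ∀ v : E, ‖v‖ = 1 → ⟪v, y'⟫_ℝ < suppFn S (v, a + ⟪w, y'⟫_ℝ) :=
      fun v hv => h1 v (by simpa using hv)
    exact ⟨hB.norm_le_of_inner_le (Ioo_subset_Icc_self h2) fun v hv => (h3 v hv).le, h3⟩
  have hmN : m ∈ N := ⟨hB.norm_interior_le, fun v hv => by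
    linarith [hB.interior v hv _ (hJ m hB.norm_interior_le), hB.δ_pos]⟩
  -- Moving outward by t(y - m) changes the height by at most 2tR‖w‖ and hence the support value by
  -- at most tδ, while ⟨v, ·⟩ grows by more than tδ. So P is preserved.
  have hray : ∀ y ∈ P, ∀ t : ℝ, 0 ≤ t → y + t • (y - m) ∈ P := by
    intro y hy t ht
    by_cases hyt : R < ‖y + t • (y - m)‖
    · exact Or.inl hyt
    have hyt' := not_lt.1 hyt
    -- y is a convex combination of the moved point and m, both in the ball of radius R.
    have hyR : ‖y‖ ≤ R := by
      have h1 : (1 + t) • y = (y + t • (y - m)) + t • m := by module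
      have h2 : (1 + t) * ‖y‖ ≤ (1 + t) * R := by
        calc (1 + t) * ‖y‖ = ‖(1 + t) • y‖ := by
              rw [norm_smul, Real.norm_of_nonneg (by linarith)]
          _ ≤ ‖y + t • (y - m)‖ + ‖t • m‖ := by rw [h1]; exact norm_add_le _ _
          _ ≤ R + t * R := by
              refine add_le_add hyt' ?_
              rw [norm_smul, Real.norm_of_nonneg ht]
              exact mul_le_mul_of_nonneg_left hB.norm_interior_le ht
          _ = (1 + t) * R := by ring
      exact le_of_mul_le_mul_left h2 (by linarith)
    rcases hy with h | ⟨v, hv, h⟩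
    · exact absurd hyR (not_le.2 h)
    refine Or.inr ⟨v, hv, ?_⟩
    have h1 := hB.suppFn_le hv (hJ _ hyt') (hJ _ hyR)
    have h2 := hB.interior v hv _ (hJ _ hyR)
    have h3 : a + ⟪w, y + t • (y - m)⟫_ℝ - (a + ⟪w, y⟫_ℝ) = t * ⟪w, y - m⟫_ℝ := by
      rw [inner_add_right, inner_smul_right]; ring
    have h4 : |t * ⟪w, y - m⟫_ℝ| ≤ t * (‖w‖ * (2 * R)) := by
      rw [abs_mul, abs_of_nonneg ht]
      refine mul_le_mul_of_nonneg_left ((abs_real_inner_le_norm _ _).trans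
        (mul_le_mul_of_nonneg_left ?_ (norm_nonneg _))) ht
      linarith [norm_sub_le y m, hB.norm_interior_le]
    rw [h3] at h1
    have h5 : L * |t * ⟪w, y - m⟫_ℝ| ≤ t * δ := by
      have := mul_le_mul_of_nonneg_left h4 hB.L_nonneg
      nlinarith [ha.star]
    have h6 : ⟪v, y + t • (y - m)⟫_ℝ = ⟪v, y⟫_ℝ + t * (⟪v, y⟫_ℝ - ⟪v, m⟫_ℝ) := by
      rw [inner_add_right, inner_smul_right, inner_sub_right]
    rw [h6]
    nlinarith
  change y ∈ outside O ↔ y ∈ P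
  constructor
  · intro hy
    by_contra hyP
    have hyN : y ∈ N := (hcover y hy.1).resolve_right hyP
    have hsub : connectedComponentIn Oᶜ y ⊆ N := by
      refine isPreconnected_connectedComponentIn.subset_left_of_subset_union hNopen hPopen
        (Set.disjoint_left.2 hNP) (fun x hx => hcover x (connectedComponentIn_subset _ _ hx))
        ⟨y, mem_connectedComponentIn hy.1, hyN⟩
    have hsub' : connectedComponentIn Oᶜ y ⊆ Metric.closedBall 0 R := fun x hx => by
      simpa using (hsub hx).1
    exact hy.2 (Metric.isBounded_closedBall.subset hsub')
  · intro hy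
    refine mem_outside_of_ray (v := y - m) (sub_ne_zero.2 ?_) fun t ht => hPO _ (hray y hy t ht)
    rintro rfl
    exact hNP _ hmN hy

/-- The section is a continuous image of the sphere, whose connectedness needs dim E > 1. Its
exterior has been identified, so restricting the local defining functions of the tube to the plane
gives the curvature condition. -/
theorem isOvaloid_tiltSet (hB : TiltBox S I z₀ m η R L δ ε) (hrank : 1 < Module.rank ℝ E)
    (ha : Admissible z₀ η R L δ ε w a) : IsOvaloid (tiltSet S z₀ η w a) := by
  rw [isOvaloid_iff]
  refine ⟨(hB.isCompact_tiltSet ha).1, (hB.isCompact_tiltSet ha).2 hrank, fun y hy => ?_⟩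
  have hyR := hB.norm_le_of_mem_tiltSet hy
  obtain ⟨x, hx, hyx⟩ := hB.family.exists_eq_suppPt (hB.subset hy.1) hy.2
  have hz : |a + ⟪w, y⟫_ℝ - z₀| < ε := by
    have h1 : |⟪w, y⟫_ℝ| ≤ ‖w‖ * R :=
      (abs_real_inner_le_norm w y).trans (mul_le_mul_of_nonneg_left hyR (norm_nonneg _))
    have h2 : |a + ⟪w, y⟫_ℝ - z₀| ≤ |a - z₀| + |⟪w, y⟫_ℝ| := by
      rw [show a + ⟪w, y⟫_ℝ - z₀ = (a - z₀) + ⟪w, y⟫_ℝ by ring]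
      exact abs_add_le _ _
    linarith [ha.near]
  obtain ⟨F, hF, hsign, hreg, hpos⟩ := hB.tilted _ w hz ha.small x (by simpa using hx)
  rw [← hyx] at hF hsign hreg hpos
  have hg : ContinuousAt (fun y : E => ((y, a + ⟪w, y⟫_ℝ) : E × ℝ)) y :=
    (contDiff_graph w a).continuous.continuousAt
  have hIoo : ∀ᶠ y' in 𝓝 y, a + ⟪w, y'⟫_ℝ ∈ Ioo (z₀ - η) (z₀ + η) :=
    (show ContinuousAt (fun y : E => a + ⟪w, y⟫_ℝ) y by fun_prop).eventually
      (isOpen_Ioo.mem_nhds (ha.height_mem (by linarith)))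
  obtain ⟨U, hU, hfU⟩ := exists_isOuterDefiningFunction_graph (O := tiltSet S z₀ η w a) hF hreg (by
    filter_upwards [hg.eventually hsign, hIoo] with y' h1 h2
    refine ⟨h1.1.trans ⟨fun h => ⟨Ioo_subset_Icc_self h2, h⟩, fun h => h.2⟩, h1.2.trans ?_⟩
    rw [hB.mem_outside_tiltSet_iff ha]
    refine ⟨Or.inr, fun h => h.elim (fun hR => ?_) id⟩
    by_contra hcon
    push Not at hcon
    exact absurd (hB.norm_le_of_inner_le (Ioo_subset_Icc_self h2) hcon) (not_le.2 hR))
  refine ⟨U, _, hU, hfU, fun v hv h0 => ?_⟩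
  have hs := hF.self_of_nhds
  rw [fderiv_comp_graph (hs.differentiableAt (by simp))] at h0
  rw [fderiv_fderiv_comp_graph (hs.of_le ENat.LEInfty.out)]
  exact hpos v hv h0

end TiltBox

end Tilt

/-! ### Differentiating without smooth dependence -/

section OneVariable

/-- Continuity of r at 0 suffices. Heights on a plane tilted by t have the form z₀ + t r(t), with
only continuity of r at hand. -/
theorem hasDerivAt_id_mul_of_continuousAt {r : ℝ → ℝ} (hr : ContinuousAt r 0) :
    HasDerivAt (fun t => t * r t) (r 0) 0 := by
  rw [hasDerivAt_iff_tendsto_slope]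
  refine (hr.tendsto.mono_left nhdsWithin_le_nhds).congr' ?_
  filter_upwards [self_mem_nhdsWithin] with t (ht : t ≠ 0)
  rw [slope_def_field]
  field_simp
  ring

theorem HasDerivAt.squeeze {l φ u : ℝ → ℝ} {c x : ℝ} (hl : HasDerivAt l c x)
    (hu : HasDerivAt u c x) (hlx : l x = φ x) (hux : u x = φ x) (h1 : ∀ᶠ t in 𝓝 x, l t ≤ φ t)
    (h2 : ∀ᶠ t in 𝓝 x, φ t ≤ u t) : HasDerivAt φ c x := by
  rw [hasDerivAt_iff_isLittleO, Asymptotics.isLittleO_iff] at hl hu ⊢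
  intro ε hε
  filter_upwards [hl hε, hu hε, h1, h2] with t ha hb h1 h2
  rw [hlx, Real.norm_eq_abs, abs_le] at ha
  rw [hux, Real.norm_eq_abs, abs_le] at hb
  rw [Real.norm_eq_abs, abs_le]
  constructor <;> linarith [ha.1, hb.2]

end OneVariable

/-! ### The support function of a tilted section -/

section TiltSupport

variable {E : Type*} [NormedAddCommGroup E] [InnerProductSpace ℝ E]

/-- The support function of the section by the plane `z = a + ⟨w, y⟩`, at `p = (w, a)`. -/
noncomputable def tiltSupp (S : E × ℝ → E) (z₀ η : ℝ) (v : E) (p : E × ℝ) : ℝ :=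
  sSup ((fun y => ⟪v, y⟫_ℝ) '' tiltSet S z₀ η p.1 p.2)

theorem isOpen_admissible {z₀ η R L δ ε : ℝ} :
    IsOpen {p : E × ℝ | Admissible z₀ η R L δ ε p.1 p.2} := by
  have h : {p : E × ℝ | Admissible z₀ η R L δ ε p.1 p.2} =
      {p | |p.2 - z₀| < η / 2} ∩ ({p | ‖p.1‖ * (R + 1) < η / 2} ∩ ({p | ‖p.1‖ * L < 1 / 2} ∩
      ({p | |p.2 - z₀| + ‖p.1‖ * R < ε} ∩ ({p | ‖p.1‖ < ε} ∩
      {p | L * (‖p.1‖ * (2 * R)) < δ})))) := by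
    ext p
    exact ⟨fun h => ⟨h.1, h.2, h.3, h.4, h.5, h.6⟩, fun ⟨a, b, c, d, e, f⟩ => ⟨a, b, c, d, e, f⟩⟩
  rw [h]
  exact (isOpen_lt (by fun_prop) (by fun_prop)).inter <|
    (isOpen_lt (by fun_prop) (by fun_prop)).inter <|
    (isOpen_lt (by fun_prop) (by fun_prop)).inter <|
    (isOpen_lt (by fun_prop) (by fun_prop)).inter <|
    (isOpen_lt (by fun_prop) (by fun_prop)).inter (isOpen_lt (by fun_prop) (by fun_prop))

variable [CompleteSpace E] [FiniteDimensional ℝ E] [Nontrivial E]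
  {S : E × ℝ → E} {I : Set ℝ} {z₀ : ℝ} {m : E} {η R L δ ε : ℝ}

namespace TiltBox

theorem exists_inner_eq_tiltSupp (hB : TiltBox S I z₀ m η R L δ ε) {p : E × ℝ}
    (hp : Admissible z₀ η R L δ ε p.1 p.2) (v : E) :
    ∃ y ∈ tiltSet S z₀ η p.1 p.2, ⟪v, y⟫_ℝ = tiltSupp S z₀ η v p ∧
      ∀ y' ∈ tiltSet S z₀ η p.1 p.2, ⟪v, y'⟫_ℝ ≤ tiltSupp S z₀ η v p := by
  have hne : (tiltSet S z₀ η p.1 p.2).Nonempty := by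
    obtain ⟨ζ, -, hζ⟩ := hB.exists_height hp
    rw [tiltSet_eq_image hζ]
    exact (NormedSpace.sphere_nonempty.2 zero_le_one).image _
  obtain ⟨y, hy, h1, h2⟩ := (hB.isCompact_tiltSet hp).1.exists_sSup_image_eq_and_ge hne
    (f := fun y => ⟪v, y⟫_ℝ) (by fun_prop)
  exact ⟨y, hy, h1.symm, fun y' hy' => (h2 y' hy').trans_eq h1.symm⟩

theorem inner_le_tiltSupp (hB : TiltBox S I z₀ m η R L δ ε) {p : E × ℝ}
    (hp : Admissible z₀ η R L δ ε p.1 p.2) (v : E) {y : E} (hy : y ∈ tiltSet S z₀ η p.1 p.2) :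
    ⟪v, y⟫_ℝ ≤ tiltSupp S z₀ η v p := by
  obtain ⟨-, -, -, h⟩ := hB.exists_inner_eq_tiltSupp hp v
  exact h y hy

/-- Compare the points with the same parameter x on both planes. Their height difference is at most
|a - a'| + ‖w - w'‖R plus half of itself, by the contraction bound; absorbing the half gives the
factor 2. -/
theorem exists_near_mem_tiltSet (hB : TiltBox S I z₀ m η R L δ ε) {w w' : E} {a a' : ℝ}
    (hp' : Admissible z₀ η R L δ ε w' a') {y : E}
    (hy : y ∈ tiltSet S z₀ η w a) : ∃ y' ∈ tiltSet S z₀ η w' a',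
      ‖y - y'‖ ≤ L * (2 * (|a - a'| + ‖w - w'‖ * R)) := by
  have hyR := hB.norm_le_of_mem_tiltSet hy
  obtain ⟨ζ, -, hζ⟩ := hB.exists_height hp'
  obtain ⟨hz, x, hx, hxy⟩ := hy
  dsimp only at hxy
  have hz' := (hζ x hx).1
  have hf := ((hζ x hx).2 _ hz').2 rfl
  have hx1 : ‖x‖ = 1 := by simpa using hx
  set z := a + ⟪w, y⟫_ℝ with hzd
  have hl := hB.lip x hx1 z hz (ζ x) hz'
  rw [hxy] at hl
  refine ⟨S (x, ζ x), by rw [tiltSet_eq_image hζ]; exact ⟨x, hx, rfl⟩, hl.trans ?_⟩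
  refine mul_le_mul_of_nonneg_left ?_ hB.L_nonneg
  have h1 : z - ζ x = (a - a') + ⟪w - w', y⟫_ℝ + ⟪w', y - S (x, ζ x)⟫_ℝ := by
    rw [inner_sub_left, inner_sub_right]
    linarith
  have h2 : |⟪w - w', y⟫_ℝ| ≤ ‖w - w'‖ * R :=
    (abs_real_inner_le_norm _ _).trans (mul_le_mul_of_nonneg_left hyR (norm_nonneg _))
  have h3 : |⟪w', y - S (x, ζ x)⟫_ℝ| ≤ 1 / 2 * |z - ζ x| := by
    refine (abs_real_inner_le_norm _ _).trans
      ((mul_le_mul_of_nonneg_left hl (norm_nonneg _)).trans ?_)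
    rw [← mul_assoc]
    exact mul_le_mul_of_nonneg_right hp'.contr.le (abs_nonneg _)
  have h4 : |z - ζ x| ≤ |a - a'| + |⟪w - w', y⟫_ℝ| + |⟪w', y - S (x, ζ x)⟫_ℝ| := by
    rw [h1]
    exact abs_add_three _ _ _
  linarith

theorem tiltSupp_le (hB : TiltBox S I z₀ m η R L δ ε) {p p' : E × ℝ}
    (hp : Admissible z₀ η R L δ ε p.1 p.2) (hp' : Admissible z₀ η R L δ ε p'.1 p'.2) (v : E) :
    tiltSupp S z₀ η v p ≤ tiltSupp S z₀ η v p'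
      + ‖v‖ * (L * (2 * (|p.2 - p'.2| + ‖p.1 - p'.1‖ * R))) := by
  obtain ⟨y, hy, h, -⟩ := hB.exists_inner_eq_tiltSupp hp v
  obtain ⟨y', hy', hyy⟩ := hB.exists_near_mem_tiltSet hp' hy
  have h1 := hB.inner_le_tiltSupp hp' v hy'
  have h2 : ⟪v, y⟫_ℝ = ⟪v, y'⟫_ℝ + ⟪v, y - y'⟫_ℝ := by rw [inner_sub_right]; ring
  have h3 := (real_inner_le_norm v (y - y')).trans (mul_le_mul_of_nonneg_left hyy (norm_nonneg _))
  linarith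

theorem continuousAt_tiltSupp (hB : TiltBox S I z₀ m η R L δ ε) {p : E × ℝ}
    (hp : Admissible z₀ η R L δ ε p.1 p.2) (v : E) : ContinuousAt (tiltSupp S z₀ η v) p := by
  have hb : Tendsto (fun q : E × ℝ => ‖v‖ * (L * (2 * (|q.2 - p.2| + ‖q.1 - p.1‖ * R)))) (𝓝 p)
      (𝓝 0) := by
    have : ContinuousAt (fun q : E × ℝ => ‖v‖ * (L * (2 * (|q.2 - p.2| + ‖q.1 - p.1‖ * R)))) p := by
      fun_prop
    simpa [ContinuousAt] using this
  have hlo : Tendsto (fun q : E × ℝ => tiltSupp S z₀ η v p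
      - ‖v‖ * (L * (2 * (|q.2 - p.2| + ‖q.1 - p.1‖ * R)))) (𝓝 p) (𝓝 (tiltSupp S z₀ η v p)) := by
    simpa using tendsto_const_nhds.sub hb
  have hhi : Tendsto (fun q : E × ℝ => tiltSupp S z₀ η v p
      + ‖v‖ * (L * (2 * (|q.2 - p.2| + ‖q.1 - p.1‖ * R)))) (𝓝 p) (𝓝 (tiltSupp S z₀ η v p)) := by
    simpa using tendsto_const_nhds.add hb
  refine tendsto_of_tendsto_of_tendsto_of_le_of_le' hlo hhi ?_ ?_
  · filter_upwards [isOpen_admissible.mem_nhds hp] with q hq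
    have := hB.tiltSupp_le hp hq v
    rw [abs_sub_comm, norm_sub_rev] at this
    linarith
  · filter_upwards [isOpen_admissible.mem_nhds hp] with q hq
    exact hB.tiltSupp_le hq hp v

/-- The reflection in b preserves the section and exchanges its support points for v and -v. -/
theorem tiltSupp_sub_tiltSupp_neg (hB : TiltBox S I z₀ m η R L δ ε) {p : E × ℝ}
    (hp : Admissible z₀ η R L δ ε p.1 p.2) {b : E}
    (hb : ∀ y ∈ tiltSet S z₀ η p.1 p.2, (2 : ℝ) • b - y ∈ tiltSet S z₀ η p.1 p.2) (v : E) :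
    tiltSupp S z₀ η v p - tiltSupp S z₀ η (-v) p = 2 * ⟪v, b⟫_ℝ := by
  obtain ⟨y, hy, h1, -⟩ := hB.exists_inner_eq_tiltSupp hp v
  obtain ⟨y', hy', h1', -⟩ := hB.exists_inner_eq_tiltSupp hp (-v)
  have h2 := hB.inner_le_tiltSupp hp (-v) (hb y hy)
  have h2' := hB.inner_le_tiltSupp hp v (hb y' hy')
  rw [← h1, ← h1'] at *
  simp only [inner_sub_right, inner_smul_right, inner_neg_left] at *
  linarith

/-- For the planes in D the difference is 2⟨v, b⟩ with b depending on the plane, hence additive in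
v. Continuity in the plane carries additivity, though not a priori central symmetry, to every
admissible plane, in particular to horizontal ones. -/
theorem tiltSupp_additive (hB : TiltBox S I z₀ m η R L δ ε) {D : Set (E × ℝ)} (hD : Dense D)
    (hcent : ∀ p ∈ D, Admissible z₀ η R L δ ε p.1 p.2 →
      ∃ b : E, ∀ y ∈ tiltSet S z₀ η p.1 p.2, (2 : ℝ) • b - y ∈ tiltSet S z₀ η p.1 p.2)
    {p : E × ℝ} (hp : Admissible z₀ η R L δ ε p.1 p.2) (v v' : E) :
    tiltSupp S z₀ η (v + v') p - tiltSupp S z₀ η (-(v + v')) p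
      = (tiltSupp S z₀ η v p - tiltSupp S z₀ η (-v) p)
        + (tiltSupp S z₀ η v' p - tiltSupp S z₀ η (-v') p) := by
  by_contra hne
  have hc := hB.continuousAt_tiltSupp hp
  have hcont := ((hc (v + v')).sub (hc (-(v + v')))).sub
    (((hc v).sub (hc (-v))).add ((hc v').sub (hc (-v'))))
  have hev := (hcont.eventually_ne (sub_ne_zero.2 hne)).and (isOpen_admissible.mem_nhds hp)
  obtain ⟨q, hqD, hq1, hq2⟩ := hD.inter_nhds_nonempty hev
  obtain ⟨b, hb⟩ := hcent q hqD hq2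
  apply hq1
  simp only [Pi.sub_apply, Pi.add_apply]
  rw [hB.tiltSupp_sub_tiltSupp_neg hq2 hb, hB.tiltSupp_sub_tiltSupp_neg hq2 hb,
    hB.tiltSupp_sub_tiltSupp_neg hq2 hb, inner_add_left]
  ring

end TiltBox

end TiltSupport

/-! ### The first variation of the support function under tilting -/

section Danskin

theorem tendsto_add_mul_of_bounded {s : ℝ → ℝ} {z C : ℝ} (hs : ∀ᶠ t in 𝓝 0, |s t| ≤ C) :
    Tendsto (fun t => z + t * s t) (𝓝 0) (𝓝 z) := by
  have h : Tendsto (fun t => t * s t) (𝓝 0) (𝓝 0) := by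
    refine squeeze_zero_norm' (a := fun t => |t| * C) ?_ ?_
    · filter_upwards [hs] with t ht
      rw [Real.norm_eq_abs, abs_mul]
      exact mul_le_mul_of_nonneg_left ht (abs_nonneg _)
    · have : ContinuousAt (fun t : ℝ => |t| * C) 0 := by fun_prop
      simpa [ContinuousAt] using this
  simpa using tendsto_const_nhds.add h

variable {E : Type*} [NormedAddCommGroup E] [InnerProductSpace ℝ E]

theorem hasDerivAt_snd_line {F : Type*} [NormedAddCommGroup F] [NormedSpace ℝ F] {G : E × ℝ → F}
    {x : E} {z : ℝ} (hG : DifferentiableAt ℝ G (x, z)) :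
    HasDerivAt (fun t : ℝ => G (x, t)) (fderiv ℝ G (x, z) (0, 1)) z :=
  hG.hasFDerivAt.comp_hasDerivAt z ((hasDerivAt_const z x).prodMk (hasDerivAt_id z))

variable [CompleteSpace E] [FiniteDimensional ℝ E] [Nontrivial E]
  {S : E × ℝ → E} {I : Set ℝ} {z₀ : ℝ} {m : E} {η R L δ ε : ℝ}

/-- Envelope argument: ⟨v, S(x, t)⟩ never exceeds the support function at height t and equals it at
t = z, so the derivatives agree. -/
theorem OvaloidFamily.inner_fderiv_height (hS : OvaloidFamily S I) {v x : E} {z : ℝ} (hv : v ≠ 0)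
    (hx : x ≠ 0) (hz : z ∈ I) (hxv : S (x, z) = suppPt S (v, z)) :
    ⟪v, fderiv ℝ S (x, z) (0, 1)⟫_ℝ = fderiv ℝ (suppFn S) (v, z) (0, 1) := by
  have h1 : HasDerivAt (fun t : ℝ => ⟪v, S (x, t)⟫_ℝ) ⟪v, fderiv ℝ S (x, z) (0, 1)⟫_ℝ z := by
    simpa using (hasDerivAt_const z v).inner ℝ
      (hasDerivAt_snd_line ((hS.contDiffAt hx hz).differentiableAt (by simp)))
  have h2 : HasDerivAt (fun t : ℝ => suppFn S (v, t)) (fderiv ℝ (suppFn S) (v, z) (0, 1)) z :=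
    hasDerivAt_snd_line ((hS.contDiffAt_suppFn hv hz).differentiableAt (by simp))
  refine sub_eq_zero.1 (IsLocalMax.hasDerivAt_eq_zero ?_ (h1.sub h2))
  filter_upwards [hS.isOpen.mem_nhds hz] with t ht
  have h3 := hS.inner_le_suppFn v ht (hS.mem_slice hx t)
  simp only [Pi.sub_apply]
  rw [hxv, show ⟪v, suppPt S (v, z)⟫_ℝ = suppFn S (v, z) from rfl, sub_self]
  linarith

/-- Near-maximizers of ⟨v, ·⟩ are near the maximizer, uniformly over nearby heights: the maximizer
is unique and the sphere compact. -/
theorem OvaloidFamily.eventually_near_suppPt (hS : OvaloidFamily S I) {v : E} (hv : v ≠ 0)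
    (hz₀ : z₀ ∈ I) {V : Set E} (hV : V ∈ 𝓝 (suppPt S (v, z₀))) :
    ∀ᶠ q : ℝ × ℝ in 𝓝 (z₀, suppFn S (v, z₀)), ∀ y ∈ slice S q.1, y ∈ V ∨ ⟪v, y⟫_ℝ < q.2 := by
  have h : ∀ᶠ q : ℝ × ℝ in 𝓝 (z₀, suppFn S (v, z₀)), ∀ x ∈ Metric.sphere (0 : E) 1,
      S (x, q.1) ∈ V ∨ ⟪v, S (x, q.1)⟫_ℝ < q.2 := by
    refine (isCompact_sphere (0 : E) 1).eventually_forall_of_forall_eventually fun x hx => ?_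
    have hx0 : x ≠ 0 := by rintro rfl; simp at hx
    have hc : ContinuousAt (fun r : (ℝ × ℝ) × E => S (r.2, r.1.1)) ((z₀, suppFn S (v, z₀)), x) :=
      ContinuousAt.comp (g := S) (f := fun r : (ℝ × ℝ) × E => (r.2, r.1.1))
        (hS.contDiffAt hx0 hz₀).continuousAt (by fun_prop)
    by_cases hxv : S (x, z₀) = suppPt S (v, z₀)
    · filter_upwards [hc (show V ∈ 𝓝 (S (x, z₀)) by rwa [hxv])] with r hr
      exact Or.inl hr
    · have := ContinuousAt.eventually_lt (continuousAt_const.inner hc)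
        (g := fun r : (ℝ × ℝ) × E => r.1.2) (by fun_prop)
        (hS.inner_lt_suppFn hv hz₀ (hS.mem_slice hx0 z₀) hxv)
      filter_upwards [this] with r hr
      exact Or.inr hr
  filter_upwards [h] with q hq
  rintro _ ⟨x, hx, rfl⟩
  exact hq x hx

namespace TiltBox

theorem tiltSet_zero (hB : TiltBox S I z₀ m η R L δ ε) : tiltSet S z₀ η 0 z₀ = slice S z₀ := by
  ext y
  simp only [tiltSet, inner_zero_left, add_zero]
  exact and_iff_right hB.z₀_mem

theorem admissible_zero (hB : TiltBox S I z₀ m η R L δ ε) : Admissible z₀ η R L δ ε (0 : E) z₀ :=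
  (eventually_admissible (R := R) (L := L) hB.η_pos hB.δ_pos hB.ε_pos).self_of_nhds

theorem tiltSupp_zero (hB : TiltBox S I z₀ m η R L δ ε) {v : E} (hv : v ≠ 0) :
    tiltSupp S z₀ η v (0, z₀) = suppFn S (v, z₀) := by
  obtain ⟨y, hy, h1, h2⟩ := hB.exists_inner_eq_tiltSupp (p := (0, z₀)) hB.admissible_zero v
  dsimp only at hy h2
  rw [hB.tiltSet_zero] at hy h2
  have hz₀ := hB.subset hB.z₀_mem
  exact le_antisymm (h1 ▸ hB.family.inner_le_suppFn v hz₀ hy)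
    (h2 _ (hB.family.suppPt_mem hv hz₀))

/-- Danskin's argument with two barriers touching at t = 0. From below, keep the parameter x₀ of the
horizontal maximizer; from above, use the support function at the height of the tilted maximizer.
Both heights are z₀ + t s(t) with s(0) = ⟨w, Γ(v)⟩, and both barriers have the z-derivative of the
support function. -/
theorem hasDerivAt_tiltSupp (hB : TiltBox S I z₀ m η R L δ ε) {v : E} (hv : v ≠ 0) (w : E) :
    HasDerivAt (fun t : ℝ => tiltSupp S z₀ η v (t • w, z₀))
      (fderiv ℝ (suppFn S) (v, z₀) (0, 1) * ⟪w, suppPt S (v, z₀)⟫_ℝ) 0 := by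
  have hS := hB.family
  have hz₀ := hB.subset hB.z₀_mem
  have hline : ContinuousAt (fun t : ℝ => ((t • w, z₀) : E × ℝ)) 0 := by fun_prop
  have hadm : ∀ᶠ t : ℝ in 𝓝 0, Admissible z₀ η R L δ ε (t • w) z₀ :=
    hline.eventually (by
      simpa using eventually_admissible (E := E) (R := R) (L := L) hB.η_pos hB.δ_pos hB.ε_pos)
  have hbd : ∀ y : E, ‖y‖ ≤ R → |⟪w, y⟫_ℝ| ≤ ‖w‖ * R := fun y hy =>
    (abs_real_inner_le_norm w y).trans (mul_le_mul_of_nonneg_left hy (norm_nonneg _))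
  obtain ⟨x₀, hx₀, hxv⟩ := hS.suppPt_mem hv hz₀
  dsimp only at hxv
  have hx₀1 : ‖x₀‖ = 1 := by simpa using hx₀
  have hx₀0 : x₀ ≠ 0 := by rintro rfl; simp at hx₀1
  -- the lower barrier
  have hex : ∀ t : ℝ, ∃ ζ : ℝ, Admissible z₀ η R L δ ε (t • w) z₀ →
      ζ ∈ Icc (z₀ - η) (z₀ + η) ∧ ζ = z₀ + t * ⟪w, S (x₀, ζ)⟫_ℝ := fun t => by
    by_cases ha : Admissible z₀ η R L δ ε (t • w) z₀
    · obtain ⟨ζ, -, hζ⟩ := hB.exists_height ha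
      refine ⟨ζ x₀, fun _ => ⟨(hζ x₀ hx₀).1, ?_⟩⟩
      simpa [inner_smul_left] using ((hζ x₀ hx₀).2 _ (hζ x₀ hx₀).1).2 rfl
    · exact ⟨0, fun h => absurd h ha⟩
  choose ζ hζ using hex
  set s₁ : ℝ → ℝ := fun t => ⟪w, S (x₀, ζ t)⟫_ℝ with hs₁
  have hs₁b : ∀ᶠ t in 𝓝 0, |s₁ t| ≤ ‖w‖ * R := by
    filter_upwards [hadm] with t ht
    exact hbd _ (hB.bound x₀ hx₀1 _ (hζ t ht).1)
  have hζ0 : ζ 0 = z₀ := by simpa using (hζ 0 hadm.self_of_nhds).2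
  have hζc : Tendsto ζ (𝓝 0) (𝓝 z₀) := by
    refine (tendsto_add_mul_of_bounded (z := z₀) hs₁b).congr' ?_
    filter_upwards [hadm] with t ht
    exact (hζ t ht).2.symm
  have hSz : DifferentiableAt ℝ S (x₀, z₀) := (hS.contDiffAt hx₀0 hz₀).differentiableAt (by simp)
  have hs₁0 : s₁ 0 = ⟪w, suppPt S (v, z₀)⟫_ℝ := by simp only [hs₁]; rw [hζ0, hxv]
  have hs₁c : ContinuousAt s₁ 0 := by
    have h1 : ContinuousAt (fun z => S (x₀, z)) (ζ 0) := by
      rw [hζ0]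
      exact (hasDerivAt_snd_line hSz).continuousAt
    have h2 : ContinuousAt ζ 0 := by rw [ContinuousAt, hζ0]; exact hζc
    exact continuousAt_const.inner (ContinuousAt.comp (g := fun z => S (x₀, z)) (f := ζ) h1 h2)
  have hl : HasDerivAt (fun t => ⟪v, S (x₀, z₀ + t * s₁ t)⟫_ℝ)
      (fderiv ℝ (suppFn S) (v, z₀) (0, 1) * ⟪w, suppPt S (v, z₀)⟫_ℝ) 0 := by
    have h1 : HasDerivAt (fun t : ℝ => ⟪v, S (x₀, t)⟫_ℝ) (fderiv ℝ (suppFn S) (v, z₀) (0, 1))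
        (z₀ + 0 * s₁ 0) := by
      rw [← hS.inner_fderiv_height hv hx₀0 hz₀ hxv, zero_mul, add_zero]
      simpa using (hasDerivAt_const z₀ v).inner ℝ (hasDerivAt_snd_line hSz)
    rw [← hs₁0]
    exact h1.comp (0 : ℝ) ((hasDerivAt_id_mul_of_continuousAt hs₁c).const_add z₀)
  -- the upper barrier
  have hex : ∀ t : ℝ, ∃ y : E, Admissible z₀ η R L δ ε (t • w) z₀ →
      y ∈ tiltSet S z₀ η (t • w) z₀ ∧ ⟪v, y⟫_ℝ = tiltSupp S z₀ η v (t • w, z₀) := fun t => by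
    by_cases ha : Admissible z₀ η R L δ ε (t • w) z₀
    · obtain ⟨y, hy, h, -⟩ := hB.exists_inner_eq_tiltSupp (p := (t • w, z₀)) ha v
      exact ⟨y, fun _ => ⟨hy, h⟩⟩
    · exact ⟨0, fun h => absurd h ha⟩
  choose y hy using hex
  set s₂ : ℝ → ℝ := fun t => ⟪w, y t⟫_ℝ with hs₂
  have hs₂b : ∀ᶠ t in 𝓝 0, |s₂ t| ≤ ‖w‖ * R := by
    filter_upwards [hadm] with t ht
    exact hbd _ (hB.norm_le_of_mem_tiltSet (hy t ht).1)
  have hyslice : ∀ t, Admissible z₀ η R L δ ε (t • w) z₀ →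
      z₀ + t * s₂ t ∈ I ∧ y t ∈ slice S (z₀ + t * s₂ t) := fun t ht => by
    have := (hy t ht).1
    rw [tiltSet, mem_ofPred_eq, inner_smul_left] at this
    exact ⟨hB.subset this.1, this.2⟩
  have hy0 : y 0 = suppPt S (v, z₀) := by
    have h1 := hyslice 0 hadm.self_of_nhds
    have h2 := (hy 0 hadm.self_of_nhds).2
    rw [zero_smul, hB.tiltSupp_zero hv] at h2
    by_contra hne
    exact (hS.inner_lt_suppFn hv hz₀ (by simpa using h1.2) hne).ne h2
  have hzc := tendsto_add_mul_of_bounded (z := z₀) hs₂b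
  have hφc : ContinuousAt (fun t : ℝ => tiltSupp S z₀ η v (t • w, z₀)) 0 :=
    ContinuousAt.comp (g := tiltSupp S z₀ η v) (f := fun t : ℝ => ((t • w, z₀) : E × ℝ))
      (hB.continuousAt_tiltSupp (by simpa using hB.admissible_zero) v) hline
  have hφ0 : tiltSupp S z₀ η v ((0 : ℝ) • w, z₀) = suppFn S (v, z₀) := by
    rw [zero_smul, hB.tiltSupp_zero hv]
  -- The maximizers are merely chosen, but at t = 0 the maximizer is unique, so any choice is
  -- continuous there.
  have hyc : ContinuousAt y 0 := by
    intro V hV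
    rw [hy0] at hV
    have hq : Tendsto (fun t : ℝ => (z₀ + t * s₂ t, tiltSupp S z₀ η v (t • w, z₀))) (𝓝 0)
        (𝓝 (z₀, suppFn S (v, z₀))) := by
      rw [ContinuousAt, hφ0] at hφc
      exact hzc.prodMk_nhds hφc
    change ∀ᶠ t in 𝓝 0, y t ∈ V
    filter_upwards [hq.eventually (hS.eventually_near_suppPt hv hz₀ hV), hadm] with t ht ha
    exact (ht _ (hyslice t ha).2).resolve_right (hy t ha).2.not_lt
  have hs₂0 : s₂ 0 = ⟪w, suppPt S (v, z₀)⟫_ℝ := by simp only [hs₂]; rw [hy0]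
  have hu : HasDerivAt (fun t => suppFn S (v, z₀ + t * s₂ t))
      (fderiv ℝ (suppFn S) (v, z₀) (0, 1) * ⟪w, suppPt S (v, z₀)⟫_ℝ) 0 := by
    have h1 : HasDerivAt (fun t : ℝ => suppFn S (v, t)) (fderiv ℝ (suppFn S) (v, z₀) (0, 1))
        (z₀ + 0 * s₂ 0) := by
      rw [zero_mul, add_zero]
      exact hasDerivAt_snd_line ((hS.contDiffAt_suppFn hv hz₀).differentiableAt (by simp))
    rw [← hs₂0]
    exact h1.comp (0 : ℝ)
      ((hasDerivAt_id_mul_of_continuousAt (continuousAt_const.inner hyc)).const_add z₀)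
  refine hl.squeeze hu ?_ ?_ ?_ ?_
  · rw [hφ0, zero_mul, add_zero, hxv, suppFn]
  · rw [hφ0, zero_mul, add_zero]
  · filter_upwards [hadm] with t ht
    refine hB.inner_le_tiltSupp (p := (t • w, z₀)) ht v ?_
    have h1 := hζ t ht
    have h2 : z₀ + t * s₁ t = ζ t := h1.2.symm
    rw [h2]
    refine ⟨?_, ?_⟩
    · rw [inner_smul_left]
      exact h2.symm ▸ h1.1
    · rw [inner_smul_left]
      change S (x₀, ζ t) ∈ slice S (z₀ + t * s₁ t)
      rw [h2]
      exact hS.mem_slice hx₀0 _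
  · filter_upwards [hadm] with t ht
    rw [← (hy t ht).2]
    exact hS.inner_le_suppFn v (hyslice t ht).1 (hyslice t ht).2

end TiltBox

end Danskin

/-! ### Consequences of central symmetry of the tilted sections -/

section CentralTilts

variable {E : Type*} [NormedAddCommGroup E] [InnerProductSpace ℝ E] [CompleteSpace E]

/-- The even part of the support function. -/
noncomputable def evenSupp (S : E × ℝ → E) (p : E × ℝ) : ℝ :=
  (suppFn S p + suppFn S (-p.1, p.2)) / 2

/-- The odd part of the support function. -/
noncomputable def oddSupp (S : E × ℝ → E) (p : E × ℝ) : ℝ :=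
  (suppFn S p - suppFn S (-p.1, p.2)) / 2


/-- Near every height, almost all slightly tilted sections are centrally symmetric. -/
def HasCentralTilts (S : E × ℝ → E) (I : Set ℝ) : Prop :=
  ∀ (z₀ : ℝ) (m : E) (η R L δ ε : ℝ), TiltBox S I z₀ m η R L δ ε →
    ∃ D : Set (E × ℝ), Dense D ∧ ∀ p ∈ D, Admissible z₀ η R L δ ε p.1 p.2 →
      ∃ b : E, ∀ y ∈ tiltSet S z₀ η p.1 p.2, (2 : ℝ) • b - y ∈ tiltSet S z₀ η p.1 p.2

variable [FiniteDimensional ℝ E] [Nontrivial E] {S : E × ℝ → E} {I : Set ℝ}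

namespace OvaloidFamily

theorem contDiffAt_suppFn_neg (hS : OvaloidFamily S I) {v : E} (hv : v ≠ 0) {z : ℝ} (hz : z ∈ I) :
    ContDiffAt ℝ ∞ (fun p : E × ℝ => suppFn S (-p.1, p.2)) (v, z) :=
  ContDiffAt.comp (g := suppFn S) (f := fun p : E × ℝ => (-p.1, p.2)) (v, z)
    (hS.contDiffAt_suppFn (neg_ne_zero.2 hv) hz) (by fun_prop)

theorem contDiffAt_evenSupp (hS : OvaloidFamily S I) {v : E} (hv : v ≠ 0) {z : ℝ} (hz : z ∈ I) :
    ContDiffAt ℝ ∞ (evenSupp S) (v, z) :=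
  ((hS.contDiffAt_suppFn hv hz).add (hS.contDiffAt_suppFn_neg hv hz)).div_const 2

theorem contDiffAt_oddSupp (hS : OvaloidFamily S I) {v : E} (hv : v ≠ 0) {z : ℝ} (hz : z ∈ I) :
    ContDiffAt ℝ ∞ (oddSupp S) (v, z) :=
  ((hS.contDiffAt_suppFn hv hz).sub (hS.contDiffAt_suppFn_neg hv hz)).div_const 2

theorem fderiv_suppFn_eq (hS : OvaloidFamily S I) {v : E} (hv : v ≠ 0) {z : ℝ} (hz : z ∈ I)
    (q : E × ℝ) : fderiv ℝ (suppFn S) (v, z) q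
      = fderiv ℝ (evenSupp S) (v, z) q + fderiv ℝ (oddSupp S) (v, z) q := by
  have h : suppFn S = evenSupp S + oddSupp S := by
    funext p
    simp only [evenSupp, oddSupp, Pi.add_apply]
    ring
  conv_lhs => rw [h]
  rw [fderiv_add ((hS.contDiffAt_evenSupp hv hz).differentiableAt (by simp))
    ((hS.contDiffAt_oddSupp hv hz).differentiableAt (by simp))]
  rfl

theorem fderiv_suppFn_neg_eq (hS : OvaloidFamily S I) {v : E} (hv : v ≠ 0) {z : ℝ} (hz : z ∈ I)
    (ξ : E) (r : ℝ) : fderiv ℝ (suppFn S) (-v, z) (-ξ, r)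
      = fderiv ℝ (evenSupp S) (v, z) (ξ, r) - fderiv ℝ (oddSupp S) (v, z) (ξ, r) := by
  have h : (fun p : E × ℝ => suppFn S (-p.1, p.2)) = evenSupp S - oddSupp S := by
    funext p
    simp only [evenSupp, oddSupp, Pi.sub_apply]
    ring
  have h1 : HasFDerivAt (fun p : E × ℝ => ((-p.1, p.2) : E × ℝ))
      ((-ContinuousLinearMap.fst ℝ E ℝ).prod (ContinuousLinearMap.snd ℝ E ℝ)) (v, z) :=
    hasFDerivAt_fst.neg.prodMk hasFDerivAt_snd
  have h2 : HasFDerivAt (suppFn S) (fderiv ℝ (suppFn S) (-v, z)) ((fun p : E × ℝ => (-p.1, p.2)) (v, z)) :=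
    ((hS.contDiffAt_suppFn (neg_ne_zero.2 hv) hz).differentiableAt (by simp)).hasFDerivAt
  have h3 := (h2.comp (v, z) h1).fderiv
  have h4 : fderiv ℝ (evenSupp S - oddSupp S) (v, z)
      = fderiv ℝ (suppFn S) (-v, z) ∘L
        ((-ContinuousLinearMap.fst ℝ E ℝ).prod (ContinuousLinearMap.snd ℝ E ℝ)) := by
    rw [← h3, ← h]
    rfl
  rw [fderiv_sub ((hS.contDiffAt_evenSupp hv hz).differentiableAt (by simp))
    ((hS.contDiffAt_oddSupp hv hz).differentiableAt (by simp))] at h4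
  have h5 := congrArg (fun A : E × ℝ →L[ℝ] ℝ => A (ξ, r)) h4
  simpa using h5.symm

variable {v v' : E}

/-- Additivity for tilted sections, read at the horizontal plane itself. Nonzero vectors are
required because the support function is compared with the section only for them. -/
theorem oddSupp_add (hS : OvaloidFamily S I) (hC : HasCentralTilts S I) (hv : v ≠ 0) (hv' : v' ≠ 0)
    (hvv : v + v' ≠ 0) {z : ℝ} (hz : z ∈ I) :
    oddSupp S (v + v', z) = oddSupp S (v, z) + oddSupp S (v', z) := by
  obtain ⟨m, η, R, L, δ, ε, hB⟩ := hS.exists_tiltBox hz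
  obtain ⟨D, hD, hcent⟩ := hC z m η R L δ ε hB
  have h := hB.tiltSupp_additive hD hcent (p := (0, z)) hB.admissible_zero v v'
  rw [hB.tiltSupp_zero hv, hB.tiltSupp_zero hv', hB.tiltSupp_zero hvv,
    hB.tiltSupp_zero (neg_ne_zero.2 hv), hB.tiltSupp_zero (neg_ne_zero.2 hv'),
    hB.tiltSupp_zero (neg_ne_zero.2 hvv)] at h
  simp only [oddSupp]
  linarith

theorem fderiv_oddSupp_height_add (hS : OvaloidFamily S I) (hC : HasCentralTilts S I) (hv : v ≠ 0)
    (hv' : v' ≠ 0) (hvv : v + v' ≠ 0) {z : ℝ} (hz : z ∈ I) :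
    fderiv ℝ (oddSupp S) (v + v', z) (0, 1)
      = fderiv ℝ (oddSupp S) (v, z) (0, 1) + fderiv ℝ (oddSupp S) (v', z) (0, 1) := by
  have hd : ∀ {x : E}, x ≠ 0 → HasDerivAt (fun t : ℝ => oddSupp S (x, t))
      (fderiv ℝ (oddSupp S) (x, z) (0, 1)) z := fun hx =>
    hasDerivAt_snd_line ((hS.contDiffAt_oddSupp hx hz).differentiableAt (by simp))
  refine ((hd hvv).congr_of_eventuallyEq ?_).unique ((hd hv).add (hd hv')) |>.symm ▸ rfl
  filter_upwards [hS.isOpen.mem_nhds hz] with t ht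
  exact (hS.oddSupp_add hC hv hv' hvv ht).symm

theorem fderiv_oddSupp_add (hS : OvaloidFamily S I) (hC : HasCentralTilts S I) (hv : v ≠ 0)
    (hv' : v' ≠ 0) (hvv : v + v' ≠ 0) {z : ℝ} (hz : z ∈ I) (w : E) :
    fderiv ℝ (oddSupp S) (v + v', z) (w, 0) = fderiv ℝ (oddSupp S) (v, z) (w, 0) := by
  have hd : ∀ {x : E}, x ≠ 0 → HasDerivAt (fun t : ℝ => oddSupp S (x + t • w, z))
      (fderiv ℝ (oddSupp S) (x, z) (w, 0)) 0 := fun hx =>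
    hasDerivAt_fst_line ((hS.contDiffAt_oddSupp hx hz).differentiableAt (by simp)) w
  refine (hd hvv).unique (((hd hv).add_const (oddSupp S (v', z))).congr_of_eventuallyEq ?_)
  filter_upwards [eventually_ne_zero hv w, eventually_ne_zero hvv w] with t h1 h2
  rw [add_right_comm] at h2 ⊢
  exact hS.oddSupp_add hC h1 hv' h2 hz

/-- The product of the height derivative and a directional derivative of the even part of the
support function is additive. -/
theorem evenSupp_product_add (hS : OvaloidFamily S I) (hC : HasCentralTilts S I) (hv : v ≠ 0)
    (hv' : v' ≠ 0) (hvv : v + v' ≠ 0) {z : ℝ} (hz : z ∈ I) (w : E) :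
    fderiv ℝ (evenSupp S) (v + v', z) (0, 1) * fderiv ℝ (evenSupp S) (v + v', z) (w, 0)
      = fderiv ℝ (evenSupp S) (v, z) (0, 1) * fderiv ℝ (evenSupp S) (v, z) (w, 0)
        + fderiv ℝ (evenSupp S) (v', z) (0, 1) * fderiv ℝ (evenSupp S) (v', z) (w, 0) := by
  obtain ⟨m, η, R, L, δ, ε, hB⟩ := hS.exists_tiltBox hz
  obtain ⟨D, hD, hcent⟩ := hC z m η R L δ ε hB
  -- Insert H = g + o, at x and at -x, into the envelope formula. The mixed products cancel.
  have hd : ∀ {x : E}, x ≠ 0 → HasDerivAt (fun t : ℝ => tiltSupp S z η x (t • w, z)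
      - tiltSupp S z η (-x) (t • w, z))
      (2 * (fderiv ℝ (evenSupp S) (x, z) (0, 1) * fderiv ℝ (evenSupp S) (x, z) (w, 0)
        + fderiv ℝ (oddSupp S) (x, z) (0, 1) * fderiv ℝ (oddSupp S) (x, z) (w, 0))) 0 := by
    intro x hx
    have h := (hB.hasDerivAt_tiltSupp hx w).sub (hB.hasDerivAt_tiltSupp (neg_ne_zero.2 hx) w)
    refine h.congr_deriv ?_
    have e1 := hS.fderiv_suppFn_eq hx hz (0, 1)
    have e2 := hS.fderiv_suppFn_eq hx hz (w, 0)
    have e3 := hS.fderiv_suppFn_neg_eq hx hz 0 1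
    have e4 := hS.fderiv_suppFn_neg_eq hx hz w 0
    rw [hS.fderiv_suppFn hx hz] at e2
    rw [hS.fderiv_suppFn (neg_ne_zero.2 hx) hz, inner_neg_left] at e4
    rw [neg_zero] at e3
    rw [e1, e2, e3, neg_eq_iff_eq_neg.1 e4]
    ring
  have hline : ContinuousAt (fun t : ℝ => ((t • w, z) : E × ℝ)) 0 := by fun_prop
  have hadm : ∀ᶠ t : ℝ in 𝓝 0, Admissible z η R L δ ε (t • w) z :=
    hline.eventually (by
      simpa using eventually_admissible (E := E) (R := R) (L := L) hB.η_pos hB.δ_pos hB.ε_pos)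
  have h := (hd hvv).unique (((hd hv).add (hd hv')).congr_of_eventuallyEq (by
    filter_upwards [hadm] with t ht
    exact hB.tiltSupp_additive hD hcent (p := (t • w, z)) ht v v'))
  have h1 := hS.fderiv_oddSupp_add hC hv hv' hvv hz w
  have h2 := hS.fderiv_oddSupp_add hC hv' hv (by rwa [add_comm]) hz w
  rw [add_comm] at h2
  rw [hS.fderiv_oddSupp_height_add hC hv hv' hvv hz] at h
  -- The height derivative of the odd part is additive and its derivative along w is the same at v,
  -- v' and v + v'. The product of the two is therefore additive and can be subtracted.
  linear_combination h / 2 - (fderiv ℝ (oddSupp S) (v, z) (0, 1)) * h1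
    - (fderiv ℝ (oddSupp S) (v', z) (0, 1)) * h2

end OvaloidFamily

end CentralTilts

/-! ### Directional derivatives of homogeneous functions -/

section Directional

variable {E : Type*} [NormedAddCommGroup E] [InnerProductSpace ℝ E] [CompleteSpace E]

/-- The derivative of `G` in the direction `q`. -/
noncomputable def dirDeriv (q : E × ℝ) (G : E × ℝ → ℝ) (p : E × ℝ) : ℝ := fderiv ℝ G p q

/-- `G` is smooth at all `(v, z)` with `v ≠ 0` and `z ∈ I`. -/
def SmoothOffZero (I : Set ℝ) (G : E × ℝ → ℝ) : Prop :=
  ∀ v, v ≠ 0 → ∀ z ∈ I, ContDiffAt ℝ ∞ G (v, z)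

/-- `G` is positively homogeneous of degree `k` in its first argument. -/
def IsPosHomog (I : Set ℝ) (k : ℤ) (G : E × ℝ → ℝ) : Prop :=
  ∀ t : ℝ, 0 < t → ∀ v, v ≠ 0 → ∀ z ∈ I, G (t • v, z) = t ^ k * G (v, z)

variable {I : Set ℝ} {G : E × ℝ → ℝ} {v : E} {z : ℝ}

theorem dirDeriv_smul (r : ℝ) (w : E) (p : E × ℝ) :
    dirDeriv (r • w, 0) G p = r * dirDeriv (w, 0) G p := by
  have := map_smul (fderiv ℝ G p) r (w, 0)
  simpa [dirDeriv] using this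

theorem dirDeriv_sub_smul (w : E) (r : ℝ) (x : E) (p : E × ℝ) :
    dirDeriv (w - r • x, 0) G p = dirDeriv (w, 0) G p - r * dirDeriv (x, 0) G p := by
  rw [← dirDeriv_smul, dirDeriv, dirDeriv, dirDeriv, ← map_sub]
  simp

theorem dirDeriv_sum {ι : Type*} [Fintype ι] (b : OrthonormalBasis ι ℝ E) (w : E) (p : E × ℝ) :
    ∑ i, ⟪b i, w⟫_ℝ * dirDeriv (b i, 0) G p = dirDeriv (w, 0) G p := by
  conv_rhs => rw [← b.sum_repr' w]
  have h : ((∑ i, ⟪b i, w⟫_ℝ • b i, 0) : E × ℝ) = ∑ i, ⟪b i, w⟫_ℝ • (b i, (0 : ℝ)) := by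
    ext1 <;> simp [Prod.fst_sum, Prod.snd_sum]
  rw [h, dirDeriv, map_sum]
  refine Finset.sum_congr rfl fun i _ => ?_
  rw [map_smul]
  rfl

namespace SmoothOffZero

theorem dirDeriv (hG : SmoothOffZero I G) (q : E × ℝ) : SmoothOffZero I (dirDeriv q G) :=
  fun v hv z hz => ((hG v hv z hz).fderiv_right (m := ∞) (by simp)).clm_apply contDiffAt_const

theorem differentiableAt (hG : SmoothOffZero I G) (hv : v ≠ 0) (hz : z ∈ I) :
    DifferentiableAt ℝ G (v, z) :=
  (hG v hv z hz).differentiableAt (by simp)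

theorem dirDeriv_comm (hG : SmoothOffZero I G) (hv : v ≠ 0) (hz : z ∈ I) (q q' : E × ℝ) :
    _root_.dirDeriv q (_root_.dirDeriv q' G) (v, z)
      = _root_.dirDeriv q' (_root_.dirDeriv q G) (v, z) := by
  have h2 : DifferentiableAt ℝ (fderiv ℝ G) (v, z) :=
    ((hG v hv z hz).fderiv_right (m := ∞) (by simp)).differentiableAt (by simp)
  have h : ∀ r r' : E × ℝ, _root_.dirDeriv r (_root_.dirDeriv r' G) (v, z)
      = fderiv ℝ (fderiv ℝ G) (v, z) r r' := fun r r' => by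
    have h3 := ((ContinuousLinearMap.apply ℝ ℝ r').hasFDerivAt.comp (v, z) h2.hasFDerivAt).fderiv
    have h4 := congrArg (fun A : E × ℝ →L[ℝ] ℝ => A r) h3
    exact h4
  rw [h, h]
  exact (hG v hv z hz).isSymmSndFDerivAt (by simpa using ENat.LEInfty.out) q q'

theorem hasDerivAt_line (hG : SmoothOffZero I G) (hz : z ∈ I) {w : E} {t : ℝ} (hv : v + t • w ≠ 0) :
    HasDerivAt (fun s : ℝ => G (v + s • w, z)) (_root_.dirDeriv (w, 0) G (v + t • w, z)) t := by
  have := hasDerivAt_comp_line (f := G) (a := (v, z)) (v := (w, 0)) (t := t)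
    (by simpa using hG.differentiableAt hv hz)
  simpa [_root_.dirDeriv] using this

theorem sum {ι : Type*} [Fintype ι] {F : ι → E × ℝ → ℝ} (hF : ∀ i, SmoothOffZero I (F i)) :
    SmoothOffZero I (fun p => ∑ i, F i p) :=
  fun v hv z hz => ContDiffAt.sum fun i _ => hF i v hv z hz

end SmoothOffZero

theorem dirDeriv_fun_sum {ι : Type*} [Fintype ι] {F : ι → E × ℝ → ℝ}
    (hF : ∀ i, SmoothOffZero I (F i)) (hv : v ≠ 0) (hz : z ∈ I) (q : E × ℝ) :
    dirDeriv q (fun p => ∑ i, F i p) (v, z) = ∑ i, dirDeriv q (F i) (v, z) := by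
  simp only [dirDeriv]
  rw [fderiv_fun_sum fun i _ => (hF i).differentiableAt hv hz]
  simp

theorem dirDeriv_congr (hI : IsOpen I) {F : E × ℝ → ℝ} (h : ∀ v, v ≠ 0 → ∀ z ∈ I, F (v, z) = G (v, z))
    (hv : v ≠ 0) (hz : z ∈ I) (q : E × ℝ) : dirDeriv q F (v, z) = dirDeriv q G (v, z) := by
  have : F =ᶠ[𝓝 (v, z)] G := by
    filter_upwards [(isOpen_compl_singleton.prod hI).mem_nhds (⟨hv, hz⟩ : (v, z) ∈ ({0}ᶜ : Set E) ×ˢ I)]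
      with p hp
    exact h p.1 hp.1 p.2 hp.2
  rw [dirDeriv, dirDeriv, this.fderiv_eq]

namespace IsPosHomog

theorem dirDeriv_self {k : ℤ} (hh : IsPosHomog I k G) (hG : SmoothOffZero I G) (hv : v ≠ 0)
    (hz : z ∈ I) : dirDeriv (v, 0) G (v, z) = k * G (v, z) := by
  have h1 : HasDerivAt (fun s : ℝ => G (v + s • v, z)) (_root_.dirDeriv (v, 0) G (v, z)) 0 := by
    simpa using hG.hasDerivAt_line (v := v) (w := v) (t := 0) hz (by simpa using hv)
  have h2 : HasDerivAt (fun s : ℝ => (1 + s) ^ k * G (v, z)) (k * G (v, z)) 0 := by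
    have h := (hasDerivAt_zpow k (1 + 0 : ℝ) (Or.inl (by norm_num))).comp (0 : ℝ)
      ((hasDerivAt_id (0 : ℝ)).const_add 1)
    simpa using h.mul_const (G (v, z))
  refine h1.unique (h2.congr_of_eventuallyEq ?_)
  filter_upwards [lt_mem_nhds (show (-1 : ℝ) < 0 by norm_num)] with s hs
  rw [show v + s • v = (1 + s) • v by module]
  exact hh _ (by linarith) v hv z hz

theorem dirDeriv {k : ℤ} (hh : IsPosHomog I k G) (hG : SmoothOffZero I G) (w : E) :
    IsPosHomog I (k - 1) (dirDeriv (w, 0) G) := by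
  intro t ht v hv z hz
  have htv : t • v ≠ 0 := smul_ne_zero ht.ne' hv
  have h1 : HasDerivAt (fun s : ℝ => G (t • v + s • (t • w), z))
      (t * _root_.dirDeriv (w, 0) G (t • v, z)) 0 := by
    rw [← dirDeriv_smul]
    simpa using hG.hasDerivAt_line (v := t • v) (w := t • w) (t := 0) hz (by simpa using htv)
  have h2 : HasDerivAt (fun s : ℝ => t ^ k * G (v + s • w, z))
      (t ^ k * _root_.dirDeriv (w, 0) G (v, z)) 0 := by
    simpa using (hG.hasDerivAt_line (v := v) (w := w) (t := 0) hz (by simpa using hv)).const_mul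
      (t ^ k)
  have h3 := h1.unique (h2.congr_of_eventuallyEq (by
    filter_upwards [OvaloidFamily.eventually_ne_zero hv w] with s hs
    rw [show t • v + s • t • w = t • (v + s • w) by module]
    exact hh t ht _ hs z hz))
  rw [zpow_sub_one₀ ht.ne']
  field_simp
  linarith

end IsPosHomog

/-- The Laplacian in the first variable. -/
noncomputable def horizLaplacian {ι : Type*} [Fintype ι] (b : OrthonormalBasis ι ℝ E)
    (G : E × ℝ → ℝ) (p : E × ℝ) : ℝ :=
  ∑ i, dirDeriv (b i, 0) (dirDeriv (b i, 0) G) p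

variable {ι : Type*} [Fintype ι] (b : OrthonormalBasis ι ℝ E)

theorem SmoothOffZero.horizLaplacian (hG : SmoothOffZero I G) :
    SmoothOffZero I (horizLaplacian b G) :=
  SmoothOffZero.sum fun i => (hG.dirDeriv (b i, 0)).dirDeriv (b i, 0)

theorem dirDeriv_horizLaplacian (hI : IsOpen I) (hG : SmoothOffZero I G) (hv : v ≠ 0) (hz : z ∈ I)
    (q : E × ℝ) : dirDeriv q (horizLaplacian b G) (v, z) = horizLaplacian b (dirDeriv q G) (v, z) := by
  have h := dirDeriv_fun_sum (fun i => (hG.dirDeriv (b i, 0)).dirDeriv (b i, 0)) hv hz q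
  refine h.trans (Finset.sum_congr rfl fun i _ => ?_)
  rw [(hG.dirDeriv (b i, 0)).dirDeriv_comm hv hz]
  exact dirDeriv_congr hI (fun v hv z hz => hG.dirDeriv_comm hv hz q (b i, 0)) hv hz (b i, 0)

theorem IsPosHomog.horizLaplacian {k : ℤ} (hh : IsPosHomog I k G) (hG : SmoothOffZero I G) :
    IsPosHomog I (k - 1 - 1) (horizLaplacian b G) := by
  intro t ht v hv z hz
  simp only [_root_.horizLaplacian]
  rw [Finset.mul_sum]
  exact Finset.sum_congr rfl fun i _ =>
    (hh.dirDeriv hG (b i)).dirDeriv (hG.dirDeriv (b i, 0)) (b i) t ht v hv z hz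

/-- If a product of two functions is additive, then its Laplacian vanishes. -/
theorem horizLaplacian_mul_eq_zero {F : E × ℝ → ℝ} (hF : SmoothOffZero I F) (hG : SmoothOffZero I G)
    (hv : v ≠ 0) (hz : z ∈ I)
    (hadd : ∀ x y : E, x ≠ 0 → y ≠ 0 → x + y ≠ 0 →
      F (x + y, z) * G (x + y, z) = F (x, z) * G (x, z) + F (y, z) * G (y, z)) :
    horizLaplacian b F (v, z) * G (v, z)
      + 2 * ∑ i, dirDeriv (b i, 0) F (v, z) * dirDeriv (b i, 0) G (v, z)
      + F (v, z) * horizLaplacian b G (v, z) = 0 := by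
  have hi : ∀ w : E, dirDeriv (w, 0) (dirDeriv (w, 0) F) (v, z) * G (v, z)
      + 2 * (dirDeriv (w, 0) F (v, z) * dirDeriv (w, 0) G (v, z))
      + F (v, z) * dirDeriv (w, 0) (dirDeriv (w, 0) G) (v, z) = 0 := by
    intro w
    set f : ℝ → ℝ := fun t => F (v + t • w, z) * G (v + t • w, z) with hf
    set f' : ℝ → ℝ := fun t => dirDeriv (w, 0) F (v + t • w, z) * G (v + t • w, z)
      + F (v + t • w, z) * dirDeriv (w, 0) G (v + t • w, z) with hf'
    have hne := OvaloidFamily.eventually_ne_zero hv w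
    have hne' : ∀ᶠ t : ℝ in 𝓝 0, v + (-t) • w ≠ 0 := by
      simpa using OvaloidFamily.eventually_ne_zero hv (-w)
    have hd : ∀ t : ℝ, v + t • w ≠ 0 → HasDerivAt f (f' t) t := fun t ht =>
      (hF.hasDerivAt_line hz ht).mul (hG.hasDerivAt_line hz ht)
    have hv0 : v + (0 : ℝ) • w ≠ 0 := by simpa using hv
    have hd2 : HasDerivAt f' (dirDeriv (w, 0) (dirDeriv (w, 0) F) (v, z) * G (v, z)
      + 2 * (dirDeriv (w, 0) F (v, z) * dirDeriv (w, 0) G (v, z))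
      + F (v, z) * dirDeriv (w, 0) (dirDeriv (w, 0) G) (v, z)) 0 := by
      have h := (((hF.dirDeriv (w, 0)).hasDerivAt_line hz hv0).mul (hG.hasDerivAt_line hz hv0)).add
        ((hF.hasDerivAt_line hz hv0).mul ((hG.dirDeriv (w, 0)).hasDerivAt_line hz hv0))
      refine h.congr_deriv ?_
      simp only [zero_smul, add_zero]
      ring
    -- The points v + tw and v - tw have the fixed sum 2v. Hence f(t) + f(-t) is constant near 0 and
    -- f''(0) = 0.
    have hsymm : (fun t => f t + f (-t)) =ᶠ[𝓝 0] fun _ => F (v + v, z) * G (v + v, z) := by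
      filter_upwards [hne, hne'] with t h1 h2
      have h3 : v + t • w + (v + (-t) • w) = v + v := by module
      have h4 := hadd _ _ h1 h2 (by rw [h3, ← two_smul ℝ]; exact smul_ne_zero two_ne_zero hv)
      rw [h3] at h4
      exact h4.symm
    have hodd : (fun t => f' t - f' (-t)) =ᶠ[𝓝 0] fun _ => 0 := by
      filter_upwards [hne, hne', hsymm.eventuallyEq_nhds] with t h1 h2 h3
      have h4 := (hd t h1).add ((hd (-t) h2).comp t (hasDerivAt_neg t))
      have h5 := h4.unique ((hasDerivAt_const t _).congr_of_eventuallyEq h3)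
      linarith
    have hd2' := hd2
    rw [← neg_zero] at hd2'
    have h6 := (hd2.sub (hd2'.comp (0 : ℝ) (hasDerivAt_neg 0))).unique
      ((hasDerivAt_const (0 : ℝ) _).congr_of_eventuallyEq hodd)
    simp only [neg_zero] at h6
    linarith
  have h := Finset.sum_eq_zero fun i (_ : i ∈ Finset.univ) => hi (b i)
  rw [Finset.sum_add_distrib, Finset.sum_add_distrib, ← Finset.sum_mul, ← Finset.mul_sum,
    ← Finset.mul_sum] at h
  exact h

end Directional

/-! ### Calculus on the sphere through extensions -/

section SphereCalculus

variable {E : Type*} [NormedAddCommGroup E] [InnerProductSpace ℝ E]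

theorem hasFDerivAt_norm_of_norm_one {u : E} (hu : ‖u‖ = 1) :
    HasFDerivAt (fun x : E => ‖x‖) (innerSL ℝ u) u := by
  have hu0 : u ≠ 0 := by rintro rfl; simp at hu
  have h1 : HasFDerivAt (fun x : E => ‖x‖) (fderiv ℝ (fun x : E => ‖x‖) u) u :=
    (differentiableAt_id.norm ℝ hu0).hasFDerivAt
  have h2 := (hasStrictFDerivAt_norm_sq u).hasFDerivAt.unique (h1.pow 2)
  have h3 : fderiv ℝ (fun x : E => ‖x‖) u = innerSL ℝ u := by
    ext ξ
    have := congrArg (fun A : E →L[ℝ] ℝ => A ξ) h2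
    simp [hu] at this
    simpa using this.symm
  rwa [h3] at h1

theorem hasFDerivAt_normalize {u : E} (hu : ‖u‖ = 1) :
    HasFDerivAt (fun x : E => ‖x‖⁻¹ • x)
      (ContinuousLinearMap.id ℝ E - (innerSL ℝ u).smulRight u) u := by
  have h1 := (hasDerivAt_inv (x := ‖u‖) (by rw [hu]; norm_num)).comp_hasFDerivAt u
    (hasFDerivAt_norm_of_norm_one hu)
  refine (h1.smul (hasFDerivAt_id u)).congr_fderiv ?_
  ext ξ
  simp [hu, sub_eq_add_neg]

variable {A : Type*} [NormedAddCommGroup A] [NormedSpace ℝ A]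

/-- The radial extension is G composed with normalization, whose derivative at u is the projection
onto u^⊥. Spherical derivatives may thus be computed from any differentiable extension. -/
theorem fderiv_radialExt {f G : E → A} (hfG : ∀ x, ‖x‖ = 1 → f x = G x) {u : E} (hu : ‖u‖ = 1)
    (hG : DifferentiableAt ℝ G u) (ξ : E) :
    fderiv ℝ (radialExt f) u ξ = fderiv ℝ G u (ξ - ⟪u, ξ⟫_ℝ • u) := by
  have hu0 : u ≠ 0 := by rintro rfl; simp at hu
  have hev : radialExt f =ᶠ[𝓝 u] fun x => G (‖x‖⁻¹ • x) := by
    filter_upwards [isOpen_compl_singleton.mem_nhds hu0] with x hx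
    refine hfG _ ?_
    rw [norm_smul, norm_inv, norm_norm, inv_mul_cancel₀ (norm_ne_zero_iff.2 hx)]
  have hG' : HasFDerivAt G (fderiv ℝ G u) (‖u‖⁻¹ • u) := by
    rw [hu, inv_one, one_smul]
    exact hG.hasFDerivAt
  have h : HasFDerivAt (fun x : E => G (‖x‖⁻¹ • x)) _ u :=
    HasFDerivAt.comp (g := G) (f := fun x : E => ‖x‖⁻¹ • x) u hG' (hasFDerivAt_normalize hu)
  rw [hev.fderiv_eq, h.fderiv]
  simp

variable [CompleteSpace E]

theorem inner_sphGrad {f G : E → ℝ} (hfG : ∀ x, ‖x‖ = 1 → f x = G x) {u : E} (hu : ‖u‖ = 1)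
    (hG : DifferentiableAt ℝ G u) (w : E) :
    ⟪sphGrad f u, w⟫_ℝ = fderiv ℝ G u (w - ⟪u, w⟫_ℝ • u) := by
  rw [sphGrad, inner_gradient, fderiv_radialExt hfG hu hG]

theorem inner_sphCov {Y Z : E → E} (hYZ : ∀ x, ‖x‖ = 1 → Y x = Z x) {u : E} (hu : ‖u‖ = 1)
    (hZ : DifferentiableAt ℝ Z u) (ξ w : E) :
    ⟪sphCov Y u ξ, w⟫_ℝ = ⟪fderiv ℝ Z u (ξ - ⟪u, ξ⟫_ℝ • u), w - ⟪u, w⟫_ℝ • u⟫_ℝ := by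
  rw [sphCov, ContinuousLinearMap.comp_apply, Submodule.inner_starProjection_left_eq_right,
    fderiv_radialExt hYZ hu hZ, Submodule.starProjection_orthogonal_val,
    Submodule.starProjection_unit_singleton ℝ hu]

/-! ### Smooth functions that are homogeneous of degree one -/

variable {I : Set ℝ} {g : E × ℝ → ℝ} {u : E} {z : ℝ}

theorem inner_sphGrad_of_smoothOffZero {G : E × ℝ → ℝ} (hG : SmoothOffZero I G) (hz : z ∈ I)
    {f : E → ℝ} (hf : ∀ x, ‖x‖ = 1 → f x = G (x, z)) (hu : ‖u‖ = 1) (w : E) :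
    ⟪sphGrad f u, w⟫_ℝ = dirDeriv (w - ⟪u, w⟫_ℝ • u, 0) G (u, z) := by
  have hu0 : u ≠ 0 := by rintro rfl; simp at hu
  have h : HasFDerivAt (fun x => G (x, z)) (fderiv ℝ G (u, z) ∘L ContinuousLinearMap.inl ℝ E ℝ) u :=
    HasFDerivAt.comp (g := G) (f := fun x : E => (x, z)) u
      (hG.differentiableAt hu0 hz).hasFDerivAt (hasFDerivAt_prodMk_left u z)
  rw [inner_sphGrad hf hu h.differentiableAt, h.fderiv]
  rfl

variable {ι : Type*} [Fintype ι]

/-- The spherical Hessian of the restriction of a function of degree one is its Euclidean Hessian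
minus its value times the metric of the tangent space. -/
theorem inner_sphCov_sphGrad (b : OrthonormalBasis ι ℝ E) (hg : SmoothOffZero I g) (hh : IsPosHomog I 1 g)
    (hz : z ∈ I) {f : E → ℝ} (hf : ∀ x, ‖x‖ = 1 → f x = g (x, z)) (hu : ‖u‖ = 1) (ξ w : E) :
    ⟪sphCov (sphGrad f) u ξ, w⟫_ℝ = dirDeriv (ξ, 0) (dirDeriv (w, 0) g) (u, z)
      - g (u, z) * (⟪ξ, w⟫_ℝ - ⟪u, ξ⟫_ℝ * ⟪u, w⟫_ℝ) := by
  have hne : ∀ x : E, ‖x‖ = 1 → x ≠ 0 := by rintro _ h rfl; simp at h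
  have hu0 := hne u hu
  have huu : ⟪u, u⟫_ℝ = 1 := by rw [real_inner_self_eq_norm_sq, hu]; norm_num
  -- By Euler's relation the tangential part of the Euclidean gradient on the sphere is ∇g - g x,
  -- which is an ambient field that can be differentiated.
  set Z : E → E := fun x => (∑ i, dirDeriv (b i, 0) g (x, z) • b i) - g (x, z) • x with hZ
  have hYZ : ∀ x, ‖x‖ = 1 → sphGrad f x = Z x := fun x hx => by
    refine ext_inner_right ℝ fun y => ?_
    rw [inner_sphGrad_of_smoothOffZero hg hz hf hx, dirDeriv_sub_smul, hh.dirDeriv_self hg (hne x hx) hz, hZ]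
    simp only [inner_sub_left, sum_inner, inner_smul_left, conj_trivial]
    rw [← dirDeriv_sum b y]
    simp only [Int.cast_one, one_mul]
    congr 1
    · exact Finset.sum_congr rfl fun i _ => mul_comm _ _
    · ring
  have hD : ∀ {G : E × ℝ → ℝ}, SmoothOffZero I G →
      HasFDerivAt (fun x => G (x, z)) (fderiv ℝ G (u, z) ∘L ContinuousLinearMap.inl ℝ E ℝ) u :=
    fun {G} hG => HasFDerivAt.comp (g := G) (f := fun x : E => (x, z)) u
      (hG.differentiableAt hu0 hz).hasFDerivAt (hasFDerivAt_prodMk_left u z)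
  have hZd : HasFDerivAt Z ((∑ i, (fderiv ℝ (dirDeriv (b i, 0) g) (u, z) ∘L
      ContinuousLinearMap.inl ℝ E ℝ).smulRight (b i)) - (g (u, z) • ContinuousLinearMap.id ℝ E
      + (fderiv ℝ g (u, z) ∘L ContinuousLinearMap.inl ℝ E ℝ).smulRight u)) u :=
    (HasFDerivAt.fun_sum fun i _ => (hD (hg.dirDeriv (b i, 0))).smul_const (b i)).sub
      ((hD hg).smul (hasFDerivAt_id u))
  have hZf : ∀ η, fderiv ℝ Z u η = (∑ i, dirDeriv (η, 0) (dirDeriv (b i, 0) g) (u, z) • b i)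
      - (g (u, z) • η + dirDeriv (η, 0) g (u, z) • u) := fun η => by
    rw [hZd.fderiv]
    simp [dirDeriv]
  have hsym := fun q q' => hg.dirDeriv_comm hu0 hz q q'
  have hM : ∀ y : E, dirDeriv (u, 0) (dirDeriv (y, 0) g) (u, z) = 0 := fun y => by
    rw [(hh.dirDeriv hg y).dirDeriv_self (hg.dirDeriv _) hu0 hz]
    simp
  have hsum : ∀ η y : E, ∑ i, dirDeriv (η, 0) (dirDeriv (b i, 0) g) (u, z) * ⟪b i, y⟫_ℝ
      = dirDeriv (η, 0) (dirDeriv (y, 0) g) (u, z) := fun η y => by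
    rw [hsym, ← dirDeriv_sum b y]
    exact Finset.sum_congr rfl fun i _ => by rw [hsym, mul_comm]
  rw [inner_sphCov hYZ hu hZd.differentiableAt, hZf, inner_sub_left, sum_inner]
  simp only [inner_smul_left, inner_add_left, conj_trivial]
  rw [hsum, hsym, dirDeriv_sub_smul, hM, hsym, dirDeriv_sub_smul, hM]
  simp only [inner_sub_left, inner_sub_right, inner_smul_left, inner_smul_right, huu, conj_trivial]
  rw [real_inner_comm u ξ]
  ring

/-- Trace of the Hessian formula; the projection onto the tangent space has trace one less than the
dimension. -/
theorem sphLaplacian_eq (b : OrthonormalBasis ι ℝ E) (hg : SmoothOffZero I g) (hh : IsPosHomog I 1 g)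
    (hz : z ∈ I) {f : E → ℝ} (hf : ∀ x, ‖x‖ = 1 → f x = g (x, z)) (hu : ‖u‖ = 1) :
    sphLaplacian f u = horizLaplacian b g (u, z) - (Fintype.card ι - 1) * g (u, z) := by
  rw [sphLaplacian, sphDiv, LinearMap.trace_eq_sum_inner _ b]
  have h : ∀ i, ⟪b i, (sphCov (sphGrad f) u : E →ₗ[ℝ] E) (b i)⟫_ℝ
      = dirDeriv (b i, 0) (dirDeriv (b i, 0) g) (u, z)
        - g (u, z) * (1 - ⟪u, b i⟫_ℝ * ⟪b i, u⟫_ℝ) := fun i => by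
    rw [real_inner_comm, ContinuousLinearMap.coe_coe, inner_sphCov_sphGrad b hg hh hz hf hu]
    rw [real_inner_self_eq_norm_sq, b.norm_eq_one, real_inner_comm u (b i)]
    norm_num
  simp_rw [h]
  rw [Finset.sum_sub_distrib, ← Finset.mul_sum, Finset.sum_sub_distrib, b.sum_inner_mul_inner,
    real_inner_self_eq_norm_sq, hu, horizLaplacian]
  simp
  ring

end SphereCalculus

/-! ### The differential equations -/

section Equations

variable {d : ℕ} {I : Set ℝ} {g : Horiz d × ℝ → ℝ} {h : Horiz d → ℝ → ℝ} {u : Horiz d} {z : ℝ}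

theorem dz_eq_dirDeriv {G : Horiz d × ℝ → ℝ} (hI : IsOpen I) (hG : SmoothOffZero I G)
    {k : Horiz d → ℝ → ℝ} (hk : ∀ v, ‖v‖ = 1 → ∀ z ∈ I, k v z = G (v, z)) (hu : ‖u‖ = 1)
    (hz : z ∈ I) : dz k u z = dirDeriv (0, 1) G (u, z) := by
  have hu0 : u ≠ 0 := by rintro rfl; simp at hu
  have hev : k u =ᶠ[𝓝 z] fun t => G (u, t) := by
    filter_upwards [hI.mem_nhds hz] with t ht
    exact hk u hu t ht
  rw [dz, hev.deriv_eq]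
  exact (hasDerivAt_snd_line (hG.differentiableAt hu0 hz)).deriv

/-- The zeroth order term d · h exactly undoes the curvature correction, so the quantity in the
equations is a Euclidean Laplacian, homogeneous of degree -1. -/
theorem radiiSum_eq (hg : SmoothOffZero I g) (hh : IsPosHomog I 1 g)
    (hhg : ∀ v, ‖v‖ = 1 → ∀ z ∈ I, h v z = g (v, z)) (hu : ‖u‖ = 1) (hz : z ∈ I) :
    radiiSum h u z = horizLaplacian (EuclideanSpace.basisFun (Fin (d + 1)) ℝ) g (u, z) := by
  rw [radiiSum, sphLaplacian_eq (EuclideanSpace.basisFun (Fin (d + 1)) ℝ) hg hh hz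
    (fun x hx => hhg x hx z hz) hu, hhg u hu z hz]
  simp

theorem sphere_equations (hI : IsOpen I) (hg : SmoothOffZero I g) (hh : IsPosHomog I 1 g)
    (hhg : ∀ v, ‖v‖ = 1 → ∀ z ∈ I, h v z = g (v, z))
    (hadd : ∀ z ∈ I, ∀ w x y : Horiz d, x ≠ 0 → y ≠ 0 → x + y ≠ 0 →
      dirDeriv (0, 1) g (x + y, z) * dirDeriv (w, 0) g (x + y, z)
        = dirDeriv (0, 1) g (x, z) * dirDeriv (w, 0) g (x, z)
          + dirDeriv (0, 1) g (y, z) * dirDeriv (w, 0) g (y, z)) (hu : ‖u‖ = 1) (hz : z ∈ I) :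
    dz h u z • sphGrad (fun v => radiiSum h v z) u
        + dz (radiiSum h) u z • sphGrad (fun v => h v z) u
        + (2 : ℝ) • (h u z • sphGrad (fun v => dz h v z) u
            + sphCov (sphGrad (fun v => h v z)) u (sphGrad (fun v => dz h v z) u)) = 0 ∧
      h u z * dz (radiiSum h) u z - radiiSum h u z * dz h u z = 0 := by
  set b := EuclideanSpace.basisFun (Fin (d + 1)) ℝ with hb
  have hu0 : u ≠ 0 := by rintro rfl; simp at hu
  have huu : ⟪u, u⟫_ℝ = 1 := by rw [real_inner_self_eq_norm_sq, hu]; norm_num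
  have hL := hg.horizLaplacian b
  have hgz := hg.dirDeriv (0, 1)
  have hradii : ∀ v, ‖v‖ = 1 → ∀ z ∈ I, radiiSum h v z = horizLaplacian b g (v, z) :=
    fun v hv z hz => radiiSum_eq hg hh hhg hv hz
  have hdz : ∀ v, ‖v‖ = 1 → dz h v z = dirDeriv (0, 1) g (v, z) := fun v hv =>
    dz_eq_dirDeriv hI hg hhg hv hz
  have hdzL : dz (radiiSum h) u z = horizLaplacian b (dirDeriv (0, 1) g) (u, z) := by
    rw [dz_eq_dirDeriv hI hL hradii hu hz, dirDeriv_horizLaplacian b hI hg hu0 hz]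
  have hM : ∀ w : Horiz d, dirDeriv (u, 0) (dirDeriv (w, 0) g) (u, z) = 0 := fun w => by
    rw [(hh.dirDeriv hg w).dirDeriv_self (hg.dirDeriv _) hu0 hz]
    simp
  -- The vanishing Laplacian of the additive product. Both equations are this identity: the
  -- tangential part of w gives the first, and w = u the second.
  have hkey : ∀ w : Horiz d, horizLaplacian b (dirDeriv (0, 1) g) (u, z) * dirDeriv (w, 0) g (u, z)
      + 2 * ∑ i, dirDeriv (b i, 0) (dirDeriv (0, 1) g) (u, z)
        * dirDeriv (b i, 0) (dirDeriv (w, 0) g) (u, z)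
      + dirDeriv (0, 1) g (u, z) * dirDeriv (w, 0) (horizLaplacian b g) (u, z) = 0 := fun w => by
    rw [dirDeriv_horizLaplacian b hI hg hu0 hz]
    exact horizLaplacian_mul_eq_zero b hgz (hg.dirDeriv (w, 0)) hu0 hz (hadd z hz w)
  constructor
  · refine ext_inner_right ℝ fun w => ?_
    set σ := sphGrad (fun v => dz h v z) u with hσ
    have hσi : ∀ x, ⟪σ, x⟫_ℝ = dirDeriv (x - ⟪u, x⟫_ℝ • u, 0) (dirDeriv (0, 1) g) (u, z) := fun x =>
      inner_sphGrad_of_smoothOffZero hgz hz hdz hu x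
    have hσu : ⟪u, σ⟫_ℝ = 0 := by
      rw [real_inner_comm, hσi, huu, one_smul, sub_self]
      exact map_zero _
    have hsym := fun q q' => hg.dirDeriv_comm hu0 hz q q'
    -- The Hessian of g annihilates u, so replacing the full gradient of the height derivative by
    -- its tangential part σ, and w by its tangential part, changes nothing in the contraction.
    have hσM : dirDeriv (σ, 0) (dirDeriv (w, 0) g) (u, z)
        = ∑ i, dirDeriv (b i, 0) (dirDeriv (0, 1) g) (u, z)
          * dirDeriv (b i, 0) (dirDeriv (w - ⟪u, w⟫_ℝ • u, 0) g) (u, z) := by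
      have h1 : ∀ i, dirDeriv (b i, 0) (dirDeriv (w - ⟪u, w⟫_ℝ • u, 0) g) (u, z)
          = dirDeriv (b i, 0) (dirDeriv (w, 0) g) (u, z) := fun i => by
        rw [hsym, dirDeriv_sub_smul, hM, hsym]
        ring
      simp_rw [h1]
      rw [← dirDeriv_sum b σ]
      simp_rw [real_inner_comm σ, hσi, dirDeriv_sub_smul, sub_mul]
      rw [Finset.sum_sub_distrib, sub_eq_self]
      have h2 := dirDeriv_sum (G := dirDeriv (w, 0) g) b u (u, z)
      rw [hM] at h2
      calc _ = dirDeriv (u, 0) (dirDeriv (0, 1) g) (u, z)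
            * ∑ i, ⟪b i, u⟫_ℝ * dirDeriv (b i, 0) (dirDeriv (w, 0) g) (u, z) := by
            rw [Finset.mul_sum]
            refine Finset.sum_congr rfl fun i _ => ?_
            rw [real_inner_comm u (b i)]
            ring
        _ = 0 := by rw [h2, mul_zero]
    simp only [inner_add_left, inner_smul_left, conj_trivial, inner_zero_left]
    rw [inner_sphGrad_of_smoothOffZero hL hz (fun v hv => hradii v hv z hz) hu,
      inner_sphGrad_of_smoothOffZero hg hz (fun v hv => hhg v hv z hz) hu,
      inner_sphCov_sphGrad b hg hh hz (fun v hv => hhg v hv z hz) hu, hσu, hσM, hdzL, hdz u hu,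
      hhg u hu z hz]
    linear_combination hkey (w - ⟪u, w⟫_ℝ • u)
  -- For radial w the contraction vanishes, and Euler's relation in degrees 1 and -1 supplies the
  -- opposite signs of the two remaining terms.
  · have h1 := hkey u
    have h2 : ∀ i, dirDeriv (b i, 0) (dirDeriv (u, 0) g) (u, z) = 0 := fun i => by
      rw [hg.dirDeriv_comm hu0 hz, hM]
    simp_rw [h2] at h1
    rw [hh.dirDeriv_self hg hu0 hz,
      (hh.horizLaplacian b hg).dirDeriv_self hL hu0 hz] at h1
    rw [hdzL, hradii u hu z hz, hdz u hu, hhg u hu z hz]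
    norm_num at h1
    linear_combination h1

end Equations

/-! ### Most planes are transversal to a family of ovaloids -/

section Transversality

variable {E : Type*} [NormedAddCommGroup E] [InnerProductSpace ℝ E] [CompleteSpace E]
  [FiniteDimensional ℝ E] [Nontrivial E] {S : E × ℝ → E} {I : Set ℝ}

namespace OvaloidFamily

theorem isPosHomog_evenSupp : IsPosHomog I 1 (evenSupp S) := by
  intro t ht v _ z _
  simp only [evenSupp]
  rw [← smul_neg, suppFn_smul ht, suppFn_smul ht, zpow_one]
  ring

/-- The orthogonal complement of the tangent space of a slice is spanned by the normal. -/
theorem exists_eq_smul_of_inner_fderiv_eq_zero (hS : OvaloidFamily S I) {v x w : E} {z : ℝ}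
    (hv : v ≠ 0) (hx : x ≠ 0) (hz : z ∈ I) (hxv : S (x, z) = suppPt S (v, z))
    (hw : ∀ ξ, ⟪w, fderiv ℝ S (x, z) (ξ, 0)⟫_ℝ = 0) : ∃ r : ℝ, w = r • v := by
  set A : E →ₗ[ℝ] E := (fderiv ℝ S (x, z) ∘L ContinuousLinearMap.inl ℝ E ℝ).toLinearMap with hA
  have hA' : ∀ ξ, A ξ = fderiv ℝ S (x, z) (ξ, 0) := fun ξ => by simp [hA]
  have hker : LinearMap.ker A ≤ ℝ ∙ x := fun ξ hξ => by
    obtain ⟨r, rfl⟩ := hS.immersion x hx z hz ξ (by rw [← hA']; exact hξ)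
    exact Submodule.smul_mem _ _ (Submodule.mem_span_singleton_self x)
  have h1 := Submodule.finrank_mono hker
  rw [finrank_span_singleton hx] at h1
  have h2 := LinearMap.finrank_range_add_finrank_ker A
  have h3 := Submodule.finrank_add_finrank_orthogonal (LinearMap.range A)
  have h4 : ℝ ∙ v ≤ (LinearMap.range A)ᗮ := by
    rw [Submodule.span_singleton_le_iff_mem, Submodule.mem_orthogonal]
    rintro _ ⟨ξ, rfl⟩
    rw [hA', real_inner_comm]
    exact hS.inner_fderiv_eq_zero hx hz hxv ξ
  have h5 : ℝ ∙ v = (LinearMap.range A)ᗮ := by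
    refine Submodule.eq_of_le_of_finrank_le h4 ?_
    rw [finrank_span_singleton hv]
    omega
  have h6 : w ∈ ℝ ∙ v := by
    rw [h5, Submodule.mem_orthogonal]
    rintro _ ⟨ξ, rfl⟩
    rw [hA', real_inner_comm]
    exact hw ξ
  obtain ⟨r, hr⟩ := Submodule.mem_span_singleton.1 h6
  exact ⟨r, hr.symm⟩

/-- For a dense set of planes `z = a + ⟨w, y⟩`, the plane is nowhere tangent to the tube. -/
theorem dense_transversal [MeasurableSpace E] [BorelSpace E] (hS : OvaloidFamily S I) :
    Dense {p : E × ℝ | ∀ x, ‖x‖ = 1 → ∀ z ∈ I, z = p.2 + ⟪p.1, S (x, z)⟫_ℝ →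
      ∃ (ξ : E) (r : ℝ), r ≠ ⟪p.1, fderiv ℝ S (x, z) (ξ, r)⟫_ℝ} := by
  set Hz : E × ℝ → ℝ := fun q => fderiv ℝ (suppFn S) q (0, 1) with hHz
  -- If the plane z = a + ⟨w, y⟩ is tangent to the tube where the slice has normal v, then w = v/H_z
  -- and a = z - H/H_z. All tangent planes of this form are therefore values of Ψ.
  set Ψ : E × ℝ → E × ℝ := fun q => ((Hz q)⁻¹ • q.1, q.2 - (Hz q)⁻¹ * suppFn S q) with hΨ
  set U : Set (E × ℝ) := {q | q.1 ≠ 0 ∧ q.2 ∈ I ∧ Hz q ≠ 0} with hU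
  have hsm : ∀ v : E, v ≠ 0 → ∀ z ∈ I, ContDiffAt ℝ ∞ (suppFn S) (v, z) := fun v hv z hz =>
    hS.contDiffAt_suppFn hv hz
  have hHzsm : ∀ v : E, v ≠ 0 → ∀ z ∈ I, ContDiffAt ℝ ∞ Hz (v, z) := fun v hv z hz =>
    ((hsm v hv z hz).fderiv_right (m := ∞) (by simp)).clm_apply contDiffAt_const
  have hΨd : ∀ q ∈ U, HasFDerivAt Ψ (fderiv ℝ Ψ q) q := by
    rintro ⟨v, z⟩ ⟨hv, hz, h0⟩
    have h1 : DifferentiableAt ℝ Hz (v, z) := (hHzsm v hv z hz).differentiableAt (by simp)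
    have h2 : DifferentiableAt ℝ (suppFn S) (v, z) := (hsm v hv z hz).differentiableAt (by simp)
    have h3 : DifferentiableAt ℝ (fun q => (Hz q)⁻¹) (v, z) := h1.inv h0
    exact ((h3.smul differentiableAt_fst).prodMk
      (differentiableAt_snd.sub (h3.mul h2))).hasFDerivAt
  have hHzh : ∀ t : ℝ, 0 < t → ∀ v : E, v ≠ 0 → ∀ z ∈ I, Hz (t • v, z) = t * Hz (v, z) := by
    intro t ht v hv z hz
    have h1 : HasDerivAt (fun s : ℝ => suppFn S (t • v, s)) (Hz (t • v, z)) z :=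
      hasDerivAt_snd_line ((hsm _ (smul_ne_zero ht.ne' hv) z hz).differentiableAt (by simp))
    have h2 : HasDerivAt (fun s : ℝ => t * suppFn S (v, s)) (t * Hz (v, z)) z :=
      (hasDerivAt_snd_line ((hsm v hv z hz).differentiableAt (by simp))).const_mul t
    refine h1.unique (h2.congr_of_eventuallyEq (Eventually.of_forall fun s => ?_))
    exact suppFn_smul ht v s
  -- Ψ is constant along the rays of v, so its differential has a kernel everywhere and its image is
  -- null.
  have hdet : ∀ q ∈ U, (fderiv ℝ Ψ q).det = 0 := by
    rintro ⟨v, z⟩ ⟨hv, hz, h0⟩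
    have h1 : HasDerivAt (fun t : ℝ => Ψ (v + t • v, z)) (fderiv ℝ Ψ (v, z) (v, 0)) 0 :=
      hasDerivAt_fst_line (hΨd (v, z) ⟨hv, hz, h0⟩).differentiableAt v
    have h2 : (fun t : ℝ => Ψ (v + t • v, z)) =ᶠ[𝓝 0] fun _ => Ψ (v, z) := by
      filter_upwards [lt_mem_nhds (show (-1 : ℝ) < 0 by norm_num)] with t ht
      have ht' : 0 < 1 + t := by linarith
      rw [show v + t • v = (1 + t) • v by module]
      simp only [hΨ]
      rw [hHzh _ ht' v hv z hz, suppFn_smul ht', smul_smul]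
      congr 1
      · congr 1
        field_simp
      · congr 1
        field_simp
    have h3 : fderiv ℝ Ψ (v, z) (v, 0) = 0 :=
      h1.unique ((hasDerivAt_const _ _).congr_of_eventuallyEq h2)
    by_contra hne
    have h4 : Function.Injective (fderiv ℝ Ψ (v, z)) :=
      ((fderiv ℝ Ψ (v, z)).toContinuousLinearEquivOfDetNeZero hne).injective
    have h5 := h4 (h3.trans (map_zero _).symm)
    exact hv (congrArg Prod.fst h5)
  have : ProperSpace E := FiniteDimensional.proper ℝ E
  have hnull : (Measure.addHaar : Measure (E × ℝ)) (Ψ '' U) = 0 :=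
    addHaar_image_eq_zero_of_det_fderivWithin_eq_zero Measure.addHaar
      (fun q hq => (hΨd q hq).hasFDerivWithinAt) hdet
  have hae : ∀ᵐ p ∂(Measure.addHaar : Measure (E × ℝ)), p ∉ Ψ '' U := measure_eq_zero_iff_ae_notMem.1 hnull
  refine (Measure.dense_of_ae hae).mono ?_
  intro p hp x hx z hz hpz
  by_contra! hcon
  have hx0 : x ≠ 0 := by rintro rfl; simp at hx
  obtain ⟨v, hv, hxv⟩ := hS.exists_eq_suppPt hz (hS.mem_slice hx0 z)
  have hv0 : v ≠ 0 := by rintro rfl; simp at hv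
  -- Tangency makes w orthogonal to the slice, so w = r v; the height direction then gives r H_z =
  -- 1.
  obtain ⟨r, hr⟩ := hS.exists_eq_smul_of_inner_fderiv_eq_zero hv0 hx0 hz hxv
    (w := p.1) fun ξ => (hcon ξ 0).symm
  have h1 := hcon 0 1
  rw [hr, inner_smul_left, hS.inner_fderiv_height hv0 hx0 hz hxv] at h1
  have h2 : r * Hz (v, z) = 1 := h1.symm
  have h3 : Hz (v, z) ≠ 0 := right_ne_zero_of_mul (h2.trans_ne one_ne_zero)
  have h4 : r = (Hz (v, z))⁻¹ := eq_inv_of_mul_eq_one_left h2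
  refine hp ⟨(v, z), ⟨hv0, hz, h3⟩, ?_⟩
  refine Prod.ext ?_ ?_
  · simp only [hΨ]
    rw [hr, h4]
  · simp only [hΨ]
    rw [hr, hxv, inner_smul_left, h4] at hpz
    simp only [conj_trivial] at hpz
    simp only [suppFn]
    linarith

end OvaloidFamily

end Transversality

/-! ### Tubes as families of ovaloids -/

section Tube

variable {d : ℕ}

open Classical in
/-- The radial projection to the unit sphere. -/
noncomputable def toSphere (x : Horiz d) : USphere d :=
  if hx : x ≠ 0 then ⟨‖x‖⁻¹ • x, by simpa using norm_inv_norm_smul hx⟩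
  else ⟨EuclideanSpace.single 0 1, by simp⟩

theorem coe_toSphere {x : Horiz d} (hx : x ≠ 0) : (toSphere x : Horiz d) = ‖x‖⁻¹ • x := by
  rw [toSphere, dif_pos hx]

theorem toSphere_coe (u : USphere d) : toSphere (u : Horiz d) = u := by
  have hu : ‖(u : Horiz d)‖ = 1 := by simp
  ext1
  rw [coe_toSphere (by intro h; simp [h] at hu), hu, inv_one, one_smul]

theorem toSphere_smul {t : ℝ} (ht : 0 < t) (x : Horiz d) : toSphere (t • x) = toSphere x := by
  rcases eq_or_ne x 0 with rfl | hx
  · rw [smul_zero]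
  ext1
  rw [coe_toSphere hx, coe_toSphere (smul_ne_zero ht.ne' hx), norm_smul, Real.norm_of_nonneg ht.le,
    smul_smul]
  congr 1
  field_simp

theorem contMDiffAt_toSphere {x : Horiz d} (hx : x ≠ 0) :
    ContMDiffAt 𝓘(ℝ, Horiz d) (𝓡 d) ∞ (toSphere (d := d)) x := by
  set U : TopologicalSpace.Opens (Horiz d) := ⟨{0}ᶜ, isOpen_compl_singleton⟩ with hU
  have hf : ContMDiff 𝓘(ℝ, Horiz d) 𝓘(ℝ, Horiz d) ∞ fun y : U => ‖(y : Horiz d)‖⁻¹ • (y : Horiz d) := by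
    intro y
    have hy : (y : Horiz d) ≠ 0 := y.2
    refine (contMDiffAt_subtype_iff (f := fun y : Horiz d => ‖y‖⁻¹ • y)).2 ?_
    have h1 : ContDiffAt ℝ ∞ (fun y : Horiz d => ‖y‖) (y : Horiz d) := contDiffAt_norm ℝ hy
    exact ((h1.inv (norm_ne_zero_iff.2 hy)).smul contDiffAt_id).contMDiffAt
  have hmem : ∀ y : U, ‖(y : Horiz d)‖⁻¹ • (y : Horiz d) ∈ Metric.sphere (0 : Horiz d) 1 :=
    fun y => by simpa using norm_inv_norm_smul y.2
  have h2 : ContMDiff 𝓘(ℝ, Horiz d) (𝓡 d) ∞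
      (Set.codRestrict (fun y : U => ‖(y : Horiz d)‖⁻¹ • (y : Horiz d)) _ hmem : U → USphere d) := by
    have := Fact.mk (@finrank_euclideanSpace_fin ℝ _ (d + 1))
    exact hf.codRestrict_sphere hmem
  have h3 : (Set.codRestrict (fun y : U => ‖(y : Horiz d)‖⁻¹ • (y : Horiz d)) _ hmem : U → USphere d)
      = fun y : U => toSphere (y : Horiz d) := by
    funext y
    ext1
    exact (coe_toSphere y.2).symm
  rw [h3] at h2
  exact contMDiffAt_subtype_iff.1 (h2 ⟨x, hx⟩)

theorem contMDiff_coe_usphere :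
    ContMDiff (𝓡 d) 𝓘(ℝ, Horiz d) ∞ (fun u : USphere d => (u : Horiz d)) := by
  have := Fact.mk (@finrank_euclideanSpace_fin ℝ _ (d + 1))
  exact contMDiff_coe_sphere

theorem mvfderiv_apply_mfderiv {F V B H M : Type*} [NormedAddCommGroup F] [NormedSpace ℝ F]
    [NormedAddCommGroup V] [NormedSpace ℝ V] [NormedAddCommGroup B] [NormedSpace ℝ B]
    [TopologicalSpace H] {J : ModelWithCorners ℝ B H} [TopologicalSpace M] [ChartedSpace H M]
    {φ : F → M} {G : M → V} {x : F} (hG : MDifferentiableAt J 𝓘(ℝ, V) G (φ x))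
    (hφ : MDifferentiableAt 𝓘(ℝ, F) J φ x) {A : F →L[ℝ] V}
    (hA : HasFDerivAt (fun y => G (φ y)) A x) (q : F) :
    mvfderiv J G (φ x) (mfderiv 𝓘(ℝ, F) J φ x q) = A q := by
  have h := mfderiv_comp_apply x hG hφ q
  rw [mfderiv_eq_fderiv, show G ∘ φ = fun y => G (φ y) from rfl, hA.fderiv] at h
  exact h.symm

theorem hasFDerivAt_toLp {F A B : Type*} [NormedAddCommGroup F] [NormedSpace ℝ F]
    [NormedAddCommGroup A] [NormedSpace ℝ A] [NormedAddCommGroup B] [NormedSpace ℝ B]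
    {f : F → A} {g : F → B} {f' : F →L[ℝ] A} {g' : F →L[ℝ] B} {x : F} (hf : HasFDerivAt f f' x)
    (hg : HasFDerivAt g g' x) : HasFDerivAt (fun x => WithLp.toLp 2 (f x, g x))
      ((WithLp.prodContinuousLinearEquiv 2 ℝ A B).symm.toContinuousLinearMap ∘L f'.prod g') x :=
  (WithLp.prodContinuousLinearEquiv 2 ℝ A B).symm.toContinuousLinearMap.hasFDerivAt.comp x
    (hf.prodMk hg)

/-- The map `(x, z) ↦ (x / |x|, z)`. -/
noncomputable def toSphereProd (p : Horiz d × ℝ) : USphere d × ℝ := (toSphere p.1, p.2)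

theorem contMDiffAt_toSphereProd {x : Horiz d} (hx : x ≠ 0) (z : ℝ) :
    ContMDiffAt 𝓘(ℝ, Horiz d × ℝ) (tubeModel d) ∞ (toSphereProd (d := d)) (x, z) := by
  have h1 : ContMDiffAt 𝓘(ℝ, Horiz d × ℝ) (𝓡 d) ∞ (fun p : Horiz d × ℝ => toSphere p.1) (x, z) :=
    ContMDiffAt.comp (g := toSphere (d := d)) (f := Prod.fst) (x, z) (contMDiffAt_toSphere hx)
      contDiff_fst.contMDiff.contMDiffAt
  exact h1.prodMk contDiff_snd.contMDiff.contMDiffAt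

/-- Rescale to a unit vector, where the differential of normalization is an orthogonal projection
with radial kernel. -/
theorem fderiv_toSphere_eq_zero {x : Horiz d} (hx : x ≠ 0) {ξ : Horiz d}
    (h : fderiv ℝ (fun y : Horiz d => ‖y‖⁻¹ • y) x ξ = 0) : ∃ r : ℝ, ξ = r • x := by
  set t := ‖x‖ with ht
  have ht0 : 0 < t := norm_pos_iff.2 hx
  have hu : ‖t⁻¹ • x‖ = 1 := norm_inv_norm_smul hx
  have h1 : HasFDerivAt (fun y : Horiz d => t⁻¹ • y) (t⁻¹ • ContinuousLinearMap.id ℝ (Horiz d)) x :=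
    (hasFDerivAt_id x).const_smul t⁻¹
  have h2 := HasFDerivAt.comp (g := fun y : Horiz d => ‖y‖⁻¹ • y) (f := fun y : Horiz d => t⁻¹ • y) x
    (hasFDerivAt_normalize hu) h1
  have h3 : (fun y : Horiz d => ‖y‖⁻¹ • y) ∘ (fun y : Horiz d => t⁻¹ • y)
      = fun y : Horiz d => ‖y‖⁻¹ • y := by
    funext y
    simp only [Function.comp]
    rcases eq_or_ne y 0 with rfl | hy
    · simp
    rw [norm_smul, norm_inv, Real.norm_of_nonneg ht0.le, smul_smul]
    congr 1
    field_simp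
  rw [h3] at h2
  rw [h2.fderiv] at h
  simp only [ContinuousLinearMap.comp_apply, smul_apply, sub_apply, ContinuousLinearMap.id_apply,
    ContinuousLinearMap.smulRight_apply, innerSL_apply_apply] at h
  refine ⟨⟪t⁻¹ • x, t⁻¹ • ξ⟫_ℝ, ?_⟩
  have h4 := congrArg (fun y => t • y) (sub_eq_zero.1 h)
  simp only [smul_smul, mul_inv_cancel₀ ht0.ne', one_smul] at h4
  conv_lhs => rw [h4]
  congr 1
  rw [mul_comm _ t⁻¹, mul_inv_cancel_left₀ ht0.ne']

variable (c : ℝ → Horiz d) (α : USphere d → ℝ → Horiz d)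

/-- The tube in homogeneous coordinates. -/
noncomputable def tubeFn (p : Horiz d × ℝ) : Horiz d := c p.2 + α (toSphere p.1) p.2

variable {c α}

namespace IsTransverselyConvexTube

theorem contMDiffAt_shape (ht : IsTransverselyConvexTube c α) {p : USphere d × ℝ}
    (hp : p ∈ tubeDomain d) :
    ContMDiffAt (tubeModel d) 𝓘(ℝ, Horiz d) ∞ (fun p : USphere d × ℝ => α p.1 p.2) p :=
  ht.smooth_shape.contMDiffAt ((isOpen_univ.prod isOpen_Ioo).mem_nhds hp)

theorem contMDiffAt_tubeMap (ht : IsTransverselyConvexTube c α) {p : USphere d × ℝ}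
    (hp : p ∈ tubeDomain d) :
    ContMDiffAt (tubeModel d) 𝓘(ℝ, Ambient d) ∞ (tubeMap c α) p := by
  have h1 : ContMDiffAt (tubeModel d) 𝓘(ℝ, Horiz d) ∞ (fun p : USphere d × ℝ => c p.2) p :=
    ContMDiffAt.comp (g := c) (f := Prod.snd) p
      (ht.smooth_center.contDiffAt (isOpen_Ioo.mem_nhds hp.2)).contMDiffAt contMDiffAt_snd
  have h2 := (h1.add (ht.contMDiffAt_shape hp)).prodMk_space
    (contMDiffAt_snd (I := 𝓡 d) (J := 𝓘(ℝ, ℝ)) (p := p) (n := ∞))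
  exact ((WithLp.prodContinuousLinearEquiv 2 ℝ (Horiz d) ℝ).symm.contDiff.contMDiff.contMDiffAt).comp
    p h2

theorem contDiffAt_tubeFn (ht : IsTransverselyConvexTube c α) {x : Horiz d} (hx : x ≠ 0) {z : ℝ}
    (hz : z ∈ Ioo (-1 : ℝ) 1) : ContDiffAt ℝ ∞ (tubeFn c α) (x, z) := by
  have h1 : ContDiffAt ℝ ∞ (fun p : Horiz d × ℝ => c p.2) (x, z) :=
    ContDiffAt.comp (g := c) (f := Prod.snd) (x, z)
      (ht.smooth_center.contDiffAt (isOpen_Ioo.mem_nhds hz)) contDiffAt_snd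
  have h2 : ContMDiffAt 𝓘(ℝ, Horiz d × ℝ) 𝓘(ℝ, Horiz d) ∞
      (fun p : Horiz d × ℝ => α (toSphere p.1) p.2) (x, z) :=
    ContMDiffAt.comp (g := fun p : USphere d × ℝ => α p.1 p.2) (f := toSphereProd (d := d)) (x, z)
      (ht.contMDiffAt_shape ⟨mem_univ _, hz⟩) (contMDiffAt_toSphereProd hx z)
  exact h1.add (contMDiffAt_iff_contDiffAt.1 h2)

/-- The chain rule through the radial projection, translating hypotheses on the manifold
differential of X into statements about the homogeneous function on E × ℝ. -/
theorem mvfderiv_tubeMap (ht : IsTransverselyConvexTube c α) {x : Horiz d} (hx : x ≠ 0) {z : ℝ}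
    (hz : z ∈ Ioo (-1 : ℝ) 1) (q : Horiz d × ℝ) :
    mvfderiv (tubeModel d) (tubeMap c α) (toSphereProd (x, z))
      (mfderiv 𝓘(ℝ, Horiz d × ℝ) (tubeModel d) (toSphereProd (d := d)) (x, z) q)
      = WithLp.toLp 2 (fderiv ℝ (tubeFn c α) (x, z) q, q.2) := by
  have h1 : MDifferentiableAt (tubeModel d) 𝓘(ℝ, Ambient d) (tubeMap c α) (toSphereProd (x, z)) :=
    (ht.contMDiffAt_tubeMap (p := toSphereProd (x, z)) ⟨mem_univ _, hz⟩).mdifferentiableAt (by simp)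
  have h2 : MDifferentiableAt 𝓘(ℝ, Horiz d × ℝ) (tubeModel d) (toSphereProd (d := d)) (x, z) :=
    (contMDiffAt_toSphereProd hx z).mdifferentiableAt (by simp)
  exact mvfderiv_apply_mfderiv h1 h2
    (hasFDerivAt_toLp ((ht.contDiffAt_tubeFn hx hz).differentiableAt (by simp)).hasFDerivAt
      hasFDerivAt_snd) q

theorem slice_tubeFn (z : ℝ) : slice (tubeFn c α) z = (fun y => c z + y) '' range fun u => α u z := by
  ext y
  constructor
  · rintro ⟨x, -, rfl⟩
    exact ⟨_, ⟨toSphere x, rfl⟩, rfl⟩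
  · rintro ⟨_, ⟨u, rfl⟩, rfl⟩
    refine ⟨u, u.2, ?_⟩
    simp only [tubeFn, toSphere_coe]

theorem crossSection_tube {z : ℝ} (hz : z ∈ Ioo (-1 : ℝ) 1) :
    crossSection (tube c α) z = slice (tubeFn c α) z := by
  rw [slice_tubeFn]
  ext y
  constructor
  · rintro ⟨⟨u, t⟩, -, h⟩
    have h' := congrArg WithLp.ofLp h
    simp only [tubeMap, Prod.mk.injEq] at h'
    obtain ⟨h1, rfl⟩ := h'
    exact ⟨_, ⟨u, rfl⟩, h1⟩
  · rintro ⟨_, ⟨u, rfl⟩, rfl⟩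
    exact ⟨(u, z), ⟨mem_univ _, hz⟩, rfl⟩

theorem ovaloidFamily (ht : IsTransverselyConvexTube c α) :
    OvaloidFamily (tubeFn c α) (Ioo (-1 : ℝ) 1) where
  isOpen := isOpen_Ioo
  smooth := fun p hp => (ht.contDiffAt_tubeFn hp.1 hp.2).contDiffWithinAt
  homog := fun t ht x z => by simp only [tubeFn, toSphere_smul ht]
  immersion := fun x hx z hz ξ h => by
    have h1 := ht.mvfderiv_tubeMap hx hz (ξ, 0)
    rw [h] at h1
    -- As X is an immersion, the differential of the radial projection kills (ξ, 0). Composing with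
    -- the inclusion of the sphere makes ξ radial.
    have h2 := ht.immersion (toSphereProd (x, z)) ⟨mem_univ _, hz⟩
      (h1.trans (map_zero _).symm : _ = mvfderiv (tubeModel d) (tubeMap c α) (toSphereProd (x, z)) 0)
    have h3 : MDifferentiableAt 𝓘(ℝ, Horiz d × ℝ) (tubeModel d) (toSphereProd (d := d)) (x, z) :=
      (contMDiffAt_toSphereProd hx z).mdifferentiableAt (by simp)
    have h4 : MDifferentiableAt (tubeModel d) 𝓘(ℝ, Horiz d)
        (fun p : USphere d × ℝ => (p.1 : Horiz d)) (toSphereProd (x, z)) :=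
      (contMDiff_coe_usphere.contMDiffAt.comp _ contMDiffAt_fst).mdifferentiableAt
        (by simp)
    have h5 := mfderiv_comp_apply (x, z) h4 h3 (ξ, 0)
    rw [h2, mfderiv_eq_fderiv] at h5
    have hN : DifferentiableAt ℝ (fun y : Horiz d => ‖y‖⁻¹ • y) x :=
      ((contDiffAt_norm ℝ hx (n := 1)).differentiableAt (by simp)).inv (norm_ne_zero_iff.2 hx) |>.smul
        differentiableAt_id
    have h6 : HasFDerivAt ((fun p : USphere d × ℝ => (p.1 : Horiz d)) ∘ toSphereProd (d := d))
        (fderiv ℝ (fun y : Horiz d => ‖y‖⁻¹ • y) x ∘L ContinuousLinearMap.fst ℝ (Horiz d) ℝ) (x, z) := by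
      refine (HasFDerivAt.comp (g := fun y : Horiz d => ‖y‖⁻¹ • y) (f := Prod.fst) (x, z)
        hN.hasFDerivAt hasFDerivAt_fst).congr_of_eventuallyEq ?_
      filter_upwards [(isOpen_compl_singleton.prod isOpen_univ).mem_nhds
        (⟨hx, mem_univ z⟩ : (x, z) ∈ ({0}ᶜ : Set (Horiz d)) ×ˢ univ)] with p hp
      exact coe_toSphere hp.1
    rw [h6.fderiv] at h5
    exact fderiv_toSphere_eq_zero hx (h5.trans (map_zero _))
  injOn := fun z hz x hx y hy hxy => by
    have hn : ∀ {x : Horiz d}, x ∈ Metric.sphere (0 : Horiz d) 1 → ((toSphere x : USphere d) : Horiz d) = x :=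
      fun {x} hx => congrArg Subtype.val (toSphere_coe ⟨x, hx⟩)
    have h1 : (tubeDomain d).domRestrict (tubeMap c α) ⟨(toSphere x, z), mem_univ _, hz⟩
        = (tubeDomain d).domRestrict (tubeMap c α) ⟨(toSphere y, z), mem_univ _, hz⟩ := by
      change WithLp.toLp 2 (tubeFn c α (x, z), z) = WithLp.toLp 2 (tubeFn c α (y, z), z)
      rw [show tubeFn c α (x, z) = tubeFn c α (y, z) from hxy]
    have h2 := congrArg (fun p => ((p : USphere d × ℝ).1 : Horiz d)) (Subtype.ext_iff.1 (ht.isEmbedding.injective h1))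
    simp only [hn hx, hn hy] at h2
    exact h2
  ovaloid := fun z hz => by
    rw [slice_tubeFn]
    exact (ht.ovaloid z hz).affine_image (ContinuousLinearEquiv.refl ℝ _) (c z)

end IsTransverselyConvexTube

end Tube

/-! ### Tilted cross-cuts of a tube -/

section TiltedPlane

variable {E : Type*} [NormedAddCommGroup E] [InnerProductSpace ℝ E]

/-- A normal vector of the plane `z = a + ⟨w, y⟩`. -/
def tiltNormal (w : E) : WithLp 2 (E × ℝ) := WithLp.toLp 2 (-w, 1)

theorem inner_tiltNormal (w y : E) (z : ℝ) :
    ⟪tiltNormal w, WithLp.toLp 2 (y, z)⟫_ℝ = z - ⟪w, y⟫_ℝ := by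
  rw [tiltNormal, WithLp.prod_inner_apply]
  simp
  ring

theorem tiltNormal_ne_zero (w : E) : tiltNormal w ≠ 0 := fun h => by
  have := congrArg (fun p : WithLp 2 (E × ℝ) => p.snd) h
  simp [tiltNormal] at this

theorem toLp_mem_hyperplane_tiltNormal {w y : E} {a z : ℝ} :
    WithLp.toLp 2 (y, z) ∈ hyperplane (tiltNormal w) a ↔ z = a + ⟪w, y⟫_ℝ := by
  rw [hyperplane, mem_ofPred_eq, inner_tiltNormal, sub_eq_iff_eq_add]

/-- The parallel plane through the origin as the graph of `y ↦ ⟨w, y⟩`. -/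
noncomputable def tiltEquiv [FiniteDimensional ℝ E] (w : E) :
    E ≃L[ℝ] ((ℝ ∙ tiltNormal w)ᗮ : Submodule ℝ (WithLp 2 (E × ℝ))) :=
  LinearEquiv.toContinuousLinearEquiv
    { toFun := fun y => ⟨WithLp.toLp 2 (y, ⟪w, y⟫_ℝ), by
        rw [Submodule.mem_orthogonal_singleton_iff_inner_right, inner_tiltNormal, sub_self]⟩
      map_add' := fun x y => by
        ext1
        simp [inner_add_right, ← WithLp.toLp_add]
      map_smul' := fun r y => by
        ext1
        simp [inner_smul_right, ← WithLp.toLp_smul]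
      invFun := fun y => (y : WithLp 2 (E × ℝ)).fst
      left_inv := fun y => rfl
      right_inv := fun y => by
        have h := Submodule.mem_orthogonal_singleton_iff_inner_right.1 y.2
        have h2 : (y : WithLp 2 (E × ℝ)) = WithLp.toLp 2 ((y : WithLp 2 (E × ℝ)).fst,
          (y : WithLp 2 (E × ℝ)).snd) := rfl
        rw [h2, inner_tiltNormal, sub_eq_zero] at h
        ext1
        rw [h2, h] }

theorem coe_tiltEquiv [FiniteDimensional ℝ E] (w y : E) :
    (tiltEquiv w y : WithLp 2 (E × ℝ)) = WithLp.toLp 2 (y, ⟪w, y⟫_ℝ) := rfl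

variable [FiniteDimensional ℝ E] [CompleteSpace E]

/-- With (0, a) as origin, the graph map onto the plane direction is linear, and affine invariance
of ovaloids applies. -/
theorem isOvaloidInHyperplane_graph {O : Set E} (hO : IsOvaloid O) (w : E) (a : ℝ) :
    IsOvaloidInHyperplane (tiltNormal w) a ((fun y => WithLp.toLp 2 (y, a + ⟪w, y⟫_ℝ)) '' O) := by
  refine ⟨?_, WithLp.toLp 2 (0, a), by simp [toLp_mem_hyperplane_tiltNormal], ?_⟩
  · rintro _ ⟨y, -, rfl⟩
    exact toLp_mem_hyperplane_tiltNormal.2 rfl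
  · convert hO.affine_image (tiltEquiv w) 0 using 1
    ext y
    obtain ⟨y, rfl⟩ := (tiltEquiv w).surjective y
    have h1 : WithLp.toLp 2 ((0 : E), a) + (tiltEquiv w y : WithLp 2 (E × ℝ))
        = WithLp.toLp 2 (y, a + ⟪w, y⟫_ℝ) := by
      rw [coe_tiltEquiv, ← WithLp.toLp_add]
      simp
    simp only [mem_ofPred_eq, h1, zero_add]
    constructor
    · rintro ⟨y', hy', h⟩
      have : y' = y := congrArg (fun p : WithLp 2 (E × ℝ) => p.fst) h
      exact ⟨y, this ▸ hy', rfl⟩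
    · rintro ⟨y', hy', h⟩
      exact ⟨y, (tiltEquiv w).injective h ▸ hy', rfl⟩

/-- Vertical projection commutes with point reflection, so the centre of the projected section is
the projection of the centre. -/
theorem exists_center_of_isCentral_graph {O : Set E} {w : E} {a : ℝ}
    (h : IsCentral ((fun y => WithLp.toLp 2 (y, a + ⟪w, y⟫_ℝ)) '' O)) :
    ∃ b : E, ∀ y ∈ O, (2 : ℝ) • b - y ∈ O := by
  obtain ⟨p, hp⟩ := h
  refine ⟨p.fst, fun y hy => ?_⟩
  obtain ⟨y', hy', h⟩ := hp _ ⟨y, hy, rfl⟩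
  have h1 := congrArg (fun q : WithLp 2 (E × ℝ) => q.fst) h
  simp only [Equiv.pointReflection_apply, vsub_eq_sub, vadd_eq_add] at h1
  have h2 : y' = p.fst - y + p.fst := h1
  rw [h2] at hy'
  convert hy' using 1
  module

end TiltedPlane

/-! ### Cross-cuts by tilted planes and the passage to central symmetry -/

section CrossCut

variable {d : ℕ} {c : ℝ → Horiz d} {α : USphere d → ℝ → Horiz d} {z₀ η : ℝ}

/-- The part near height `z₀` of the preimage of the plane `z = a + ⟨w, y⟩`. -/
def tiltCut (c : ℝ → Horiz d) (α : USphere d → ℝ → Horiz d) (z₀ η : ℝ) (w : Horiz d) (a : ℝ) :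
    Set (USphere d × ℝ) :=
  {q | q.2 ∈ Icc (z₀ - η) (z₀ + η) ∧ q.2 = a + ⟪w, c q.2 + α q.1 q.2⟫_ℝ}

theorem image_tiltCut (w : Horiz d) (a : ℝ) : tubeMap c α '' tiltCut c α z₀ η w a
    = (fun y => WithLp.toLp 2 (y, a + ⟪w, y⟫_ℝ)) '' tiltSet (tubeFn c α) z₀ η w a := by
  ext x
  constructor
  · rintro ⟨⟨u, z⟩, ⟨h1, h2⟩, rfl⟩
    dsimp only at h1 h2
    refine ⟨c z + α u z, ⟨h2 ▸ h1, ?_⟩, ?_⟩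
    · rw [← h2, IsTransverselyConvexTube.slice_tubeFn]
      exact ⟨_, ⟨u, rfl⟩, rfl⟩
    · simp only [← h2, tubeMap]
  · rintro ⟨y, ⟨h1, h2⟩, rfl⟩
    set z := a + ⟪w, y⟫_ℝ with hz
    rw [IsTransverselyConvexTube.slice_tubeFn] at h2
    obtain ⟨_, ⟨u, rfl⟩, h2⟩ := h2
    dsimp only at h2
    refine ⟨(u, z), ⟨h1, ?_⟩, ?_⟩
    · dsimp only
      rw [h2]
    · simp only [tubeMap, h2]
      rfl

theorem TiltBox.isCompact_tiltCut {I : Set ℝ} {m w : Horiz d} {R L δ ε a : ℝ}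
    (hB : TiltBox (tubeFn c α) I z₀ m η R L δ ε) (ha : Admissible z₀ η R L δ ε w a)
    (hrank : 1 < Module.rank ℝ (Horiz d)) :
    IsCompact (tiltCut c α z₀ η w a) ∧ IsConnected (tiltCut c α z₀ η w a) := by
  obtain ⟨ζ, hζc, hζ⟩ := hB.exists_height ha
  have hcont : Continuous fun u : USphere d => ((u, ζ u) : USphere d × ℝ) :=
    continuous_id.prodMk (continuousOn_iff_continuous_domRestrict.1 hζc)
  have heq : tiltCut c α z₀ η w a = range fun u : USphere d => ((u, ζ u) : USphere d × ℝ) := by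
    ext ⟨u, z⟩
    have hf : ∀ z, tubeFn c α ((u : Horiz d), z) = c z + α u z := fun z => by
      simp only [tubeFn, toSphere_coe]
    constructor
    · rintro ⟨h1, h2⟩
      have h3 := ((hζ u u.2).2 z h1).1 (by rw [hf]; exact h2)
      exact ⟨u, Prod.ext rfl h3.symm⟩
    · rintro ⟨u', h⟩
      obtain ⟨rfl, rfl⟩ := Prod.ext_iff.1 h
      refine ⟨(hζ u' u'.2).1, ?_⟩
      have h3 := ((hζ u' u'.2).2 _ (hζ u' u'.2).1).2 rfl
      rwa [hf] at h3
  have : CompactSpace (USphere d) := isCompact_iff_compactSpace.1 (isCompact_sphere 0 1)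
  have : ConnectedSpace (USphere d) :=
    isConnected_iff_connectedSpace.1 (isConnected_sphere hrank 0 zero_le_one)
  rw [heq]
  exact ⟨isCompact_range hcont, isConnected_range hcont⟩

/-- The part near height z₀ is connected, being a graph over the sphere, and its heights avoid the
ends of the interval. Heights inside the open interval and heights off the closed one thus separate
it from the rest of the preimage. -/
theorem TiltBox.tiltCut_eq_connectedComponentIn {m w : Horiz d} {R L δ ε a : ℝ}
    (hB : TiltBox (tubeFn c α) (Ioo (-1) 1) z₀ m η R L δ ε) (ha : Admissible z₀ η R L δ ε w a)
    (hrank : 1 < Module.rank ℝ (Horiz d)) :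
    ∃ p ∈ tubeDomain d ∩ tubeMap c α ⁻¹' hyperplane (tiltNormal w) a, tiltCut c α z₀ η w a
      = connectedComponentIn (tubeDomain d ∩ tubeMap c α ⁻¹' hyperplane (tiltNormal w) a) p := by
  have hC := (hB.isCompact_tiltCut ha hrank).2
  set K := tubeDomain d ∩ tubeMap c α ⁻¹' hyperplane (tiltNormal w) a with hK
  have hmemK : ∀ q : USphere d × ℝ, q ∈ K ↔ q.2 ∈ Ioo (-1 : ℝ) 1 ∧ q.2 = a + ⟪w, c q.2 + α q.1 q.2⟫_ℝ :=
    fun q => by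
      rw [hK, mem_inter_iff, mem_preimage, tubeMap, toLp_mem_hyperplane_tiltNormal, tubeDomain]
      simp
  have hCK : tiltCut c α z₀ η w a ⊆ K := fun q hq => (hmemK q).2 ⟨hB.subset hq.1, hq.2⟩
  have hCo : ∀ q ∈ tiltCut c α z₀ η w a, q.2 ∈ Ioo (z₀ - η) (z₀ + η) := fun q hq => by
    have h1 : c q.2 + α q.1 q.2 ∈ tiltSet (tubeFn c α) z₀ η w a := by
      refine ⟨hq.2 ▸ hq.1, ?_⟩
      rw [← hq.2, IsTransverselyConvexTube.slice_tubeFn]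
      exact ⟨_, ⟨q.1, rfl⟩, rfl⟩
    have h2 := ha.height_mem ((hB.norm_le_of_mem_tiltSet h1).trans_lt (lt_add_one R))
    rwa [← hq.2] at h2
  obtain ⟨p, hp⟩ := hC.nonempty
  refine ⟨p, hCK hp, Subset.antisymm (hC.isPreconnected.subset_connectedComponentIn hp hCK) ?_⟩
  have hsub := connectedComponentIn_subset K p
  have h := (isPreconnected_connectedComponentIn (x := p) (F := K)).subset_left_of_subset_union
    (u := {q : USphere d × ℝ | q.2 ∈ Ioo (z₀ - η) (z₀ + η)})
    (v := {q : USphere d × ℝ | q.2 ∈ (Icc (z₀ - η) (z₀ + η))ᶜ})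
    (isOpen_Ioo.preimage continuous_snd) (isClosed_Icc.isOpen_compl.preimage continuous_snd)
    (disjoint_left.2 fun q h1 h2 => h2 (Ioo_subset_Icc_self h1))
    (fun q hq => by
      by_cases h : q.2 ∈ Icc (z₀ - η) (z₀ + η)
      · exact Or.inl (hCo q ⟨h, ((hmemK q).1 (hsub hq)).2⟩)
      · exact Or.inr h)
    ⟨p, mem_connectedComponentIn (hCK hp), hCo p hp⟩
  exact fun q hq => ⟨Ioo_subset_Icc_self (h hq), ((hmemK q).1 (hsub hq)).2⟩

/-- The plane direction has codimension one, so a single tangent vector of the tube with nonzero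
component along the normal already spans a complement. -/
theorem IsTransverselyConvexTube.isTransversal_tiltNormal (ht : IsTransverselyConvexTube c α)
    {w : Horiz d} {a : ℝ}
    (h : ∀ x, ‖x‖ = 1 → ∀ z ∈ Ioo (-1 : ℝ) 1, z = a + ⟪w, tubeFn c α (x, z)⟫_ℝ →
      ∃ (ξ : Horiz d) (r : ℝ), r ≠ ⟪w, fderiv ℝ (tubeFn c α) (x, z) (ξ, r)⟫_ℝ) :
    IsTransversal (tubeModel d) (tubeMap c α) (tubeDomain d) (tiltNormal w) a := by
  rintro ⟨u, z⟩ ⟨-, hz⟩ hp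
  have hu : ‖(u : Horiz d)‖ = 1 := by simp
  have hu0 : (u : Horiz d) ≠ 0 := by intro h; simp [h] at hu
  have hf : tubeFn c α ((u : Horiz d), z) = c z + α u z := by simp only [tubeFn, toSphere_coe]
  obtain ⟨ξ, r, hne⟩ := h u hu z hz (by rw [hf]; exact toLp_mem_hyperplane_tiltNormal.1 hp)
  have h1 := ht.mvfderiv_tubeMap hu0 hz (ξ, r)
  rw [show toSphereProd ((u : Horiz d), z) = (u, z) from Prod.ext (toSphere_coe u) rfl] at h1
  set q : Ambient d := WithLp.toLp 2 (fderiv ℝ (tubeFn c α) ((u : Horiz d), z) (ξ, r), r) with hq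
  have h2 : ⟪tiltNormal w, q⟫_ℝ ≠ 0 := by
    rw [hq, inner_tiltNormal]
    exact sub_ne_zero.2 hne
  rw [eq_top_iff]
  rintro y -
  set s := ⟪tiltNormal w, y⟫_ℝ / ⟪tiltNormal w, q⟫_ℝ with hs
  have h3 : y = s • q + (y - s • q) := by module
  rw [h3]
  refine Submodule.add_mem_sup (Submodule.smul_mem _ _ ⟨_, h1⟩) ?_
  rw [Submodule.mem_orthogonal_singleton_iff_inner_right, inner_sub_right, inner_smul_right, hs,
    div_mul_cancel₀ _ h2, sub_self]

/-- For every plane of the dense transversal set, the part of the preimage near z₀ is a cross-cut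
whose image is an ovaloid, so the central ovaloid property applies to it. The bound on d makes the
sphere connected. -/
theorem IsTransverselyConvexTube.hasCentralTilts (ht : IsTransverselyConvexTube c α) (hd : 1 ≤ d)
    (hcop : HasCop (tubeModel d) (tubeMap c α) (tubeDomain d)) :
    HasCentralTilts (tubeFn c α) (Ioo (-1) 1) := by
  have hrank : 1 < Module.rank ℝ (Horiz d) := by
    rw [← Module.finrank_eq_rank, finrank_euclideanSpace_fin]
    exact_mod_cast Nat.lt_succ_of_le hd
  intro z₀ m η R L δ ε hB
  refine ⟨_, ht.ovaloidFamily.dense_transversal, fun p hp ha => ?_⟩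
  have hcut : IsCrossCut (tubeModel d) (tubeMap c α) (tubeDomain d) (tiltNormal p.1) p.2
      (tiltCut c α z₀ η p.1 p.2) :=
    ⟨tiltNormal_ne_zero _, ht.isTransversal_tiltNormal hp,
      hB.tiltCut_eq_connectedComponentIn ha hrank, (hB.isCompact_tiltCut ha hrank).1⟩
  have hcent := hcop.2 _ _ _ hcut
  rw [image_tiltCut] at hcent
  exact exists_center_of_isCentral_graph
    (hcent (isOvaloidInHyperplane_graph (hB.isOvaloid_tiltSet hrank ha) _ _))

/-- The second factor u changes sign with the normal: -u · Γ(-u) is the support value at -u, so the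
odd part of Γ yields the even part of the support function. -/
theorem IsTransverselyConvexTube.transverseSupport_eq {u : Horiz d} (hu : ‖u‖ = 1) {z : ℝ}
    (hz : z ∈ Ioo (-1 : ℝ) 1) :
    transverseSupport (tube c α) u z = evenSupp (tubeFn c α) (u, z) := by
  simp only [transverseSupport, oddSupportMap, supportMap, evenSupp, suppFn]
  rw [crossSection_tube hz, OvaloidFamily.suppPt_of_norm_one hu,
    OvaloidFamily.suppPt_of_norm_one (by rwa [norm_neg]), inner_smul_right, inner_sub_right,
    inner_neg_left]
  ring

end CrossCut

theorem mainTheorem6 (d : ℕ) (hd : 1 ≤ d) (c : ℝ → Horiz d) (α : USphere d → ℝ → Horiz d)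
    (htube : IsTransverselyConvexTube c α)
    (hcop : HasCop (tubeModel d) (tubeMap c α) (tubeDomain d))
    (h : Horiz d → ℝ → ℝ) (hh : h = transverseSupport (tube c α)) :
    ContMDiffOn (tubeModel d) 𝓘(ℝ, ℝ) ∞
      (fun p : USphere d × ℝ => h (p.1 : Horiz d) p.2) (tubeDomain d) ∧
    ∀ u ∈ Metric.sphere (0 : Horiz d) 1, ∀ z ∈ Set.Ioo (-1 : ℝ) 1,
      dz h u z • sphGrad (fun v => radiiSum h v z) u
        + dz (radiiSum h) u z • sphGrad (fun v => h v z) u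
        + (2 : ℝ) • (h u z • sphGrad (fun v => dz h v z) u
            + sphCov (sphGrad (fun v => h v z)) u (sphGrad (fun v => dz h v z) u)) = 0 ∧
      h u z * dz (radiiSum h) u z - radiiSum h u z * dz h u z = 0 := by
  have hS := htube.ovaloidFamily
  have hC := htube.hasCentralTilts hd hcop
  -- The even part of the support function is the smooth extension of h, homogeneous of degree one,
  -- on which all the calculus is done.
  have hhg : ∀ v, ‖v‖ = 1 → ∀ z ∈ Ioo (-1 : ℝ) 1, h v z = evenSupp (tubeFn c α) (v, z) :=
    fun v hv z hz => by rw [hh, IsTransverselyConvexTube.transverseSupport_eq hv hz]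
  have hg : SmoothOffZero (Ioo (-1 : ℝ) 1) (evenSupp (tubeFn c α)) := fun v hv z hz =>
    hS.contDiffAt_evenSupp hv hz
  constructor
  · have hinc : ContMDiff (tubeModel d) 𝓘(ℝ, Horiz d × ℝ) ∞
        fun p : USphere d × ℝ => ((p.1 : Horiz d), p.2) :=
      (contMDiff_coe_usphere.comp contMDiff_fst).prodMk_space contMDiff_snd
    intro p hp
    have hp1 : ‖(p.1 : Horiz d)‖ = 1 := by simp
    have h1 := (hg (p.1 : Horiz d) (by intro h; simp [h] at hp1) p.2 hp.2).contMDiffAt.comp p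
      (hinc p)
    refine h1.contMDiffWithinAt.congr (fun q hq => ?_) ?_
    · exact hhg q.1 (by simp) q.2 hq.2
    · exact hhg p.1 (by simp) p.2 hp.2
  · intro u hu z hz
    exact sphere_equations isOpen_Ioo hg OvaloidFamily.isPosHomog_evenSupp hhg
      (fun z hz w x y hx hy hxy => hS.evenSupp_product_add hC hx hy hxy hz w) (by simpa using hu) hz
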